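/- Let $K\subset\mathbb R^3$ be a nondegenerate tetrahedron, and let $k\ge 3$ and $\ell\ge\max\{k-1,3\}$ be integers. For a set $S$ let $\mathbb P_m(S)$ be the space of restrictions to $S$ of real polynomials in $x=(x_1,x_2,x_3)^{\intercal}$ of total degree at most $m$. Let $\mathbb P_m(K;\mathbb T)$ be the space of trace-free $3\times 3$ matrix fields with entries in $\mathbb P_m(K)$. For matrix fields, $\operatorname{curl}A$ and $A\times x$ are taken row by row, $\operatorname{sym}A=\frac12(A+A^{\intercal})$, and $(\cdot,\cdot)_S$ is the $L^2(S)$ inner product (for matrices with the Frobenius product). For each face $F$ of $K$ fix a unit normal vector $n=n_F$, and put $\partial_n=n\cdot\nabla$, $\nabla_F=\nabla-n\,\partial_n$ and $\operatorname{div}_F u=\nabla_F\cdot u$. For each edge $e$ fix two linearly independent vectors $n_1,n_2$ orthogonal to $e$. Fix an arbitrary face $F_1$ of $K$. Let $$\Sigma_{\ell,k}(K)=\operatorname{sym}\operatorname{curl}\,\mathbb P_{\ell+1}(K;\mathbb T)+x x^{\intercal}\,\mathbb P_{k-2}(K).$$ **Theorem.** The sum defining $\Sigma_{\ell,k}(K)$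 is direct, and the following degrees of freedom of $\tau\in\Sigma_{\ell,k}(K)$ are unisolvent: 1. $\tau(\delta)$ for every vertex $\delta$ of $K$; 2. $(n_i^{\intercal}\tau n_j,q)_e$ for all $q\in\mathbb P_{\ell-2}(e)$, every edge $e$ and $1\le i\le j\le 2$; 3. $(n^{\intercal}\tau n,q)_F$ for all $q\in\mathbb P_{\ell-3}(F)$ and every face $F$; 4. $(2\operatorname{div}_F(\tau n)+\partial_n(n^{\intercal}\tau n),q)_F$ for all $q\in\mathbb P_{\ell-1}(F)$ and every face $F$; 5. $(\tau,\varsigma)_K$ for all $\varsigma\in\nabla^2\mathbb P_{k-2}(K)$; 6. $(\tau,\varsigma)_K$ for all $\varsigma\in\operatorname{sym}(\mathbb P_{\ell-2}(K;\mathbb T)\times x)$; 7. $(\tau n,\ n\times x\,q)_{F_1}$ for all $q\in\mathbb P_{\ell-2}(F_1)$. Unisolvent means: given any symmetric matrix at each vertex, and any linear functional on each of the spaces of test functions in 2–7 (one for each edge and pair $i\le j$ in 2, one for each face in 3 and 4), there is exactly one $\tau\in\Sigma_{\ell,k}(K)$ whose degrees of freedom take these values. Moreover, the traces that have to be single-valued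 for $H(\operatorname{div}\operatorname{div})$-conformity are determined locally. Let $\tau\in\Sigma_{\ell,k}(K)$. If the values 1 at the two endpoints of an edge $e$ and the moments 2 on $e$ vanish, then $n_i^{\intercal}\tau n_j|_e=0$ for $i,j=1,2$. If the values 1 at the vertices of a face $F$, the moments 2 on the edges of $F$ and the moments 3 and 4 on $F$ vanish, then $n^{\intercal}\tau n|_F=0$ and $(2\operatorname{div}_F(\tau n)+\partial_n(n^{\intercal}\tau n))|_F=0$. -/

import Mathlib

open scoped Matrix

noncomputable section

namespace DivDiv

/-- Points and vectors of `ℝ³`; Euclidean products and lengths are written with `⬝ᵥ`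
and `len`, since the norm that Mathlib puts on this type is the sup norm. -/
abbrev Vec := Fin 3 → ℝ

/-- Real polynomials in the three coordinates of `ℝ³`. -/
abbrev Poly := MvPolynomial (Fin 3) ℝ

/-- Polynomial tensor fields (`3 × 3` matrices of polynomials). A polynomial tensor field on a
tetrahedron determines its polynomial coefficients, so the two are identified. -/
abbrev Tensor := Matrix (Fin 3) (Fin 3) Poly

/-- Euclidean length. -/
def len (a : Vec) : ℝ := √(a ⬝ᵥ a)

/-- A constant vector regarded as a vector of polynomials. -/
def const (a : Vec) : Fin 3 → Poly := fun i => MvPolynomial.C (a i)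

/-- The position vector `x`. -/
def pos : Fin 3 → Poly := fun i => MvPolynomial.X i

/-- The value of a polynomial tensor field at a point. -/
def value (τ : Tensor) (x : Vec) : Matrix (Fin 3) (Fin 3) ℝ :=
  τ.map (MvPolynomial.eval x)

/-! ### Differential and algebraic operators on polynomial fields -/

/-- The curl of a polynomial vector field. -/
def curlVec (u : Fin 3 → Poly) : Fin 3 → Poly :=
  ![MvPolynomial.pderiv 1 (u 2) - MvPolynomial.pderiv 2 (u 1),
    MvPolynomial.pderiv 2 (u 0) - MvPolynomial.pderiv 0 (u 2),
    MvPolynomial.pderiv 0 (u 1) - MvPolynomial.pderiv 1 (u 0)]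

/-- The row-wise curl of a tensor field. -/
def curl (A : Tensor) : Tensor := Matrix.of fun i => curlVec (A i)

/-- The symmetric part of a tensor field. -/
def sym (A : Tensor) : Tensor := (1 / 2 : ℝ) • (A + Aᵀ)

/-- The row-wise cross product `A × x` with the position vector. -/
def crossPos (A : Tensor) : Tensor := Matrix.of fun i => A i ⨯₃ pos

/-- The Hessian `∇² p`. -/
def hess (p : Poly) : Tensor :=
  Matrix.of fun i j => MvPolynomial.pderiv i (MvPolynomial.pderiv j p)

/-- The derivative `∂ₙ p = n · ∇ p` in the direction of a constant vector. -/
def dirDeriv (n : Vec) (p : Poly) : Poly := const n ⬝ᵥ fun a => MvPolynomial.pderiv a p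

/-- The surface divergence `∇_F · u`, where `∇_F = ∇ - n ∂ₙ` for a plane with unit normal `n`. -/
def divF (n : Vec) (u : Fin 3 → Poly) : Poly :=
  ∑ a, (MvPolynomial.pderiv a (u a) - const n a * dirDeriv n (u a))

/-- The scalar field `aᵀ τ b` for constant vectors `a`, `b`. -/
def comp (a : Vec) (τ : Tensor) (b : Vec) : Poly := const a ⬝ᵥ (τ *ᵥ const b)

/-- The second trace `2 div_F (τ n) + ∂ₙ (nᵀ τ n)`. -/
def trace₂ (n : Vec) (τ : Tensor) : Poly :=
  2 * divF n (τ *ᵥ const n) + dirDeriv n (comp n τ n)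

/-- `A ↦ sym curl A`, as a linear map. -/
def symCurl : Tensor →ₗ[ℝ] Tensor where
  toFun A := sym (curl A)
  map_add' A B := by
    ext1 i j
    fin_cases i <;> fin_cases j <;>
      simp [sym, curl, curlVec, Matrix.add_apply, ← smul_add] <;> ring_nf
  map_smul' c A := by
    ext1 i j
    fin_cases i <;> fin_cases j <;>
      simp [sym, curl, curlVec, smul_comm c, smul_sub]

/-- `A ↦ sym (A × x)`, as a linear map. -/
def symCross : Tensor →ₗ[ℝ] Tensor where
  toFun A := sym (crossPos A)
  map_add' A B := by
    ext1 i j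
    fin_cases i <;> fin_cases j <;>
      simp [sym, crossPos, cross_apply, Matrix.add_apply, ← smul_add] <;> ring_nf
  map_smul' c A := by
    ext1 i j
    fin_cases i <;> fin_cases j <;>
      simp [sym, crossPos, cross_apply, smul_comm c, smul_sub]

/-- `p ↦ ∇² p`, as a linear map. -/
def hessLin : Poly →ₗ[ℝ] Tensor where
  toFun := hess
  map_add' p q := by ext1 i j; simp [hess]
  map_smul' c p := by ext1 i j; simp [hess]

/-- `q ↦ x xᵀ q`, as a linear map. -/
def posPos : Poly →ₗ[ℝ] Tensor where
  toFun q := Matrix.of fun i j => pos i * pos j * q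
  map_add' p q := by ext1 i j; simp [mul_add]
  map_smul' c p := by ext1 i j; simp

/-! ### Polynomial spaces -/

/-- Scalar polynomials of total degree at most `m`. -/
abbrev polys (m : ℕ) : Submodule ℝ Poly := MvPolynomial.restrictTotalDegree (Fin 3) ℝ m

/-- Trace-free tensor fields with entries of total degree at most `m`. -/
def polysT (m : ℕ) : Submodule ℝ Tensor where
  carrier := {A | (∀ i j, A i j ∈ polys m) ∧ A.trace = 0}
  add_mem' := by
    rintro A B ⟨hA, hA'⟩ ⟨hB, hB'⟩
    exact ⟨fun i j => (polys m).add_mem (hA i j) (hB i j), by simp [hA', hB']⟩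
  zero_mem' := ⟨fun _ _ => (polys m).zero_mem, by simp⟩
  smul_mem' := by
    rintro c A ⟨hA, hA'⟩
    exact ⟨fun i j => (polys m).smul_mem c (hA i j), by simp [hA']⟩

/-- `sym curl P_{ℓ+1}(T)`. -/
def curlPart (l : ℕ) : Submodule ℝ Tensor := (polysT (l + 1)).map symCurl

/-- `x xᵀ P_{k-2}`, for `2 ≤ k`. -/
def radialPart (k : ℕ) : Submodule ℝ Tensor := (polys (k - 2)).map posPos

/-- The space of shape functions `sym curl P_{ℓ+1}(T) + x xᵀ P_{k-2}`. -/
def shape (l k : ℕ) : Submodule ℝ Tensor := curlPart l ⊔ radialPart k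

/-- `∇² P_m`. -/
def hessSpace (m : ℕ) : Submodule ℝ Tensor := (polys m).map hessLin

/-- `sym (P_m(T) × x)`. -/
def symCrossSpace (m : ℕ) : Submodule ℝ Tensor := (polysT m).map symCross

/-- The restriction of a polynomial to a set `S`; functions on `S` are represented by their
extension by zero to all of `ℝ³`. -/
def restrictTo (S : Set Vec) : Poly →ₗ[ℝ] (Vec → ℝ) where
  toFun p := S.indicator fun x => MvPolynomial.eval x p
  map_add' p q := by
    ext x
    by_cases hx : x ∈ S <;> simp [hx]
  map_smul' c p := by
    ext x
    by_cases hx : x ∈ S <;> simp [hx]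

/-- `P_m(S)`: the functions on `S` that are restrictions of polynomials of degree at most `m`. -/
def polysOn (S : Set Vec) (m : ℕ) : Submodule ℝ (Vec → ℝ) := (polys m).map (restrictTo S)

/-! ### The tetrahedron, its faces and edges, and integrals over them

The tetrahedron is given by its four vertices `v 0, …, v 3`. -/

/-- The closed tetrahedron. -/
def tet (v : Fin 4 → Vec) : Set Vec := convexHull ℝ (Set.range v)

/-- The face opposite to the vertex `v i`; its vertices are `v (i.succAbove r)`, `r = 0, 1, 2`. -/
def face (v : Fin 4 → Vec) (i : Fin 4) : Set Vec :=
  convexHull ℝ (Set.range fun r : Fin 3 => v (i.succAbove r))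

/-- The six edges, as pairs of distinct vertices in increasing order. -/
abbrev Edge := {p : Fin 4 × Fin 4 // p.1 < p.2}

/-- The edge as a set of points. -/
def edge (v : Fin 4 → Vec) (e : Edge) : Set Vec := segment ℝ (v e.1.1) (v e.1.2)

/-- `n` is a unit normal vector of the face opposite to `v i`. -/
def IsUnitNormal (v : Fin 4 → Vec) (i : Fin 4) (n : Vec) : Prop :=
  n ⬝ᵥ n = 1 ∧ ∀ r s : Fin 3, n ⬝ᵥ (v (i.succAbove r) - v (i.succAbove s)) = 0

/-- `m 0`, `m 1` are two linearly independent vectors orthogonal to the edge `e`. -/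
def IsNormalPair (v : Fin 4 → Vec) (e : Edge) (m : Fin 2 → Vec) : Prop :=
  LinearIndependent ℝ m ∧ ∀ a, m a ⬝ᵥ (v e.1.2 - v e.1.1) = 0

/-- The arc length integral of `f` over an edge. -/
def edgeIntegral (v : Fin 4 → Vec) (e : Edge) (f : Vec → ℝ) : ℝ :=
  len (v e.1.2 - v e.1.1) * ∫ t in (0 : ℝ)..1, f (v e.1.1 + t • (v e.1.2 - v e.1.1))

/-- The surface integral of `f` over a face, through its affine parametrization over the triangle
`0 ≤ s`, `0 ≤ t`, `s + t ≤ 1`. -/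
def faceIntegral (v : Fin 4 → Vec) (i : Fin 4) (f : Vec → ℝ) : ℝ :=
  len ((v (i.succAbove 1) - v (i.succAbove 0)) ⨯₃ (v (i.succAbove 2) - v (i.succAbove 0))) *
    ∫ s in (0 : ℝ)..1, ∫ t in (0 : ℝ)..(1 - s),
      f (v (i.succAbove 0) + s • (v (i.succAbove 1) - v (i.succAbove 0))
        + t • (v (i.succAbove 2) - v (i.succAbove 0)))

/-! ### Degrees of freedom -/

/-- `(aᵀ τ b, q)_e`. -/
def edgeMoment (v : Fin 4 → Vec) (e : Edge) (a b : Vec) (τ : Tensor) (q : Vec → ℝ) : ℝ :=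
  edgeIntegral v e fun x => MvPolynomial.eval x (comp a τ b) * q x

/-- `(nᵀ τ n, q)_F`. -/
def normalMoment (v : Fin 4 → Vec) (i : Fin 4) (n : Vec) (τ : Tensor) (q : Vec → ℝ) : ℝ :=
  faceIntegral v i fun x => MvPolynomial.eval x (comp n τ n) * q x

/-- `(2 div_F (τ n) + ∂ₙ (nᵀ τ n), q)_F`. -/
def trace₂Moment (v : Fin 4 → Vec) (i : Fin 4) (n : Vec) (τ : Tensor) (q : Vec → ℝ) : ℝ :=
  faceIntegral v i fun x => MvPolynomial.eval x (trace₂ n τ) * q x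

/-- `(τ n, n × x q)_F`. -/
def tangentialMoment (v : Fin 4 → Vec) (i : Fin 4) (n : Vec) (τ : Tensor) (q : Vec → ℝ) : ℝ :=
  faceIntegral v i fun x => (value τ x *ᵥ n) ⬝ᵥ (q x • (n ⨯₃ x))

/-- `(τ, ς)_K`, the integral of the Frobenius product over the tetrahedron. -/
def interiorMoment (v : Fin 4 → Vec) (τ ς : Tensor) : ℝ :=
  ∫ x in tet v, ∑ i, ∑ j, value τ x i j * value ς x i j

end DivDiv

end

namespace DivDiv

open MvPolynomial

/-! ### Polynomial degrees -/

section Degree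

variable {σ : Type*} {m k : ℕ} {p q : MvPolynomial σ ℝ}

/-! The degrees of freedom form one linear map on the finite-dimensional space `shape l k`. It is
injective, and its target is no larger than its source, so it is bijective. One-sided dimension
bounds suffice, because injectivity supplies the reverse inequality.

The algebra rests on two homotopy formulas for homogeneous symmetric fields. For the divdiv complex,
a divdiv-free `S` is recovered from `S × x` by sym curl, up to a term which a second application
removes (`mem_curlPart_of_eul`). Moreover div div acts on `x xᵀ q` by multiplying the part of `q` of
degree d by (d + 3)(d + 4) > 0. Hence the sum is direct, and symmetric fields of degree l lie in sym
curl P_{l+1}(T) + x xᵀ P_{l-2}, which bounds the dimension of the curl part from below. The Hessian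
complex is treated in the same way, with `curl S` and the quadratic form `xᵀ S x`: every symmetric
field is a Hessian plus some sym(A × x) (`symT_le_hessSpace_sup_symCrossSpace`).

For the traces, `n · x` is constant on a face and likewise on an edge for vectors orthogonal to it,
so there the radial part contributes only degree k - 2 ≤ l - 1. Bernstein forms show that a
polynomial vanishing on subfaces is divisible by the corresponding barycentric coordinates; testing
with the quotient then shows that it is zero (`Bary.vanish_of_moments`).

Suppose all degrees of freedom of τ vanish. The traces vanish, so Green's identity
(`faceFun_divDiv_mul`) gives (div div τ, q) = (τ, ∇²q). With q = div div τ, moments 5 give div div τ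
= 0, and the radial part is zero. Now τ is orthogonal to every Hessian, by moments 6 to the fields
sym(A × x), and so to all symmetric fields of degree l - 1. Since nᵀτn is divisible by the
barycentric coordinate of its face, it vanishes identically. On F₁ the field τn has zero surface
divergence and zero flux through the edges, so it is orthogonal to gradients; with moments 7 it is
orthogonal to all tangential fields of degree l - 1 (`faceFun_tangential`). Divisibility again makes
τn vanish on F₁ and then everywhere. These components determine a symmetric matrix
(`eq_zero_of_comp_grad`), so τ = 0. -/

theorem mem_restrict_iff :
    p ∈ restrictTotalDegree σ ℝ m ↔ ∀ d, coeff d p ≠ 0 → d.degree ≤ m := by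
  rw [mem_restrictTotalDegree, totalDegree, Finset.sup_le_iff]
  simp only [mem_support_iff]
  rfl

theorem restrict_mono (h : m ≤ k) (hp : p ∈ restrictTotalDegree σ ℝ m) :
    p ∈ restrictTotalDegree σ ℝ k := by
  rw [mem_restrictTotalDegree] at *
  exact hp.trans h

theorem mul_mem_restrict (hp : p ∈ restrictTotalDegree σ ℝ m)
    (hq : q ∈ restrictTotalDegree σ ℝ k) : p * q ∈ restrictTotalDegree σ ℝ (m + k) := by
  rw [mem_restrictTotalDegree] at *
  exact (totalDegree_mul _ _).trans (add_le_add hp hq)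

theorem C_mul_mem_restrict (c : ℝ) (hp : p ∈ restrictTotalDegree σ ℝ m) :
    C c * p ∈ restrictTotalDegree σ ℝ m := by
  rw [← smul_eq_C_mul]
  exact Submodule.smul_mem _ _ hp

theorem C_mem_restrict (c : ℝ) : (C c : MvPolynomial σ ℝ) ∈ restrictTotalDegree σ ℝ m := by
  rw [mem_restrictTotalDegree]
  simp

theorem X_mem_restrict (i : σ) (hm : 1 ≤ m) :
    (X i : MvPolynomial σ ℝ) ∈ restrictTotalDegree σ ℝ m := by
  rw [mem_restrictTotalDegree]
  simpa using hm

theorem X_mul_mem_restrict (i : σ) (hp : p ∈ restrictTotalDegree σ ℝ m) :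
    X i * p ∈ restrictTotalDegree σ ℝ (m + 1) := by
  rw [add_comm]
  exact mul_mem_restrict (X_mem_restrict i le_rfl) hp

/-- The truncated subtraction is harmless at m = 0, where the derivative is zero. -/
theorem pderiv_mem_restrict (i : σ) (hp : p ∈ restrictTotalDegree σ ℝ m) :
    pderiv i p ∈ restrictTotalDegree σ ℝ (m - 1) := by
  rw [mem_restrict_iff] at *
  intro d hd
  rw [coeff_pderiv] at hd
  have h := hp _ (left_ne_zero_of_mul hd)
  rw [map_add, Finsupp.degree_single] at h
  omega

theorem mem_restrict_of_isHomogeneous (hp : p.IsHomogeneous m) :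
    p ∈ restrictTotalDegree σ ℝ m := by
  rw [mem_restrictTotalDegree]
  exact hp.totalDegree_le

theorem homogeneousComponent_mem_restrict (d : ℕ) (hp : p ∈ restrictTotalDegree σ ℝ m) :
    homogeneousComponent d p ∈ restrictTotalDegree σ ℝ m := by
  classical
  rw [mem_restrict_iff] at *
  intro e he
  rw [coeff_homogeneousComponent] at he
  split_ifs at he with h
  · exact hp _ he
  · exact absurd rfl he

theorem sum_range_homogeneousComponent (hp : p ∈ restrictTotalDegree σ ℝ m) :
    ∑ d ∈ Finset.range (m + 1), homogeneousComponent d p = p := by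
  rw [mem_restrictTotalDegree] at hp
  conv_rhs => rw [← sum_homogeneousComponent p]
  refine (Finset.sum_subset (Finset.range_mono (by omega)) fun d _ hd => ?_).symm
  exact homogeneousComponent_eq_zero _ _ (by simpa using hd)

end Degree

/-- The space of polynomials of degree at most `m` in `n` variables has dimension `(n + m).choose m`. -/
theorem finrank_restrictTotalDegree (n m : ℕ) :
    Module.finrank ℝ (restrictTotalDegree (Fin n) ℝ m) = (n + m).choose m := by
  have hb := Module.finrank_eq_nat_card_basis
    (basisRestrictSupport ℝ {d : Fin n →₀ ℕ | (d.sum fun _ e => e) ≤ m})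
  have hs : {d : Fin n →₀ ℕ | (d.sum fun _ e => e) ≤ m} =
      ((Finset.range (m + 1)).biUnion fun k =>
        (Finset.univ : Finset (Fin n)).finsuppAntidiag k : Finset (Fin n →₀ ℕ)) := by
    ext d
    simp only [Set.mem_ofPred_eq, Finset.coe_biUnion, Finset.mem_coe, Set.mem_iUnion,
      Finset.mem_range, Finset.mem_finsuppAntidiag]
    rw [Finsupp.sum_fintype _ _ fun _ => rfl]
    exact ⟨fun h => ⟨_, Nat.lt_succ_of_le h, rfl, Finset.subset_univ _⟩,
      fun ⟨k, hk, h, _⟩ => h ▸ Nat.le_of_lt_succ hk⟩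
  unfold restrictTotalDegree
  rw [hb, hs, Nat.card_coe_set_eq, Set.ncard_coe_finset, Finset.card_biUnion]
  · clear hb hs
    -- Summing the numbers of monomials of each exact degree is the hockey-stick identity.
    induction m with
    | zero => simp [Finset.card_finsuppAntidiag_nat_eq_choose]
    | succ m ih =>
      rw [Finset.sum_range_succ, ih, Finset.card_finsuppAntidiag_nat_eq_choose,
        Finset.card_univ, Fintype.card_fin, ← add_assoc, Nat.add_sub_cancel,
        ← Nat.choose_succ_succ]
  · intro a _ b _ hab
    rw [Function.onFun, Finset.disjoint_left]
    intro d ha hb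
    rw [Finset.mem_finsuppAntidiag] at ha hb
    exact hab (ha.1.symm.trans hb.1)

/-! ### Euler's identity -/

/-- `p` satisfies Euler's identity `x · ∇ p = c p`. -/
def Eul (c : ℝ) (p : Poly) : Prop :=
  X 0 * pderiv 0 p + X 1 * pderiv 1 p + X 2 * pderiv 2 p = C c * p

namespace Eul

variable {c : ℝ} {p q : Poly}

theorem of_isHomogeneous {d : ℕ} (h : p.IsHomogeneous d) : Eul d p := by
  have := h.sum_X_mul_pderiv
  rw [Fin.sum_univ_three] at this
  rw [Eul, this]
  simp

theorem add (hp : Eul c p) (hq : Eul c q) : Eul c (p + q) := by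
  unfold Eul at *
  simp only [map_add]
  linear_combination hp + hq

theorem sub (hp : Eul c p) (hq : Eul c q) : Eul c (p - q) := by
  unfold Eul at *
  simp only [map_sub]
  linear_combination hp - hq

theorem C_mul (a : ℝ) (hp : Eul c p) : Eul c (C a * p) := by
  unfold Eul at *
  simp only [pderiv_C_mul]
  linear_combination C a * hp

theorem mul {c' : ℝ} (hp : Eul c p) (hq : Eul c' q) : Eul (c + c') (p * q) := by
  unfold Eul at *
  simp only [pderiv_mul, map_add]
  linear_combination q * hp + p * hq

theorem X_one (i : Fin 3) : Eul 1 (X i) := by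
  unfold Eul
  fin_cases i <;> simp [pderiv_X]

theorem X_mul (i : Fin 3) (hp : Eul c p) : Eul (c + 1) (X i * p) := by
  rw [add_comm]
  exact (X_one i).mul hp

end Eul

theorem pderiv_comm (i j : Fin 3) (p : Poly) :
    pderiv i (pderiv j p) = pderiv j (pderiv i p) := by
  ext d
  simp only [coeff_pderiv]
  rcases eq_or_ne i j with rfl | h
  · rfl
  · rw [add_right_comm]
    simp [h, h.symm]
    ring

/-- The commutator of ∂ᵢ with x · ∇ is ∂ᵢ. The exponent c is real, so it drops by one even at c = 0,
where a natural number would be truncated. -/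
theorem Eul.pderiv {c : ℝ} {p : Poly} (i : Fin 3) (hp : Eul c p) :
    Eul (c - 1) (MvPolynomial.pderiv i p) := by
  have h := congrArg (MvPolynomial.pderiv i) hp
  unfold Eul
  simp only [map_add, pderiv_mul, pderiv_C, pderiv_X] at h
  simp only [pderiv_comm _ i, C_sub, C_1]
  fin_cases i <;> simp at h ⊢ <;> linear_combination h

theorem coeff_X_mul_pderiv (i : Fin 3) (p : Poly) (d : Fin 3 →₀ ℕ) :
    coeff d (X i * pderiv i p) = d i * coeff d p := by
  rw [coeff_X_mul']
  split_ifs with h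
  · rw [coeff_pderiv]
    have h1 : 1 ≤ d i := Nat.one_le_iff_ne_zero.2 (Finsupp.mem_support_iff.1 h)
    rw [tsub_add_cancel_of_le (Finsupp.single_le_iff.2 h1), mul_comm]
    congr 1
    simp [Finsupp.tsub_apply, Nat.cast_sub h1]
  · simp [Finsupp.notMem_support_iff.1 h]

/-- The Euler operator `x · ∇` multiplies the coefficient of a monomial by its degree. -/
theorem coeff_euler (p : Poly) (d : Fin 3 →₀ ℕ) :
    coeff d (X 0 * pderiv 0 p + X 1 * pderiv 1 p + X 2 * pderiv 2 p) = d.degree * coeff d p := by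
  simp only [coeff_add, coeff_X_mul_pderiv]
  rw [Finsupp.degree_eq_sum, Fin.sum_univ_three]
  push_cast
  ring

end DivDiv

namespace DivDiv

open MvPolynomial

/-! ### Symmetric tensor fields and the operators of the complexes -/

noncomputable section

/-- Symmetric tensor fields with entries of total degree at most `m`. -/
def symT (m : ℕ) : Submodule ℝ Tensor where
  carrier := {A | (∀ i j, A i j ∈ polys m) ∧ Aᵀ = A}
  add_mem' := by
    rintro A B ⟨hA, hA'⟩ ⟨hB, hB'⟩
    exact ⟨fun i j => (polys m).add_mem (hA i j) (hB i j), by simp [hA', hB']⟩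
  zero_mem' := ⟨fun _ _ => (polys m).zero_mem, by simp⟩
  smul_mem' := by
    rintro c A ⟨hA, hA'⟩
    exact ⟨fun i j => (polys m).smul_mem c (hA i j), by simp [hA']⟩

/-- The divergence of a polynomial vector field. -/
def divVec (u : Fin 3 → Poly) : Poly := pderiv 0 (u 0) + pderiv 1 (u 1) + pderiv 2 (u 2)

/-- The row-wise divergence of a tensor field. -/
def divRow (S : Tensor) (i : Fin 3) : Poly := divVec (S i)

/-- The operator `div div`. -/
def divDiv (S : Tensor) : Poly := divVec (divRow S)

/-- The product `S x` with the position vector. -/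
def mulPos (S : Tensor) (i : Fin 3) : Poly := S i 0 * X 0 + S i 1 * X 1 + S i 2 * X 2

/-- The quadratic form `xᵀ S x`. -/
def quadPos (S : Tensor) : Poly := X 0 * mulPos S 0 + X 1 * mulPos S 1 + X 2 * mulPos S 2

/-- The tensor field `sym (w xᵀ)`. -/
def symOuter (w : Fin 3 → Poly) : Tensor :=
  Matrix.of fun i j => C (1 / 2 : ℝ) * (w i * X j + w j * X i)

/-- The symmetric gradient of a vector field. -/
def symGrad (w : Fin 3 → Poly) : Tensor :=
  Matrix.of fun i j => C (1 / 2 : ℝ) * (pderiv j (w i) + pderiv i (w j))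

theorem two_mul_C_half : (2 : Poly) * C (1 / 2 : ℝ) = 1 := by
  have : (2 : Poly) = C (2 : ℝ) := (map_ofNat C 2).symm
  rw [this, ← C_mul]
  norm_num

theorem sym_apply (A : Tensor) (i j : Fin 3) : sym A i j = C (1 / 2 : ℝ) * (A i j + A j i) := by
  simp [sym, smul_eq_C_mul, mul_add]

theorem symCurl_apply (A : Tensor) (i j : Fin 3) :
    symCurl A i j = C (1 / 2 : ℝ) * (curlVec (A i) j + curlVec (A j) i) :=
  sym_apply _ i j

theorem symCross_apply (A : Tensor) (i j : Fin 3) :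
    symCross A i j = C (1 / 2 : ℝ) * ((A i ⨯₃ pos) j + (A j ⨯₃ pos) i) :=
  sym_apply _ i j

theorem symm_of_mem_symT {m : ℕ} {S : Tensor} (hS : S ∈ symT m) (i j : Fin 3) : S i j = S j i :=
  congrFun (congrFun hS.2 j) i

/-- div div does not see the skew part of a tensor field, and the row-wise divergence of a row-wise
curl is zero. -/
theorem divDiv_symCurl (A : Tensor) : divDiv (symCurl A) = 0 := by
  simp only [divDiv, divRow, divVec, symCurl_apply, curlVec, pderiv_C_mul, map_add, map_sub,
    Matrix.cons_val]
  simp only [pderiv_comm 1 0, pderiv_comm 2 0, pderiv_comm 2 1]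
  ring

theorem divDiv_sub (S T : Tensor) : divDiv (S - T) = divDiv S - divDiv T := by
  simp only [divDiv, divRow, divVec, Matrix.sub_apply, map_sub, map_add]
  ring

theorem divDiv_add (S T : Tensor) : divDiv (S + T) = divDiv S + divDiv T := by
  simp only [divDiv, divRow, divVec, Matrix.add_apply, map_add]
  ring

/-- `div div (x xᵀ q) = (E + 3) (E + 4) q` for the Euler operator `E`. -/
theorem divDiv_posPos (q : Poly) :
    let E : Poly → Poly := fun p => X 0 * pderiv 0 p + X 1 * pderiv 1 p + X 2 * pderiv 2 p
    divDiv (posPos q) = E (E q) + 7 * E q + 12 * q := by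
  simp [divDiv, divRow, divVec, posPos, pos, pderiv_X]
  simp only [pderiv_comm 1 0, pderiv_comm 2 0, pderiv_comm 2 1]
  ring

theorem coeff_divDiv_posPos (q : Poly) (d : Fin 3 →₀ ℕ) :
    coeff d (divDiv (posPos q)) = (d.degree + 3) * (d.degree + 4) * coeff d q := by
  have h7 : (7 : Poly) = C (7 : ℝ) := (map_ofNat C 7).symm
  have h12 : (12 : Poly) = C (12 : ℝ) := (map_ofNat C 12).symm
  rw [divDiv_posPos, h7, h12]
  simp only [coeff_add _ (_ + _) (C (12 : ℝ) * q), coeff_add _ _ (C (7 : ℝ) * _), coeff_C_mul]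
  rw [coeff_euler, coeff_euler]
  ring

/-- Every monomial is an eigenvector with a positive eigenvalue. This gives directness of the sum
and, later, the vanishing of the radial part. -/
theorem divDiv_posPos_injective {q : Poly} (h : divDiv (posPos q) = 0) : q = 0 := by
  ext d
  have := coeff_divDiv_posPos q d
  rw [h, coeff_zero] at this
  rw [coeff_zero]
  have h3 : ((d.degree : ℝ) + 3) * (d.degree + 4) ≠ 0 := by positivity
  exact (mul_eq_zero.1 this.symm).resolve_left h3

/-- `div div (x xᵀ p) = (c + 3) (c + 4) p` for `p` homogeneous of degree `c`. -/
theorem divDiv_posPos_of_eul {c : ℝ} {p : Poly} (hp : Eul c p) :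
    divDiv (posPos p) = C ((c + 3) * (c + 4)) * p := by
  have h1 := hp.C_mul c
  rw [Eul] at h1
  rw [divDiv_posPos]
  simp only [show X 0 * pderiv 0 p + X 1 * pderiv 1 p + X 2 * pderiv 2 p = C c * p from hp, h1]
  have h3 : (3 : Poly) = C (3 : ℝ) := (map_ofNat C 3).symm
  have h4 : (4 : Poly) = C (4 : ℝ) := (map_ofNat C 4).symm
  simp only [C_mul, C_add, ← h3, ← h4]
  ring

/-! ### The divdiv complex -/

/-- The product rule curl(u × x) = 3u - u + (x · ∇)u - (div u) x, with Euler's identity for the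
convective term. -/
theorem curlVec_cross_pos {c : ℝ} {u : Fin 3 → Poly} (hu : ∀ i, Eul c (u i)) (j : Fin 3) :
    curlVec (u ⨯₃ pos) j = C (c + 2) * u j - divVec u * X j := by
  have h0 := hu 0
  have h1 := hu 1
  have h2 := hu 2
  unfold Eul at h0 h1 h2
  have h3 : (2 : Poly) = C (2 : ℝ) := (map_ofNat C 2).symm
  rw [C_add, ← h3]
  fin_cases j <;>
    simp [curlVec, cross_apply, pos, divVec, pderiv_X]
  · linear_combination h0
  · linear_combination h1
  · linear_combination h2

/-- First half of the homotopy: S is a symmetric curl up to a scalar and an error that depends only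
on its row divergence. -/
theorem symCurl_crossPos {c : ℝ} {S : Tensor} (hS : ∀ i j, S i j = S j i)
    (he : ∀ i j, Eul c (S i j)) :
    symCurl (crossPos S) = (c + 2) • S - symOuter (divRow S) := by
  ext1 i j
  rw [symCurl_apply]
  change C (1 / 2 : ℝ) * (curlVec (S i ⨯₃ pos) j + curlVec (S j ⨯₃ pos) i) = _
  simp only [curlVec_cross_pos (he _), Matrix.sub_apply, Matrix.of_apply,
    Matrix.smul_apply, smul_eq_C_mul, symOuter, hS j i, divRow]
  linear_combination C (c + 2) * S i j * two_mul_C_half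

theorem symOuter_symm (w : Fin 3 → Poly) (i j : Fin 3) : symOuter w i j = symOuter w j i := by
  simp [symOuter, add_comm]

theorem eul_symOuter {c : ℝ} {w : Fin 3 → Poly} (hw : ∀ i, Eul (c - 1) (w i)) (i j : Fin 3) :
    Eul c (symOuter w i j) := by
  have h : ∀ i j, Eul c (w i * X j) := fun i j => by
    simpa using (hw i).mul (Eul.X_one j)
  exact ((h i j).add (h j i)).C_mul _

/-- Second half of the homotopy: when div w = 0, the error term reproduces w as its own divergence,
up to the factor (3 + (c - 1) + 1)/2. Applying the first half to the error therefore yields a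
multiple of the error. -/
theorem divRow_symOuter {c : ℝ} {w : Fin 3 → Poly} (hw : ∀ i, Eul (c - 1) (w i))
    (hd : divVec w = 0) (i : Fin 3) : divRow (symOuter w) i = C ((c + 3) / 2) * w i := by
  have hi := hw i
  unfold Eul at hi
  unfold divVec at hd
  have h3 : (3 : Poly) = C (3 : ℝ) := (map_ofNat C 3).symm
  have h1 : (1 : Poly) = C (1 : ℝ) := C_1.symm
  rw [C_sub, ← h1] at hi
  rw [div_eq_mul_one_div, C_mul, C_add, ← h3]
  fin_cases i <;>
    simp [divRow, divVec, symOuter, pderiv_X] at hi ⊢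
  · linear_combination C (2⁻¹ : ℝ) * hi + C (2⁻¹ : ℝ) * X 0 * hd
  · linear_combination C (2⁻¹ : ℝ) * hi + C (2⁻¹ : ℝ) * X 1 * hd
  · linear_combination C (2⁻¹ : ℝ) * hi + C (2⁻¹ : ℝ) * X 2 * hd

theorem symOuter_C_mul (a : ℝ) (w : Fin 3 → Poly) :
    symOuter (fun i => C a * w i) = a • symOuter w := by
  ext1 i j
  simp only [symOuter, Matrix.of_apply, Matrix.smul_apply, smul_eq_C_mul]
  ring

/-- The trace of S × x contracts a symmetric matrix with a skew one, so it vanishes. -/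
theorem crossPos_mem_polysT {m : ℕ} {S : Tensor} (hS : S ∈ symT m) :
    crossPos S ∈ polysT (m + 1) := by
  have hX : ∀ i j k, S i j * X k ∈ polys (m + 1) := fun i j k =>
    mul_mem_restrict (hS.1 i j) (X_mem_restrict k le_rfl)
  refine ⟨fun i j => ?_, ?_⟩
  · fin_cases j <;> simp only [crossPos, cross_apply, pos, Matrix.of_apply] <;>
      exact Submodule.sub_mem _ (hX _ _ _) (hX _ _ _)
  · have h01 := symm_of_mem_symT hS 0 1
    have h02 := symm_of_mem_symT hS 0 2
    have h12 := symm_of_mem_symT hS 1 2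
    simp [Matrix.trace, Fin.sum_univ_three, crossPos, cross_apply, pos, h01, h02, h12]

theorem divVec_mem {m : ℕ} {u : Fin 3 → Poly} (hu : ∀ i, u i ∈ polys m) :
    divVec u ∈ polys (m - 1) :=
  Submodule.add_mem _ (Submodule.add_mem _ (pderiv_mem_restrict _ (hu _))
    (pderiv_mem_restrict _ (hu _))) (pderiv_mem_restrict _ (hu _))

theorem eul_divVec {c : ℝ} {u : Fin 3 → Poly} (hu : ∀ i, Eul c (u i)) : Eul (c - 1) (divVec u) :=
  (((hu 0).pderiv 0).add ((hu 1).pderiv 1)).add ((hu 2).pderiv 2)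

theorem symOuter_mem {m : ℕ} {w : Fin 3 → Poly} (hw : ∀ i, w i ∈ polys m) :
    symOuter w ∈ symT (m + 1) :=
  ⟨fun i j => C_mul_mem_restrict _ (Submodule.add_mem _
    (mul_mem_restrict (hw i) (X_mem_restrict j le_rfl))
    (mul_mem_restrict (hw j) (X_mem_restrict i le_rfl))), by
    ext1 i j
    exact symOuter_symm w j i⟩

/-- A divdiv-free symmetric tensor field, homogeneous of degree `d`, is a symmetric curl. -/
theorem mem_curlPart_of_eul {l d : ℕ} (hl : 1 ≤ l) {S : Tensor} (hS : S ∈ symT l)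
    (he : ∀ i j, Eul d (S i j)) (hd : divDiv S = 0) : S ∈ curlPart l := by
  set G := symOuter (divRow S) with hG
  have hw : ∀ i, Eul ((d : ℝ) - 1) (divRow S i) := fun i => eul_divVec (he i)
  have hGm : G ∈ symT l := by
    have := symOuter_mem fun i => divVec_mem (hS.1 i)
    rwa [Nat.sub_add_cancel hl] at this
  -- The factor is (d + 2) - (d + 3)/2.
  have hGG : symCurl (crossPos G) = ((d + 1 : ℝ) / 2) • G := by
    have h := symCurl_crossPos (symOuter_symm (divRow S)) (eul_symOuter hw)
    have h' : divRow G = fun i => C ((d + 3 : ℝ) / 2) * divRow S i :=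
      funext fun i => divRow_symOuter hw hd i
    rw [← hG, h', symOuter_C_mul, ← hG, ← sub_smul] at h
    rw [h]
    congr 1
    ring
  have hSS := symCurl_crossPos (symm_of_mem_symT hS) he
  rw [← hG] at hSS
  refine ⟨((d : ℝ) + 2)⁻¹ • (crossPos S + (2 / (d + 1) : ℝ) • crossPos G), ?_, ?_⟩
  · exact Submodule.smul_mem _ _ (Submodule.add_mem _ (crossPos_mem_polysT hS)
      (Submodule.smul_mem _ _ (crossPos_mem_polysT hGm)))
  · have h1 : (d : ℝ) + 1 ≠ 0 := by positivity
    have h2 : (d : ℝ) + 2 ≠ 0 := by positivity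
    rw [map_smul, map_add, map_smul, hSS, hGG, smul_smul,
      show 2 / ((d : ℝ) + 1) * ((d + 1) / 2) = 1 by field_simp, one_smul, sub_add_cancel,
      smul_smul, inv_mul_cancel₀ h2, one_smul]

theorem posPos_mem {m : ℕ} {q : Poly} (hq : q ∈ polys m) : posPos q ∈ symT (m + 2) := by
  refine ⟨fun i j => ?_, ?_⟩
  · change X i * X j * q ∈ polys (m + 2)
    rw [mul_assoc]
    exact X_mul_mem_restrict _ (X_mul_mem_restrict _ hq)
  · ext1 i j
    change X j * X i * q = X i * X j * q
    ring

theorem eul_posPos {c : ℝ} {q : Poly} (hq : Eul c q) (i j : Fin 3) :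
    Eul (c + 2) (posPos q i j) := by
  have h : posPos q i j = X i * (X j * q) := mul_assoc _ _ _
  have h2 : c + 2 = c + 1 + 1 := by ring
  rw [h, h2]
  exact (hq.X_mul j).X_mul i

/-- The homogeneous part of degree `d` of a tensor field. -/
def homogTensor (d : ℕ) (S : Tensor) : Tensor := S.map (homogeneousComponent d)

theorem homogTensor_mem {m : ℕ} (d : ℕ) {S : Tensor} (hS : S ∈ symT m) :
    homogTensor d S ∈ symT m :=
  ⟨fun i j => homogeneousComponent_mem_restrict d (hS.1 i j), by
    ext1 i j
    exact congrArg (homogeneousComponent d) (symm_of_mem_symT hS j i)⟩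

theorem eul_homogTensor (d : ℕ) (S : Tensor) (i j : Fin 3) : Eul d (homogTensor d S i j) :=
  Eul.of_isHomogeneous (homogeneousComponent_isHomogeneous d _)

theorem sum_homogTensor {m : ℕ} {S : Tensor} (hS : S ∈ symT m) :
    ∑ d ∈ Finset.range (m + 1), homogTensor d S = S := by
  ext1 i j
  rw [Matrix.sum_apply]
  exact sum_range_homogeneousComponent (hS.1 i j)

/-- The homotopy formulas have degree-dependent constants, so they are applied to each homogeneous
part separately. -/
theorem symT_le_of_homogeneous {m : ℕ} {V : Submodule ℝ Tensor}
    (h : ∀ d : ℕ, ∀ S ∈ symT m, (∀ i j, Eul d (S i j)) → S ∈ V) : symT m ≤ V := fun S hS => by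
  rw [← sum_homogTensor hS]
  exact Submodule.sum_mem _ fun d _ => h d _ (homogTensor_mem d hS) (eul_homogTensor d S)

/-- Symmetric tensor fields are sums of a symmetric curl and a multiple of `x xᵀ`. -/
theorem symT_le_curlPart_sup_radialPart {l : ℕ} (hl : 2 ≤ l) :
    symT l ≤ curlPart l ⊔ radialPart l := by
  refine symT_le_of_homogeneous fun d S hS he => ?_
  have hdd : Eul ((d : ℝ) - 1 - 1) (divDiv S) := eul_divVec fun i => eul_divVec (he i)
  have hp := hdd.C_mul (((d + 1 : ℝ) * (d + 2))⁻¹)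
  -- The constant inverts the eigenvalue (c + 3)(c + 4) at c = d - 2, the degree of div div S, so
  -- that x xᵀ p has the same div div as S.
  set p : Poly := C (((d + 1 : ℝ) * (d + 2))⁻¹) * divDiv S with hpd
  have hpm : p ∈ polys (l - 2) := C_mul_mem_restrict _ (divVec_mem fun i => divVec_mem (hS.1 i))
  have hpS := posPos_mem hpm
  rw [Nat.sub_add_cancel hl] at hpS
  have hdiv : divDiv (S - posPos p) = 0 := by
    rw [divDiv_sub, divDiv_posPos_of_eul hp, hpd, ← mul_assoc, ← C_mul,
      show ((d : ℝ) - 1 - 1 + 3) * (d - 1 - 1 + 4) * (((d : ℝ) + 1) * (d + 2))⁻¹ = 1 by field_simp; ring,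
      C_1, one_mul, sub_self]
  have hmem := mem_curlPart_of_eul (by omega) (Submodule.sub_mem _ hS hpS)
    (fun i j => (he i j).sub (by
      have := eul_posPos hp i j
      rwa [show (d : ℝ) - 1 - 1 + 2 = d by ring] at this)) hdiv
  rw [← sub_add_cancel S (posPos p)]
  exact Submodule.add_mem_sup hmem ⟨p, hpm, rfl⟩

/-! ### The Hessian complex -/

/-- Here (curl u) × x = (x · ∇)u + u - ∇(u · x); Euler's identity turns the first two terms into (c
+ 1)u. -/
theorem curlVec_cross {c : ℝ} {u : Fin 3 → Poly} (hu : ∀ i, Eul c (u i)) (j : Fin 3) :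
    (curlVec u ⨯₃ pos) j =
      C (c + 1) * u j - pderiv j (u 0 * X 0 + u 1 * X 1 + u 2 * X 2) := by
  have h0 := hu 0
  have h1 := hu 1
  have h2 := hu 2
  unfold Eul at h0 h1 h2
  have h3 : (1 : Poly) = C (1 : ℝ) := C_1.symm
  rw [C_add, ← h3]
  fin_cases j <;>
    simp [curlVec, cross_apply, pos, pderiv_X]
  · linear_combination h0
  · linear_combination h1
  · linear_combination h2

theorem symCross_curl {c : ℝ} {S : Tensor} (hS : ∀ i j, S i j = S j i)
    (he : ∀ i j, Eul c (S i j)) :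
    symCross (curl S) = (c + 1) • S - symGrad (mulPos S) := by
  ext1 i j
  rw [symCross_apply]
  change C (1 / 2 : ℝ) * ((curlVec (S i) ⨯₃ pos) j + (curlVec (S j) ⨯₃ pos) i) = _
  simp only [curlVec_cross (he _), Matrix.sub_apply, Matrix.of_apply,
    Matrix.smul_apply, smul_eq_C_mul, symGrad, hS j i, mulPos]
  linear_combination C (c + 1) * S i j * two_mul_C_half

theorem symGrad_symm (w : Fin 3 → Poly) (i j : Fin 3) : symGrad w i j = symGrad w j i := by
  simp [symGrad, add_comm]

theorem eul_symGrad {c : ℝ} {w : Fin 3 → Poly} (hw : ∀ i, Eul (c + 1) (w i)) (i j : Fin 3) :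
    Eul c (symGrad w i j) := by
  have h : ∀ i j, Eul c (pderiv j (w i)) := fun i j => by
    simpa using (hw i).pderiv j
  exact ((h i j).add (h j i)).C_mul _

/-- Differentiating w · x = 0 gives the transposed term: (∇w)ᵀx = -w. With Euler's identity,
symGrad(w) x = ((c + 1) - 1)/2 · w. -/
theorem mulPos_symGrad {c : ℝ} {w : Fin 3 → Poly} (hw : ∀ i, Eul (c + 1) (w i))
    (hd : X 0 * w 0 + X 1 * w 1 + X 2 * w 2 = 0) (i : Fin 3) :
    mulPos (symGrad w) i = C (c / 2) * w i := by
  have hi := hw i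
  unfold Eul at hi
  have h1 : (1 : Poly) = C (1 : ℝ) := C_1.symm
  rw [C_add, ← h1] at hi
  have hd' := congrArg (pderiv i) hd
  rw [div_eq_mul_one_div, C_mul]
  fin_cases i <;>
    simp [mulPos, symGrad, pderiv_X] at hi hd' ⊢ <;>
    linear_combination C (2⁻¹ : ℝ) * hi + C (2⁻¹ : ℝ) * hd'

theorem symGrad_C_mul (a : ℝ) (w : Fin 3 → Poly) :
    symGrad (fun i => C a * w i) = a • symGrad w := by
  ext1 i j
  simp only [symGrad, Matrix.of_apply, Matrix.smul_apply, smul_eq_C_mul, pderiv_C_mul]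
  ring

theorem curl_mem_polysT {m : ℕ} {S : Tensor} (hS : S ∈ symT m) : curl S ∈ polysT (m - 1) := by
  refine ⟨fun i j => ?_, ?_⟩
  · fin_cases j <;> exact Submodule.sub_mem _ (pderiv_mem_restrict _ (hS.1 _ _))
      (pderiv_mem_restrict _ (hS.1 _ _))
  · have h01 := symm_of_mem_symT hS 0 1
    have h02 := symm_of_mem_symT hS 0 2
    have h12 := symm_of_mem_symT hS 1 2
    simp [Matrix.trace, Fin.sum_univ_three, curl, curlVec, h01, h02, h12]

theorem symGrad_mem {m : ℕ} {w : Fin 3 → Poly} (hw : ∀ i, w i ∈ polys m) :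
    symGrad w ∈ symT (m - 1) :=
  ⟨fun i j => C_mul_mem_restrict _ (Submodule.add_mem _
    (pderiv_mem_restrict j (hw i)) (pderiv_mem_restrict i (hw j))), by
    ext1 i j
    exact symGrad_symm w j i⟩

theorem mulPos_mem {m : ℕ} {S : Tensor} (hS : S ∈ symT m) (i : Fin 3) :
    mulPos S i ∈ polys (m + 1) := by
  have h : ∀ j, S i j * X j ∈ polys (m + 1) := fun j =>
    mul_mem_restrict (hS.1 i j) (X_mem_restrict j le_rfl)
  exact Submodule.add_mem _ (Submodule.add_mem _ (h _) (h _)) (h _)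

theorem eul_mulPos {c : ℝ} {S : Tensor} (he : ∀ i j, Eul c (S i j)) (i : Fin 3) :
    Eul (c + 1) (mulPos S i) :=
  (((he i 0).mul (Eul.X_one 0)).add ((he i 1).mul (Eul.X_one 1))).add
    ((he i 2).mul (Eul.X_one 2))

/-- Counterpart of `mem_curlPart_of_eul`: A = curl S reproduces (d + 1)S up to the error G =
symGrad(S x). Because xᵀSx = 0, applying the same formula to G gives ((d + 1) - d/2) G. -/
theorem mem_symCrossSpace_of_eul {m d : ℕ} {S : Tensor} (hS : S ∈ symT m)
    (he : ∀ i j, Eul d (S i j)) (hd : quadPos S = 0) : S ∈ symCrossSpace (m - 1) := by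
  set G := symGrad (mulPos S) with hG
  have hw : ∀ i, Eul ((d : ℝ) + 1) (mulPos S i) := fun i => eul_mulPos he i
  have hGm : G ∈ symT m := by
    have := symGrad_mem fun i => mulPos_mem hS i
    rwa [Nat.add_sub_cancel] at this
  have hGG : symCross (curl G) = ((d + 2 : ℝ) / 2) • G := by
    have h := symCross_curl (symGrad_symm (mulPos S)) (eul_symGrad hw)
    have h' : mulPos G = fun i => C ((d : ℝ) / 2) * mulPos S i :=
      funext fun i => mulPos_symGrad hw hd i
    rw [← hG, h', symGrad_C_mul, ← hG, ← sub_smul] at h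
    rw [h]
    congr 1
    ring
  have hSS := symCross_curl (symm_of_mem_symT hS) he
  rw [← hG] at hSS
  refine ⟨((d : ℝ) + 1)⁻¹ • (curl S + (2 / (d + 2) : ℝ) • curl G), ?_, ?_⟩
  · exact Submodule.smul_mem _ _ (Submodule.add_mem _ (curl_mem_polysT hS)
      (Submodule.smul_mem _ _ (curl_mem_polysT hGm)))
  · have h1 : (d : ℝ) + 1 ≠ 0 := by positivity
    have h2 : (d : ℝ) + 2 ≠ 0 := by positivity
    rw [map_smul, map_add, map_smul, hSS, hGG, smul_smul,
      show 2 / ((d : ℝ) + 2) * ((d + 2) / 2) = 1 by field_simp, one_smul, sub_add_cancel,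
      smul_smul, inv_mul_cancel₀ h1, one_smul]

theorem hess_mem {m : ℕ} {p : Poly} (hp : p ∈ polys m) : hessLin p ∈ symT (m - 2) :=
  ⟨fun i j => pderiv_mem_restrict i (pderiv_mem_restrict j hp), by
    ext1 i j
    exact pderiv_comm j i p⟩

theorem quadPos_hess_of_eul {c : ℝ} {p : Poly} (hp : Eul c p) :
    quadPos (hessLin p) = C (c * (c - 1)) * p := by
  have h0 := hp.pderiv 0
  have h1 := hp.pderiv 1
  have h2 := hp.pderiv 2
  unfold Eul at hp h0 h1 h2
  simp only [quadPos, mulPos, hessLin, hess, LinearMap.coe_mk, AddHom.coe_mk, Matrix.of_apply,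
    C_mul]
  simp only [pderiv_comm 1 0, pderiv_comm 2 0, pderiv_comm 2 1] at h0 h1 h2 ⊢
  linear_combination X 0 * h0 + X 1 * h1 + X 2 * h2 + C (c - 1) * hp

theorem quadPos_sub (S T : Tensor) : quadPos (S - T) = quadPos S - quadPos T := by
  simp only [quadPos, mulPos, Matrix.sub_apply]
  ring

/-- Symmetric tensor fields are sums of a Hessian and a field `sym (A × x)`, `A` trace-free. -/
theorem symT_le_hessSpace_sup_symCrossSpace (m : ℕ) :
    symT m ≤ hessSpace (m + 2) ⊔ symCrossSpace (m - 1) := by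
  refine symT_le_of_homogeneous fun d S hS he => ?_
  have hq : Eul ((d : ℝ) + 1 + 1) (quadPos S) :=
    (((eul_mulPos he 0).X_mul 0).add ((eul_mulPos he 1).X_mul 1)).add ((eul_mulPos he 2).X_mul 2)
  have hp := hq.C_mul (((d + 1 : ℝ) * (d + 2))⁻¹)
  -- The constant inverts c(c - 1) at c = d + 2, the degree of xᵀSx, so that ∇²p has the same
  -- quadratic form as S.
  set p : Poly := C (((d + 1 : ℝ) * (d + 2))⁻¹) * quadPos S with hpd
  have hpm : p ∈ polys (m + 2) := C_mul_mem_restrict _ (Submodule.add_mem _ (Submodule.add_mem _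
    (X_mul_mem_restrict _ (mulPos_mem hS _)) (X_mul_mem_restrict _ (mulPos_mem hS _)))
    (X_mul_mem_restrict _ (mulPos_mem hS _)))
  have hpS := hess_mem hpm
  rw [Nat.add_sub_cancel] at hpS
  have hquad : quadPos (S - hessLin p) = 0 := by
    rw [quadPos_sub, quadPos_hess_of_eul hp, hpd, ← mul_assoc, ← C_mul,
      show ((d : ℝ) + 1 + 1) * (d + 1 + 1 - 1) * (((d : ℝ) + 1) * (d + 2))⁻¹ = 1 by field_simp; ring,
      C_1, one_mul, sub_self]
  have hmem := mem_symCrossSpace_of_eul (Submodule.sub_mem _ hS hpS)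
    (fun i j => (he i j).sub (by
      have := (hp.pderiv j).pderiv i
      rwa [add_sub_cancel_right, add_sub_cancel_right] at this)) hquad
  rw [← add_sub_cancel (hessLin p) S]
  exact Submodule.add_mem_sup ⟨p, hpm, rfl⟩ hmem

/-! ### Kernels and disjointness of the decompositions. -/

theorem quadPos_symCross (A : Tensor) : quadPos (symCross A) = 0 := by
  simp only [quadPos, mulPos, symCross_apply, cross_apply, pos, Matrix.cons_val]
  ring

theorem quadPos_hess (p : Poly) :
    let E : Poly → Poly := fun p => X 0 * pderiv 0 p + X 1 * pderiv 1 p + X 2 * pderiv 2 p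
    quadPos (hessLin p) = E (E p) - E p := by
  simp [quadPos, mulPos, hessLin, hess, pderiv_X]
  simp only [pderiv_comm 1 0, pderiv_comm 2 0, pderiv_comm 2 1]
  ring

theorem coeff_quadPos_hess (p : Poly) (d : Fin 3 →₀ ℕ) :
    coeff d (quadPos (hessLin p)) = d.degree * (d.degree - 1) * coeff d p := by
  rw [quadPos_hess]
  simp only [coeff_sub _ _ (_ : Poly)]
  rw [coeff_euler, coeff_euler]
  ring

theorem hess_eq_zero_of_mem_polys_one {p : Poly} (hp : p ∈ polys 1) : hessLin p = 0 := by
  have h : ∀ i j, pderiv i (pderiv j p) = 0 := fun i j => by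
    have h0 : pderiv j p ∈ polys 0 := pderiv_mem_restrict j hp
    rw [mem_restrictTotalDegree, Nat.le_zero, totalDegree_eq_zero_iff_eq_C] at h0
    rw [h0, pderiv_C]
  ext1 i j
  exact h i j

/-- The form xᵀ∇²p x multiplies a monomial of degree d by d(d - 1), which is zero only for d = 0 and
d = 1. -/
theorem mem_polys_one_of_quadPos_hess {p : Poly} (h : quadPos (hessLin p) = 0) :
    p ∈ polys 1 := by
  rw [mem_restrict_iff]
  intro d hd
  have h1 := coeff_quadPos_hess p d
  rw [h, coeff_zero] at h1
  have h2 := (mul_eq_zero.1 h1.symm).resolve_right hd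
  rcases mul_eq_zero.1 h2 with h3 | h3
  · have : d.degree = 0 := by exact_mod_cast h3
    omega
  · have : (d.degree : ℝ) = 1 := by linarith
    exact le_of_eq (by exact_mod_cast this)

theorem symCross_mem {m : ℕ} {A : Tensor} (hA : A ∈ polysT m) : symCross A ∈ symT (m + 1) := by
  have hX : ∀ i j k, A i j * X k ∈ polys (m + 1) := fun i j k =>
    mul_mem_restrict (hA.1 i j) (X_mem_restrict k le_rfl)
  have h : ∀ i j, (A i ⨯₃ pos) j ∈ polys (m + 1) := fun i j => by
    fin_cases j <;> simp only [cross_apply, pos] <;>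
      exact Submodule.sub_mem (polys _) (hX _ _ _) (hX _ _ _)
  refine ⟨fun i j => ?_, ?_⟩
  · rw [symCross_apply]
    exact C_mul_mem_restrict _ (Submodule.add_mem _ (h _ _) (h _ _))
  · ext1 i j
    rw [Matrix.transpose_apply, symCross_apply, symCross_apply, add_comm]

theorem symCurl_mem {m : ℕ} {A : Tensor} (hA : A ∈ polysT (m + 1)) : symCurl A ∈ symT m := by
  have h' : ∀ i j k, pderiv k (A i j) ∈ polys m := fun i j k => pderiv_mem_restrict k (hA.1 i j)
  have h : ∀ i j, curlVec (A i) j ∈ polys m := fun i j => by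
    fin_cases j <;> exact Submodule.sub_mem (polys m) (h' _ _ _) (h' _ _ _)
  refine ⟨fun i j => ?_, ?_⟩
  · rw [symCurl_apply]
    exact C_mul_mem_restrict _ (Submodule.add_mem _ (h _ _) (h _ _))
  · ext1 i j
    rw [Matrix.transpose_apply, symCurl_apply, symCurl_apply, add_comm]

theorem disjoint_hessSpace_symCrossSpace (m m' : ℕ) :
    Disjoint (hessSpace m) (symCrossSpace m') := by
  rw [Submodule.disjoint_def]
  rintro _ ⟨p, _, rfl⟩ ⟨A, _, hA⟩
  refine hess_eq_zero_of_mem_polys_one (mem_polys_one_of_quadPos_hess ?_)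
  rw [← hA, quadPos_symCross]

theorem disjoint_curlPart_radialPart (l k : ℕ) : Disjoint (curlPart l) (radialPart k) := by
  rw [Submodule.disjoint_def]
  rintro _ ⟨A, _, rfl⟩ ⟨q, _, hq⟩
  have : q = 0 := divDiv_posPos_injective (by rw [hq, divDiv_symCurl])
  rw [← hq, this, map_zero]

/-! ### Barycentric coordinates -/

/-- The barycentric coordinates `c i + g i · x` of the tetrahedron with vertices `v i`. -/
structure Bary (v : Fin 4 → Vec) where
  /-- The constant terms. -/
  c : Fin 4 → ℝ
  /-- The gradients. -/
  g : Fin 4 → Vec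
  sum_c : ∑ i, c i = 1
  sum_g : ∀ a, ∑ i, g i a = 0
  sum_cv : ∀ a, ∑ i, v i a * c i = 0
  sum_gv : ∀ a b, ∑ i, v i a * g i b = if a = b then 1 else 0
  apply_vertex : ∀ i j, c i + ∑ a, g i a * v j a = if i = j then 1 else 0

/-- Affine independence says that the matrix with rows (1, vᵢ) is invertible. The columns of its
inverse are (cᵢ, gᵢ), and the fields of `Bary` are the entries of the two products with the inverse.
-/
theorem exists_bary {v : Fin 4 → Vec} (hv : AffineIndependent ℝ v) : Nonempty (Bary v) := by
  let M : Matrix (Fin 4) (Fin 4) ℝ := Matrix.of fun i => Fin.cons 1 (v i)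
  have hM : IsUnit M.det := by
    rw [isUnit_iff_ne_zero]
    intro h
    obtain ⟨w, hw, hwM⟩ := Matrix.exists_vecMul_eq_zero_iff.2 h
    rw [affineIndependent_iff] at hv
    refine hw (funext fun i => hv Finset.univ w ?_ ?_ i (Finset.mem_univ i))
    · simpa [Matrix.vecMul, dotProduct, M] using congrFun hwM 0
    · ext a
      simpa [Matrix.vecMul, dotProduct, M] using congrFun hwM a.succ
  have h1 : ∀ r s, ∑ i, M⁻¹ r i * M i s = if r = s then 1 else 0 := fun r s => by
    rw [← Matrix.mul_apply, Matrix.nonsing_inv_mul M hM, Matrix.one_apply]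
  have h2 : ∀ r s, ∑ i, M r i * M⁻¹ i s = if r = s then 1 else 0 := fun r s => by
    rw [← Matrix.mul_apply, Matrix.mul_nonsing_inv M hM, Matrix.one_apply]
  exact ⟨{
    c := fun i => M⁻¹ 0 i
    g := fun i a => M⁻¹ a.succ i
    sum_c := by simpa [M] using h1 0 0
    sum_g := fun a => by simpa [M] using h1 a.succ 0
    sum_cv := fun a => by
      have := h1 0 a.succ
      simp only [M, Matrix.of_apply, Fin.cons_succ, (Fin.succ_ne_zero a).symm, if_false] at this
      rw [← this]
      exact Finset.sum_congr rfl fun i _ => mul_comm _ _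
    sum_gv := fun a b => by
      have := h1 b.succ a.succ
      simp only [M, Matrix.of_apply, Fin.cons_succ, Fin.succ_inj] at this
      rw [if_congr eq_comm rfl rfl, ← this]
      exact Finset.sum_congr rfl fun i _ => mul_comm _ _
    apply_vertex := fun i j => by
      have := h2 j i
      rw [Fin.sum_univ_succ] at this
      simp only [M, Matrix.of_apply, Fin.cons_succ, Fin.cons_zero, one_mul] at this
      rw [if_congr eq_comm rfl rfl, ← this]
      congr 1
      exact Finset.sum_congr rfl fun i _ => mul_comm _ _ }⟩

/-- The point with (homogeneous) barycentric coordinates `μ`. -/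
def pt (v : Fin 4 → Vec) (μ : Fin 4 → ℝ) : Vec := fun a => ∑ i, v i a * μ i

/-- The polynomial in four barycentric variables obtained by the substitution `x = ∑ λᵢ vᵢ`. -/
def pull (v : Fin 4 → Vec) : Poly →ₐ[ℝ] MvPolynomial (Fin 4) ℝ :=
  aeval fun a => ∑ i, C (v i a) * X i

theorem eval_pull (v : Fin 4 → Vec) (μ : Fin 4 → ℝ) (f : Poly) :
    eval μ (pull v f) = eval (pt v μ) f := by
  induction f using MvPolynomial.induction_on with
  | C a => simp [pull]
  | add p q hp hq => simp only [map_add, hp, hq]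
  | mul_X p a hp =>
    rw [map_mul, map_mul, map_mul, hp, eval_X]
    simp [pull, pt]

/-- The face of the tetrahedron spanned by the vertices `v i`, `i ∈ S`. -/
def hull (v : Fin 4 → Vec) (S : Finset (Fin 4)) : Set Vec := convexHull ℝ (v '' S)

theorem hull_univ (v : Fin 4 → Vec) : hull v Finset.univ = tet v := by
  simp [hull, tet]

theorem hull_compl_singleton (v : Fin 4 → Vec) (i : Fin 4) : hull v {i}ᶜ = face v i := by
  rw [hull, face, Set.range_comp', Fin.range_succAbove, Finset.coe_compl, Finset.coe_singleton]

theorem hull_pair (v : Fin 4 → Vec) (e : Edge) : hull v {e.1.1, e.1.2} = edge v e := by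
  rw [hull, edge, Finset.coe_pair, Set.image_pair, convexHull_pair]

theorem hull_mono (v : Fin 4 → Vec) {S T : Finset (Fin 4)} (h : S ⊆ T) : hull v S ⊆ hull v T :=
  convexHull_mono (Set.image_mono (by exact_mod_cast h))

theorem vertex_mem_hull (v : Fin 4 → Vec) {S : Finset (Fin 4)} {i : Fin 4} (h : i ∈ S) :
    v i ∈ hull v S :=
  subset_convexHull ℝ _ ⟨i, h, rfl⟩

theorem pt_mem_hull (v : Fin 4 → Vec) {S : Finset (Fin 4)} {μ : Fin 4 → ℝ} (h0 : ∀ i, 0 ≤ μ i)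
    (hS : ∀ i ∉ S, μ i = 0) (h1 : ∑ i, μ i = 1) : pt v μ ∈ hull v S := by
  have hsum : ∑ i ∈ S, μ i = 1 := by
    rw [← h1]
    exact Finset.sum_subset (Finset.subset_univ S) fun i _ hi => hS i hi
  have hpt : pt v μ = ∑ i ∈ S, μ i • v i := by
    rw [Finset.sum_subset (Finset.subset_univ S) fun i _ hi => by simp [hS i hi]]
    ext a
    simp [pt, mul_comm]
  rw [hpt]
  exact (convex_convexHull ℝ _).sum_mem (fun i _ => h0 i) hsum fun i hi =>
    vertex_mem_hull v hi

namespace Bary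

variable {v : Fin 4 → Vec} (b : Bary v)

/-- The barycentric coordinate functions as polynomials. -/
def lam (i : Fin 4) : Poly := C (b.c i) + ∑ a, C (b.g i a) * X a

theorem eval_lam (i : Fin 4) (x : Vec) : eval x (b.lam i) = b.c i + b.g i ⬝ᵥ x := by
  simp [lam, dotProduct]

theorem eval_lam_vertex (i j : Fin 4) : eval (v j) (b.lam i) = if i = j then 1 else 0 := by
  rw [eval_lam, ← b.apply_vertex i j, dotProduct]

theorem sum_eval_lam (x : Vec) : ∑ i, eval x (b.lam i) = 1 := by
  simp only [eval_lam, dotProduct, Finset.sum_add_distrib, b.sum_c]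
  rw [Finset.sum_comm]
  simp [← Finset.sum_mul, b.sum_g]

theorem pt_eval_lam (x : Vec) : pt v (fun i => eval x (b.lam i)) = x := by
  ext a
  simp only [pt, eval_lam, dotProduct, mul_add, Finset.sum_add_distrib, b.sum_cv, zero_add,
    Finset.mul_sum]
  rw [Finset.sum_comm]
  simp [← mul_assoc, ← Finset.sum_mul, b.sum_gv]

/-- A vector is determined by its products with the gradients. -/
theorem sum_dotProduct_smul_vertex (w : Vec) (a : Fin 3) : ∑ i, (b.g i ⬝ᵥ w) * v i a = w a := by
  simp only [dotProduct, Finset.sum_mul]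
  rw [Finset.sum_comm]
  have : ∀ c, ∑ i, b.g i c * w c * v i a = (if a = c then 1 else 0) * w c := fun c => by
    rw [← b.sum_gv, Finset.sum_mul]
    exact Finset.sum_congr rfl fun i _ => by ring
  simp [this]

theorem sum_dotProduct_smul_grad (w : Vec) (a : Fin 3) : ∑ i, (w ⬝ᵥ v i) * b.g i a = w a := by
  simp only [dotProduct, Finset.sum_mul]
  rw [Finset.sum_comm]
  have : ∀ c, ∑ i, w c * v i c * b.g i a = w c * (if c = a then 1 else 0) := fun c => by
    rw [← b.sum_gv, Finset.mul_sum]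
    exact Finset.sum_congr rfl fun i _ => by ring
  simp [this]

theorem mem_hull_iff {S : Finset (Fin 4)} {x : Vec} :
    x ∈ hull v S ↔ (∀ i, 0 ≤ eval x (b.lam i)) ∧ ∀ i ∉ S, eval x (b.lam i) = 0 := by
  constructor
  · intro hx
    have hconv : Convex ℝ {x | (∀ i, 0 ≤ eval x (b.lam i)) ∧ ∀ i ∉ S, eval x (b.lam i) = 0} := by
      intro x hx y hy s t hs ht hst
      have h : ∀ i, eval (s • x + t • y) (b.lam i) = s * eval x (b.lam i) + t * eval y (b.lam i) :=
        fun i => by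
          simp only [eval_lam, dotProduct_add, dotProduct_smul, smul_eq_mul]
          linear_combination (-b.c i) * hst
      refine ⟨fun i => ?_, fun i hi => ?_⟩
      · rw [h]
        exact add_nonneg (mul_nonneg hs (hx.1 i)) (mul_nonneg ht (hy.1 i))
      · rw [h, hx.2 i hi, hy.2 i hi]
        simp
    refine convexHull_min ?_ hconv hx
    rintro _ ⟨j, hj, rfl⟩
    refine ⟨fun i => ?_, fun i hi => ?_⟩
    · rw [eval_lam_vertex]
      split_ifs <;> simp
    · rw [eval_lam_vertex, if_neg]
      rintro rfl
      exact hi hj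
  · rintro ⟨h0, hS⟩
    rw [← b.pt_eval_lam x]
    exact pt_mem_hull v h0 hS (b.sum_eval_lam x)

end Bary

/-! ### The Bernstein form of a polynomial -/

section Bernstein

variable {σ τ : Type*} {m : ℕ}

theorem eval_aeval (φ : σ → MvPolynomial τ ℝ) (p : MvPolynomial σ ℝ) (x : τ → ℝ) :
    eval x (aeval φ p) = eval (fun a => eval x (φ a)) p := by
  simp only [← aeval_eq_eval]
  exact comp_aeval_apply (R := ℝ) φ (aeval x : MvPolynomial τ ℝ →ₐ[ℝ] ℝ) p

theorem aeval_mem_restrict {φ : σ → MvPolynomial τ ℝ}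
    (hφ : ∀ i, φ i ∈ restrictTotalDegree τ ℝ 1) {p : MvPolynomial σ ℝ}
    (hp : p ∈ restrictTotalDegree σ ℝ m) : aeval φ p ∈ restrictTotalDegree τ ℝ m := by
  rw [p.as_sum, map_sum]
  refine Submodule.sum_mem _ fun d hd => ?_
  rw [aeval_monomial, algebraMap_eq]
  refine C_mul_mem_restrict _ ?_
  rw [mem_restrict_iff] at hp
  refine restrict_mono (hp d (mem_support_iff.1 hd)) ?_
  rw [mem_restrictTotalDegree, Finsupp.prod, Finsupp.degree]
  refine (totalDegree_finsetProd _ _).trans (Finset.sum_le_sum fun i _ => ?_)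
  refine (totalDegree_pow _ _).trans ?_
  have := (mem_restrictTotalDegree _ _ _).1 (hφ i)
  nlinarith [Nat.zero_le (d i)]

theorem lam_mem {v : Fin 4 → Vec} (b : Bary v) (i : Fin 4) : b.lam i ∈ polys 1 :=
  Submodule.add_mem _ (C_mem_restrict _) (Submodule.sum_mem _ fun _ _ =>
    C_mul_mem_restrict _ (X_mem_restrict _ le_rfl))

theorem pull_mem {v : Fin 4 → Vec} {f : Poly} (hf : f ∈ polys m) :
    pull v f ∈ restrictTotalDegree (Fin 4) ℝ m :=
  aeval_mem_restrict (fun _ => Submodule.sum_mem _ fun _ _ =>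
    C_mul_mem_restrict _ (X_mem_restrict _ le_rfl)) hf

/-- The homogeneous polynomial of degree `m` in the barycentric variables that represents `f`. -/
def bernstein (v : Fin 4 → Vec) (m : ℕ) (f : Poly) : MvPolynomial (Fin 4) ℝ :=
  ∑ d ∈ Finset.range (m + 1), homogeneousComponent d (pull v f) * (∑ i, X i) ^ (m - d)

theorem bernstein_isHomogeneous (v : Fin 4 → Vec) (m : ℕ) (f : Poly) :
    (bernstein v m f).IsHomogeneous m := by
  refine IsHomogeneous.sum _ _ _ fun d hd => ?_
  have h := (homogeneousComponent_isHomogeneous d (pull v f)).mul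
    ((IsHomogeneous.sum Finset.univ (fun i : Fin 4 => (X i : MvPolynomial (Fin 4) ℝ)) 1
      fun i _ => isHomogeneous_X ℝ i).pow (m - d))
  rwa [one_mul, Nat.add_sub_cancel' (Nat.lt_succ_iff.1 (Finset.mem_range.1 hd))] at h

/-- The powers that make the form homogeneous are powers of the sum of the barycentric variables,
which is 1 here. -/
theorem eval_bernstein {v : Fin 4 → Vec} {f : Poly} (hf : f ∈ polys m) {μ : Fin 4 → ℝ}
    (hμ : ∑ i, μ i = 1) : eval μ (bernstein v m f) = eval (pt v μ) f := by
  rw [bernstein, map_sum]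
  simp only [map_mul, map_pow, map_sum, eval_X, hμ, one_pow, mul_one]
  rw [← map_sum, sum_range_homogeneousComponent (pull_mem hf), eval_pull]

/-- The terms of a polynomial that involve only the variables in `S`. -/
def supportedPart (S : Finset (Fin 4)) (h : MvPolynomial (Fin 4) ℝ) : MvPolynomial (Fin 4) ℝ :=
  ∑ d ∈ h.support with d.support ⊆ S, monomial d (coeff d h)

theorem coeff_supportedPart {S : Finset (Fin 4)} (h : MvPolynomial (Fin 4) ℝ) {d : Fin 4 →₀ ℕ}
    (hd : d.support ⊆ S) : coeff d (supportedPart S h) = coeff d h := by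
  simp only [supportedPart, coeff_sum, coeff_monomial, Finset.sum_ite_eq', Finset.mem_filter,
    mem_support_iff]
  by_cases h0 : coeff d h = 0 <;> simp [h0, hd]

theorem eval_eq_sum_supported {S : Finset (Fin 4)} (h : MvPolynomial (Fin 4) ℝ) {μ : Fin 4 → ℝ}
    (hμ : ∀ i ∉ S, μ i = 0) :
    eval μ h = ∑ d ∈ h.support with d.support ⊆ S, coeff d h * ∏ i, μ i ^ d i := by
  rw [eval_eq', Finset.sum_filter]
  refine Finset.sum_congr rfl fun d _ => ?_
  split_ifs with hd
  · rfl
  · obtain ⟨i, hi, hiS⟩ := Finset.not_subset.1 hd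
    rw [Finset.prod_eq_zero (Finset.mem_univ i), mul_zero]
    rw [hμ i hiS, zero_pow (Finsupp.mem_support_iff.1 hi)]

/-- A homogeneous polynomial in barycentric coordinates vanishes on a face of the simplex only if
its coefficients that belong to that face vanish. -/
theorem coeff_eq_zero_of_vanish {S : Finset (Fin 4)} (hS : S.Nonempty)
    {h : MvPolynomial (Fin 4) ℝ} (hh : h.IsHomogeneous m)
    (h0 : ∀ μ : Fin 4 → ℝ, (∀ i, 0 ≤ μ i) → (∀ i ∉ S, μ i = 0) → ∑ i, μ i = 1 → eval μ h = 0)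
    {d : Fin 4 →₀ ℕ} (hd : d.support ⊆ S) : coeff d h = 0 := by
  suffices supportedPart S h = 0 by rw [← coeff_supportedPart h hd, this, coeff_zero]
  -- It suffices to test on the open positive orthant. A positive x is projected to the face by
  -- dropping the coordinates outside S and dividing by the sum s of the others; homogeneity costs a
  -- factor s ^ m.
  refine funext_set (fun _ => Set.Ioi 0) (fun _ => Set.Ioi_infinite 0) fun x hx => ?_
  rw [map_zero]
  have hx : ∀ i, 0 < x i := fun i => hx i trivial
  set s := ∑ i ∈ S, x i with hs
  have hs0 : 0 < s := Finset.sum_pos (fun i _ => hx i) hS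
  let μ : Fin 4 → ℝ := fun i => if i ∈ S then x i / s else 0
  have hμ : eval μ h = 0 := by
    refine h0 μ (fun i => ?_) (fun i hi => if_neg hi) ?_
    · simp only [μ]
      split_ifs
      · exact div_nonneg (hx i).le hs0.le
      · exact le_rfl
    · simp only [μ, Finset.sum_ite_mem, Finset.univ_inter, ← Finset.sum_div]
      exact div_self hs0.ne'
  rw [eval_eq_sum_supported (S := S) h fun i hi => if_neg hi] at hμ
  rw [← mul_zero (s ^ m), ← hμ, supportedPart, map_sum, Finset.mul_sum]
  refine Finset.sum_congr rfl fun d hd => ?_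
  obtain ⟨hd1, hd2⟩ := Finset.mem_filter.1 hd
  have hdm : ∑ i, d i = m := by
    rw [← Finsupp.degree_eq_sum, Finsupp.degree_eq_weight_one]
    exact hh (mem_support_iff.1 hd1)
  rw [eval_monomial, Finsupp.prod_fintype _ _ fun i => pow_zero _, ← hdm,
    ← Finset.prod_pow_eq_pow_sum, mul_left_comm, ← Finset.prod_mul_distrib]
  congr 1
  refine Finset.prod_congr rfl fun i _ => ?_
  by_cases hi : i ∈ S
  · simp only [if_pos hi, ← mul_pow]
    rw [mul_div_cancel₀ _ hs0.ne']
  · have : d i = 0 := Finsupp.notMem_support_iff.1 fun h => hi (hd2 h)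
    simp [this]

end Bernstein

namespace Bary

variable {v : Fin 4 → Vec} (b : Bary v) {m : ℕ}

/-- A polynomial on a face that vanishes on some of the subfaces of codimension one is divisible
by the product of the corresponding barycentric coordinates. -/
theorem exists_eq_prod_lam_mul {S J : Finset (Fin 4)} {f : Poly}
    (hf : f ∈ polys m) (hJ : ∀ j ∈ J, (S.erase j).Nonempty)
    (h0 : ∀ j ∈ J, ∀ x ∈ hull v (S.erase j), eval x f = 0) :
    ∃ q ∈ polys (m - J.card), ∀ x ∈ hull v S,
      eval x f = (∏ j ∈ J, eval x (b.lam j)) * eval x q := by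
  set h := bernstein v m f with hh
  have hhom := bernstein_isHomogeneous v m f
  rw [← hh] at hhom
  -- The exponent of the product of the barycentric coordinates in J.
  let e : Fin 4 →₀ ℕ := ∑ j ∈ J, Finsupp.single j 1
  have he : ∀ i, e i = if i ∈ J then 1 else 0 := fun i => by
    simp [e, Finsupp.finsetSum_apply, Finsupp.single_apply]
  -- A monomial without λⱼ survives on the subface opposite to vertex j. There f vanishes, so its
  -- coefficient is zero; hence each remaining monomial is divisible by λⱼ.
  have hle : ∀ d ∈ h.support.filter (fun d => d.support ⊆ S), e ≤ d := by
    intro d hd i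
    obtain ⟨hd1, hd2⟩ := Finset.mem_filter.1 hd
    rw [he]
    split_ifs with hi
    · by_contra hlt
      have hdi : d i = 0 := by omega
      refine mem_support_iff.1 hd1 (coeff_eq_zero_of_vanish (hJ i hi) hhom ?_ (d := d) ?_)
      · intro μ hμ0 hμS hμ1
        rw [hh, eval_bernstein hf hμ1]
        exact h0 i hi _ (pt_mem_hull v hμ0 hμS hμ1)
      · intro k hk
        refine Finset.mem_erase.2 ⟨?_, hd2 hk⟩
        rintro rfl
        exact Finsupp.mem_support_iff.1 hk hdi
    · exact Nat.zero_le _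
  let Q : MvPolynomial (Fin 4) ℝ :=
    ∑ d ∈ h.support with d.support ⊆ S, monomial (d - e) (coeff d h)
  have hQ : Q ∈ restrictTotalDegree (Fin 4) ℝ (m - J.card) := by
    refine Submodule.sum_mem _ fun d hd => ?_
    rw [mem_restrictTotalDegree]
    refine (totalDegree_monomial_le _ _).trans ?_
    have h1 : d.degree = m := by
      rw [Finsupp.degree_eq_weight_one]
      exact hhom (mem_support_iff.1 (Finset.mem_filter.1 hd).1)
    have h2 : (d - e).degree + e.degree = d.degree := by
      rw [← map_add, tsub_add_cancel_of_le (hle d hd)]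
    have h3 : e.degree = J.card := by
      simp [e, Finsupp.degree_single]
    have h4 : (d - e).degree = m - J.card := by omega
    exact h4.le
  refine ⟨aeval b.lam Q, aeval_mem_restrict (lam_mem b) hQ, fun x hx => ?_⟩
  obtain ⟨_, hxS⟩ := b.mem_hull_iff.1 hx
  have h1 := eval_bernstein (v := v) hf (b.sum_eval_lam x)
  rw [b.pt_eval_lam, ← hh, eval_eq_sum_supported (S := S) h hxS] at h1
  rw [eval_aeval, ← h1, map_sum, Finset.mul_sum]
  refine Finset.sum_congr rfl fun d hd => ?_
  rw [eval_monomial, Finsupp.prod_fintype _ _ fun i => pow_zero _, mul_left_comm]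
  congr 1
  have h3 : ∏ j ∈ J, eval x (b.lam j) = ∏ i, eval x (b.lam i) ^ e i := by
    simp only [he, pow_ite, pow_one, pow_zero, Finset.prod_ite_mem, Finset.univ_inter]
  rw [h3, ← Finset.prod_mul_distrib]
  refine Finset.prod_congr rfl fun i _ => ?_
  rw [← pow_add, Finsupp.tsub_apply, Nat.add_sub_cancel' (hle d hd i)]

/-- A polynomial that vanishes on the tetrahedron is zero. -/
theorem eq_zero_of_vanish (b : Bary v) {f : Poly} (h0 : ∀ x ∈ hull v Finset.univ, eval x f = 0) : f = 0 := by
  have hf : f ∈ polys f.totalDegree := (mem_restrictTotalDegree _ _ _).2 le_rfl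
  have h : bernstein v f.totalDegree f = 0 := by
    ext d
    rw [coeff_zero]
    refine coeff_eq_zero_of_vanish Finset.univ_nonempty (bernstein_isHomogeneous v _ f) ?_
      (Finset.subset_univ _)
    intro μ hμ0 hμS hμ1
    rw [eval_bernstein hf hμ1]
    exact h0 _ (pt_mem_hull v hμ0 hμS hμ1)
  -- The coordinates of any point sum to one, so the vanishing Bernstein form determines f outside
  -- the tetrahedron as well.
  refine funext fun x => ?_
  have := eval_bernstein (v := v) hf (b.sum_eval_lam x)
  rw [b.pt_eval_lam, h, map_zero] at this
  rw [← this, map_zero]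

end Bary

/-! ### Integration of Bernstein polynomials over a face -/

/-- The functional `λ^d ↦ d! / (|d| + r)!` for `d` supported in `S`, and `λ^d ↦ 0` otherwise. -/
def dirichlet (S : Finset (Fin 4)) (r : ℕ) : MvPolynomial (Fin 4) ℝ →ₗ[ℝ] ℝ :=
  (basisMonomials (Fin 4) ℝ).constr ℝ fun d =>
    if d.support ⊆ S then (∏ i, ((d i).factorial : ℝ)) / ((d.degree + r).factorial : ℝ) else 0

theorem dirichlet_monomial (S : Finset (Fin 4)) (r : ℕ) (d : Fin 4 →₀ ℕ) (c : ℝ) :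
    dirichlet S r (monomial d c) = if d.support ⊆ S then
      c * ((∏ i, ((d i).factorial : ℝ)) / ((d.degree + r).factorial : ℝ)) else 0 := by
  have h : monomial d c = c • basisMonomials (Fin 4) ℝ d := by
    simp [smul_monomial]
  rw [h, map_smul, dirichlet, Module.Basis.constr_basis]
  split_ifs <;> simp

/-- The normalized integral over the face spanned by the vertices in `S`. -/
def faceFun (S : Finset (Fin 4)) : MvPolynomial (Fin 4) ℝ →ₗ[ℝ] ℝ := dirichlet S (S.card - 1)

/-- The source of integration by parts. The first term on the right does not depend on j, so it
cancels in combinations of total weight zero, that is, in tangential derivatives; the second is a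
boundary term. On monomials: if d j = 0 the two terms agree; otherwise the boundary term is zero and
d j · (d j - 1)! = (d j)!. -/
theorem faceFun_pderiv {S : Finset (Fin 4)} (hS : 2 ≤ S.card) {j : Fin 4} (hj : j ∈ S)
    (h : MvPolynomial (Fin 4) ℝ) :
    faceFun S (pderiv j h) = dirichlet S (S.card - 2) h - faceFun (S.erase j) h := by
  induction h using MvPolynomial.induction_on' with
  | add p q hp hq =>
    simp only [map_add, hp, hq]
    ring
  | monomial d c =>
    have hr : (S.erase j).card - 1 = S.card - 2 := by rw [Finset.card_erase_of_mem hj]; omega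
    rw [pderiv_monomial, faceFun, faceFun, hr, dirichlet_monomial, dirichlet_monomial,
      dirichlet_monomial]
    by_cases hd : d j = 0
    · have h1 : d.support ⊆ S.erase j ↔ d.support ⊆ S := by
        rw [Finset.subset_erase, and_iff_left]
        exact Finsupp.notMem_support_iff.2 hd
      simp only [h1, hd]
      simp
    · have h1 : ¬ d.support ⊆ S.erase j := by
        rw [Finset.subset_erase, not_and_not_right]
        exact fun _ => Finsupp.mem_support_iff.2 hd
      have hle : Finsupp.single j 1 ≤ d := Finsupp.single_le_iff.2 (Nat.one_le_iff_ne_zero.2 hd)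
      set d' := d - Finsupp.single j 1 with hd'
      have hdd : d = d' + Finsupp.single j 1 := (tsub_add_cancel_of_le hle).symm
      have h2 : d'.support ⊆ S ↔ d.support ⊆ S := by
        constructor
        · intro h i hi
          by_cases hij : i = j
          · exact hij ▸ hj
          · refine h (Finsupp.mem_support_iff.2 ?_)
            rw [hd', Finsupp.tsub_apply, Finsupp.single_eq_of_ne hij]
            exact Finsupp.mem_support_iff.1 hi
        · exact fun h i hi => h (Finsupp.support_tsub hi)
      rw [if_neg h1, sub_zero]
      simp only [h2]
      split_ifs with hdS
      · have hdeg : d.degree = d'.degree + 1 := by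
          rw [hdd, map_add, Finsupp.degree_single]
        have hprod : ∏ i, ((d i).factorial : ℝ) = d j * ∏ i, ((d' i).factorial : ℝ) := by
          rw [← Finset.mul_prod_erase _ _ (Finset.mem_univ j),
            ← Finset.mul_prod_erase _ (fun i => ((d' i).factorial : ℝ)) (Finset.mem_univ j)]
          have hj1 : d' j = d j - 1 := by simp [hd', Finsupp.tsub_apply]
          rw [hj1, ← mul_assoc]
          congr 1
          · exact_mod_cast (Nat.mul_factorial_pred hd).symm
          · refine Finset.prod_congr rfl fun i hi => ?_
            rw [hd', Finsupp.tsub_apply, Finsupp.single_eq_of_ne (Finset.ne_of_mem_erase hi),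
              tsub_zero]
        have hr2 : d'.degree + (S.card - 1) = d.degree + (S.card - 2) := by omega
        rw [hprod, hr2]
        ring
      · rfl

/-! ### Derivatives in barycentric coordinates. -/

theorem pull_X (v : Fin 4 → Vec) (a : Fin 3) : pull v (X a) = ∑ i, C (v i a) * X i := by
  simp [pull]

theorem pderiv_pull (v : Fin 4 → Vec) (i : Fin 4) (f : Poly) :
    pderiv i (pull v f) = ∑ a, C (v i a) * pull v (pderiv a f) := by
  induction f using MvPolynomial.induction_on with
  | C a => simp
  | add p q hp hq => simp only [map_add, hp, hq, mul_add, Finset.sum_add_distrib]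
  | mul_X p a hp =>
    have hX : pderiv i (pull v (X a)) = C (v i a) := by
      rw [pull_X, map_sum]
      simp [pderiv_X, Pi.single_apply]
    have h2 : ∀ c, pull v (pderiv c (p * X a)) =
        pull v (pderiv c p) * pull v (X a) + if c = a then pull v p else 0 := fun c => by
      rw [pderiv_mul, map_add, map_mul, map_mul, pderiv_X, Pi.single_apply]
      split_ifs with h1 h2 h2
      · simp
      · exact absurd h1.symm h2
      · exact absurd h2.symm h1
      · simp
    simp only [h2, mul_add, Finset.sum_add_distrib, mul_ite, mul_zero, Finset.sum_ite_eq',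
      Finset.mem_univ, if_true]
    rw [map_mul, pderiv_mul, hp, hX, Finset.sum_mul]
    simp only [mul_assoc]
    rw [mul_comm (pull v p)]

namespace Bary

variable {v : Fin 4 → Vec} (b : Bary v)

theorem pull_dirDeriv (w : Vec) (f : Poly) :
    pull v (dirDeriv w f) = ∑ i, C (b.g i ⬝ᵥ w) * pderiv i (pull v f) := by
  have h1 : ∀ i, C (b.g i ⬝ᵥ w) * pderiv i (pull v f) =
      ∑ a, C ((b.g i ⬝ᵥ w) * v i a) * pull v (pderiv a f) := fun i => by
    rw [pderiv_pull, Finset.mul_sum]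
    simp only [C_mul, mul_assoc]
  simp only [h1]
  rw [Finset.sum_comm]
  simp only [← Finset.sum_mul, ← map_sum, b.sum_dotProduct_smul_vertex]
  simp [dirDeriv, dotProduct, const]

/-- The divergence theorem on a face for derivatives in a tangential direction. -/
theorem faceFun_dirDeriv {S : Finset (Fin 4)} (hS : 2 ≤ S.card) {w : Vec}
    (hw : ∀ j ∉ S, b.g j ⬝ᵥ w = 0) (f : Poly) :
    faceFun S (pull v (dirDeriv w f)) =
      -∑ j ∈ S, (b.g j ⬝ᵥ w) * faceFun (S.erase j) (pull v f) := by
  -- The total weight is zero because the barycentric gradients sum to zero and w is tangential to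
  -- the face.
  have hsum : ∑ j ∈ S, b.g j ⬝ᵥ w = 0 := by
    rw [Finset.sum_subset (Finset.subset_univ S) fun j _ hj => hw j hj]
    simp only [dotProduct]
    rw [Finset.sum_comm]
    simp [← Finset.sum_mul, b.sum_g]
  rw [b.pull_dirDeriv, ← Finset.sum_subset (Finset.subset_univ S) fun j _ hj => by simp [hw j hj],
    map_sum]
  have : ∀ j ∈ S, faceFun S (C (b.g j ⬝ᵥ w) * pderiv j (pull v f)) =
      (b.g j ⬝ᵥ w) * dirichlet S (S.card - 2) (pull v f) -
        (b.g j ⬝ᵥ w) * faceFun (S.erase j) (pull v f) := fun j hj => by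
    rw [← smul_eq_C_mul, map_smul, faceFun_pderiv hS hj, smul_eq_mul, mul_sub]
  rw [Finset.sum_congr rfl this, Finset.sum_sub_distrib, ← Finset.sum_mul, hsum]
  simp

end Bary

open MeasureTheory

/-! ### Integrals over simplices -/

/-- The simplex `{x | 0 ≤ x i, ∑ x i ≤ h}`. -/
def corner (n : ℕ) (h : ℝ) : Set (Fin n → ℝ) := {x | (∀ i, 0 ≤ x i) ∧ ∑ i, x i ≤ h}

theorem isClosed_corner (n : ℕ) (h : ℝ) : IsClosed (corner n h) := by
  have h1 : corner n h = (⋂ i, {x | 0 ≤ x i}) ∩ {x | ∑ i, x i ≤ h} := by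
    ext x
    simp [corner]
  rw [h1]
  exact (isClosed_iInter fun i => isClosed_le continuous_const (continuous_apply i)).inter
    (isClosed_le (by fun_prop) continuous_const)

theorem isCompact_corner (n : ℕ) (h : ℝ) : IsCompact (corner n h) := by
  refine (isCompact_Icc (a := (0 : Fin n → ℝ)) (b := fun _ => h)).of_isClosed_subset
    (isClosed_corner n h) fun x hx => ⟨hx.1, fun i => ?_⟩
  exact (Finset.single_le_sum (fun j _ => hx.1 j) (Finset.mem_univ i)).trans hx.2

theorem measurableSet_corner (n : ℕ) (h : ℝ) : MeasurableSet (corner n h) :=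
  (isClosed_corner n h).measurableSet

theorem Continuous.integrableOn_corner {n : ℕ} {h : ℝ} {F : (Fin n → ℝ) → ℝ} (hF : Continuous F) :
    IntegrableOn F (corner n h) :=
  hF.continuousOn.integrableOn_compact (isCompact_corner n h)

theorem cons_mem_corner {n : ℕ} {h s : ℝ} {y : Fin n → ℝ} :
    (Fin.cons s y : Fin (n + 1) → ℝ) ∈ corner (n + 1) h ↔ 0 ≤ s ∧ y ∈ corner n (h - s) := by
  simp only [corner, Set.mem_ofPred_eq, Fin.forall_fin_succ, Fin.sum_univ_succ, Fin.cons_zero,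
    Fin.cons_succ, and_assoc, le_sub_iff_add_le']

theorem nonneg_of_mem_corner {n : ℕ} {h : ℝ} {y : Fin n → ℝ} (hy : y ∈ corner n h) : 0 ≤ h :=
  (Finset.sum_nonneg fun i _ => hy.1 i).trans hy.2

theorem integral_corner_zero {h : ℝ} (hh : 0 ≤ h) (F : (Fin 0 → ℝ) → ℝ) :
    ∫ x in corner 0 h, F x = F 0 := by
  have : corner 0 h = Set.univ := by
    ext x
    simp [corner, hh]
  rw [this, Measure.restrict_univ, integral_unique]
  simp only [volume_pi, Measure.real, Measure.pi_univ, Finset.univ_eq_empty, Finset.prod_empty,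
    ENNReal.toReal_one, one_smul]
  exact congrArg F (Subsingleton.elim _ _)

/-- Fubini: the slice of the simplex of size h at first coordinate s is a simplex of size h - s. The
size is a parameter so that inductions on the dimension can proceed. -/
theorem integral_corner_succ {n : ℕ} {h : ℝ} (hh : 0 ≤ h) {F : (Fin (n + 1) → ℝ) → ℝ}
    (hF : Continuous F) :
    ∫ x in corner (n + 1) h, F x = ∫ s in (0 : ℝ)..h, ∫ y in corner n (h - s), F (Fin.cons s y) := by
  have hT := measurableSet_corner (n + 1) h
  have hmp := (volume_preserving_piFinSuccAbove (fun _ : Fin (n + 1) => ℝ) 0).symm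
  have hint : Integrable ((corner (n + 1) h).indicator F) :=
    (integrable_indicator_iff hT).2 (Continuous.integrableOn_corner hF)
  rw [← integral_indicator hT, ← hmp.integral_comp']
  rw [← hmp.integrable_comp_emb (MeasurableEquiv.measurableEmbedding _)] at hint
  rw [intervalIntegral.integral_of_le hh, ← integral_Icc_eq_integral_Ioc,
    ← integral_indicator measurableSet_Icc]
  change ∫ p : ℝ × (Fin n → ℝ), ((corner (n + 1) h).indicator F ∘
    (MeasurableEquiv.piFinSuccAbove (fun _ : Fin (n + 1) => ℝ) 0).symm) p = _
  rw [Measure.volume_eq_prod, integral_prod _ hint]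
  refine integral_congr_ae (Filter.Eventually.of_forall fun s => ?_)
  simp only [Function.comp_apply, MeasurableEquiv.piFinSuccAbove_symm_apply, Fin.insertNthEquiv, Equiv.coe_fn_mk,
    Fin.insertNth_zero]
  by_cases hs : s ∈ Set.Icc 0 h
  · rw [Set.indicator_of_mem hs, ← integral_indicator (measurableSet_corner n _)]
    refine integral_congr_ae (Filter.Eventually.of_forall fun y => ?_)
    by_cases hy : y ∈ corner n (h - s)
    · simp only [Set.indicator_of_mem hy]
      exact Set.indicator_of_mem (cons_mem_corner.2 ⟨hs.1, hy⟩) F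
    · simp only [Set.indicator_of_notMem hy]
      exact Set.indicator_of_notMem (fun h' => hy (cons_mem_corner.1 h').2) F
  · rw [Set.indicator_of_notMem hs]
    refine integral_eq_zero_of_ae (Filter.Eventually.of_forall fun y => ?_)
    refine Set.indicator_of_notMem (fun h' => hs ?_) F
    obtain ⟨h0, hy⟩ := cons_mem_corner.1 h'
    exact ⟨h0, by linarith [nonneg_of_mem_corner hy]⟩

/-- The Beta integral: integration by parts moves one power from s to h - s, and the boundary terms
vanish. -/
theorem integral_pow_mul_sub_pow (p q : ℕ) (h : ℝ) :
    ∫ s in (0 : ℝ)..h, s ^ p * (h - s) ^ q =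
      (p.factorial * q.factorial : ℝ) / (p + q + 1).factorial * h ^ (p + q + 1) := by
  induction p generalizing q with
  | zero =>
    have hd : ∀ s ∈ Set.uIcc 0 h,
        HasDerivAt (fun s : ℝ => -((h - s) ^ (q + 1) / (q + 1))) (s ^ 0 * (h - s) ^ q) s := by
      intro s _
      have h1 := ((((hasDerivAt_id s).const_sub h).pow (q + 1)).div_const ((q : ℝ) + 1)).neg
      refine HasDerivAt.congr_deriv h1 ?_
      have : (q : ℝ) + 1 ≠ 0 := by positivity
      simp
      field_simp
    rw [intervalIntegral.integral_eq_sub_of_hasDerivAt hd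
      (Continuous.intervalIntegrable (by fun_prop) _ _)]
    have : (q : ℝ) + 1 ≠ 0 := by positivity
    have hq : (q.factorial : ℝ) ≠ 0 := by positivity
    simp [Nat.factorial_succ]
    field_simp
  | succ p ih =>
    have hd : ∀ s ∈ Set.uIcc 0 h,
        HasDerivAt (fun s : ℝ => s ^ (p + 1) * (h - s) ^ (q + 1))
          ((p + 1) * (s ^ p * (h - s) ^ (q + 1)) - (q + 1) * (s ^ (p + 1) * (h - s) ^ q)) s := by
      intro s _
      have h1 := ((hasDerivAt_id s).pow (p + 1)).mul (((hasDerivAt_id s).const_sub h).pow (q + 1))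
      refine HasDerivAt.congr_deriv h1 ?_
      simp
      ring
    have h2 := intervalIntegral.integral_eq_sub_of_hasDerivAt hd
      (Continuous.intervalIntegrable (by fun_prop) _ _)
    rw [intervalIntegral.integral_sub (Continuous.intervalIntegrable (by fun_prop) _ _)
      (Continuous.intervalIntegrable (by fun_prop) _ _),
      intervalIntegral.integral_const_mul, intervalIntegral.integral_const_mul, ih] at h2
    simp only [sub_self, zero_pow (Nat.succ_ne_zero _), mul_zero, zero_mul] at h2
    have hq : (q : ℝ) + 1 ≠ 0 := by positivity
    rw [show p + (q + 1) + 1 = p + 1 + q + 1 by ring] at h2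
    refine mul_left_cancel₀ hq ?_
    rw [← sub_eq_zero.1 h2]
    simp only [Nat.factorial_succ p, Nat.factorial_succ q]
    push_cast
    ring

/-- Dirichlet's integral. -/
theorem integral_corner_monomial (n : ℕ) (a : ℕ) (d : Fin n → ℕ) {h : ℝ} (hh : 0 ≤ h) :
    ∫ x in corner n h, (h - ∑ i, x i) ^ a * ∏ i, x i ^ d i =
      (a.factorial * ∏ i, ((d i).factorial : ℝ)) / (a + ∑ i, d i + n).factorial *
        h ^ (a + ∑ i, d i + n) := by
  induction n generalizing h with
  | zero =>
    rw [integral_corner_zero hh]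
    have : (a.factorial : ℝ) ≠ 0 := by positivity
    simp [this]
  | succ n ih =>
    rw [integral_corner_succ hh (by fun_prop)]
    simp only [Fin.sum_univ_succ, Fin.prod_univ_succ, Fin.cons_zero, Fin.cons_succ]
    set D := ∑ i : Fin n, d i.succ
    set P := ∏ i : Fin n, ((d i.succ).factorial : ℝ)
    have h1 : ∀ s ∈ Set.uIcc 0 h,
        (∫ y in corner n (h - s), (h - (s + ∑ i, y i)) ^ a * (s ^ d 0 * ∏ i, y i ^ d i.succ)) =
        (a.factorial * P) / (a + D + n).factorial * (s ^ d 0 * (h - s) ^ (a + D + n)) := by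
      intro s hs
      rw [Set.uIcc_of_le hh] at hs
      have := ih (fun i => d i.succ) (h := h - s) (by linarith [hs.2])
      rw [mul_left_comm, ← this, ← integral_const_mul]
      congr 1
      ext y
      rw [sub_sub]
      ring
    rw [intervalIntegral.integral_congr h1, intervalIntegral.integral_const_mul,
      integral_pow_mul_sub_pow]
    have hf : ((a + D + n).factorial : ℝ) ≠ 0 := by positivity
    rw [show d 0 + (a + D + n) + 1 = a + (d 0 + D) + (n + 1) by ring]
    field_simp

theorem convex_corner (n : ℕ) (h : ℝ) : Convex ℝ (corner n h) := by
  intro x hx y hy s t hs ht hst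
  refine ⟨fun i => ?_, ?_⟩
  · exact add_nonneg (mul_nonneg hs (hx.1 i)) (mul_nonneg ht (hy.1 i))
  · have h1 : ∑ i, (s • x + t • y) i = s * ∑ i, x i + t * ∑ i, y i := by
      simp [Finset.sum_add_distrib, Finset.mul_sum]
    rw [h1]
    calc s * ∑ i, x i + t * ∑ i, y i ≤ s * h + t * h :=
          add_le_add (mul_le_mul_of_nonneg_left hx.2 hs) (mul_le_mul_of_nonneg_left hy.2 ht)
      _ = h := by rw [← add_mul, hst, one_mul]

theorem interior_corner_nonempty (n : ℕ) : (interior (corner n 1)).Nonempty := by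
  have hopen : IsOpen {x : Fin n → ℝ | (∀ i, 0 < x i) ∧ ∑ i, x i < 1} := by
    have h1 : {x : Fin n → ℝ | (∀ i, 0 < x i) ∧ ∑ i, x i < 1} =
        (⋂ i, {x | 0 < x i}) ∩ {x | ∑ i, x i < 1} := by
      ext x
      simp
    rw [h1]
    exact (isOpen_iInter_of_finite fun i => isOpen_lt continuous_const (continuous_apply i)).inter
      (isOpen_lt (by fun_prop) continuous_const)
  refine ⟨fun _ => 1 / (n + 1 : ℝ), interior_maximal ?_ hopen ⟨fun i => by positivity, ?_⟩⟩
  · exact fun x hx => ⟨fun i => (hx.1 i).le, hx.2.le⟩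
  · have : (0 : ℝ) < n + 1 := by positivity
    simp only [Finset.sum_const, Finset.card_univ, Fintype.card_fin, nsmul_eq_mul]
    rw [mul_one_div, div_lt_one this]
    linarith

/-- A continuous nonnegative function on the simplex with vanishing integral is zero. -/
theorem eqOn_zero_of_integral_corner {n : ℕ} {F : (Fin n → ℝ) → ℝ} (hF : Continuous F)
    (h0 : ∀ x ∈ corner n 1, 0 ≤ F x) (h : ∫ x in corner n 1, F x = 0) :
    ∀ x ∈ corner n 1, F x = 0 := by
  rw [setIntegral_eq_zero_iff_of_nonneg_ae
    ((ae_restrict_iff' (measurableSet_corner n 1)).2 (Filter.Eventually.of_forall h0))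
    (Continuous.integrableOn_corner hF)] at h
  -- Vanishing almost everywhere extends by continuity, since the convex set with interior points
  -- lies in the closure of its interior.
  refine Measure.eqOn_of_ae_eq h hF.continuousOn continuousOn_const ?_
  rw [(convex_corner n 1).closure_interior_eq_closure_of_nonempty_interior
    (interior_corner_nonempty n)]
  exact subset_closure

/-! ### The normalized integrals as integrals -/

/-- The barycentric coordinates of the point of the face with vertices `e 0, …, e n` that has the
parameters `y`. -/
def coordOf {n : ℕ} (e : Fin (n + 1) → Fin 4) (y : Fin n → ℝ) (i : Fin 4) : ℝ :=
  ∑ k, if e k = i then (Fin.cons (1 - ∑ j, y j) y : Fin (n + 1) → ℝ) k else 0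

section

variable {n : ℕ} {e : Fin (n + 1) → Fin 4}

theorem continuous_coordOf : Continuous (coordOf e) := by
  refine continuous_pi fun i => ?_
  unfold coordOf
  simp only [Fin.sum_univ_succ, Fin.cons_zero, Fin.cons_succ]
  refine Continuous.add ?_ (continuous_finsetSum _ fun k _ => ?_)
  · split_ifs <;> fun_prop
  · split_ifs <;> fun_prop

theorem sum_coordOf (y : Fin n → ℝ) : ∑ i, coordOf e y i = 1 := by
  simp only [coordOf]
  rw [Finset.sum_comm]
  simp [Fin.sum_univ_succ]

theorem coordOf_nonneg {y : Fin n → ℝ} (hy : y ∈ corner n 1) (i : Fin 4) : 0 ≤ coordOf e y i := by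
  refine Finset.sum_nonneg fun k _ => ?_
  split_ifs
  · refine Fin.cases ?_ (fun j => ?_) k
    · exact sub_nonneg.2 hy.2
    · exact hy.1 j
  · exact le_rfl

theorem coordOf_eq_zero {S : Finset (Fin 4)} (hS : Finset.univ.image e = S) (y : Fin n → ℝ)
    {i : Fin 4} (hi : i ∉ S) : coordOf e y i = 0 := by
  refine Finset.sum_eq_zero fun k _ => if_neg ?_
  rintro rfl
  exact hi (hS ▸ Finset.mem_image_of_mem e (Finset.mem_univ k))

theorem coordOf_apply (he : Function.Injective e) (y : Fin n → ℝ) (k : Fin (n + 1)) :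
    coordOf e y (e k) = (Fin.cons (1 - ∑ j, y j) y : Fin (n + 1) → ℝ) k := by
  simp [coordOf, he.eq_iff]

theorem pt_coordOf (v : Fin 4 → Vec) (y : Fin n → ℝ) :
    pt v (coordOf e y) = v (e 0) + ∑ j, y j • (v (e j.succ) - v (e 0)) := by
  ext a
  simp only [pt, coordOf, Finset.mul_sum]
  rw [Finset.sum_comm]
  simp only [mul_ite, mul_zero, Finset.sum_ite_eq, Finset.mem_univ, if_true, Fin.sum_univ_succ,
    Fin.cons_zero, Fin.cons_succ, Pi.add_apply, Finset.sum_apply, Pi.smul_apply, Pi.sub_apply,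
    smul_eq_mul, mul_sub, Finset.sum_sub_distrib, ← Finset.sum_mul]
  rw [Finset.sum_congr rfl fun j _ => mul_comm (v (e (Fin.succ j)) a) (y j)]
  ring

theorem pt_coordOf_mem (v : Fin 4 → Vec) {S : Finset (Fin 4)} (hS : Finset.univ.image e = S)
    {y : Fin n → ℝ} (hy : y ∈ corner n 1) : pt v (coordOf e y) ∈ hull v S :=
  pt_mem_hull v (coordOf_nonneg hy) (fun _ hi => coordOf_eq_zero hS y hi) (sum_coordOf y)

theorem continuous_eval_coordOf (h : MvPolynomial (Fin 4) ℝ) :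
    Continuous fun y => eval (coordOf e y) h :=
  h.continuous_eval.comp continuous_coordOf

/-- The normalized integral over a face is an integral over a parameter domain. -/
theorem faceFun_eq_integral (he : Function.Injective e) {S : Finset (Fin 4)}
    (hS : Finset.univ.image e = S) (h : MvPolynomial (Fin 4) ℝ) :
    faceFun S h = ∫ y in corner n 1, eval (coordOf e y) h := by
  have hcard : S.card - 1 = n := by
    rw [← hS, Finset.card_image_of_injective _ he]
    simp
  rw [faceFun, hcard]
  induction h using MvPolynomial.induction_on' with
  | add p q hp hq =>
    simp only [map_add, hp, hq]
    exact (integral_add (Continuous.integrableOn_corner (continuous_eval_coordOf p))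
      (Continuous.integrableOn_corner (continuous_eval_coordOf q))).symm
  | monomial d c =>
    rw [dirichlet_monomial]
    simp only [eval_monomial, Finsupp.prod_fintype _ _ fun i => pow_zero _]
    rw [integral_const_mul]
    split_ifs with hd
    · have hsum : ∀ {M : Type} [CommMonoid M] (f : Fin 4 → M), (∀ i ∉ S, f i = 1) →
          ∏ i, f i = f (e 0) * ∏ k : Fin n, f (e k.succ) := fun f hf => by
        rw [← Finset.prod_subset (Finset.subset_univ S) fun i _ hi => hf i hi, ← hS,
          Finset.prod_image he.injOn, Fin.prod_univ_succ]
      have hd0 : ∀ i ∉ S, d i = 0 := fun i hi => Finsupp.notMem_support_iff.1 fun h => hi (hd h)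
      have h1 : ∀ y, ∏ i, coordOf e y i ^ d i =
          (1 - ∑ j, y j) ^ d (e 0) * ∏ k : Fin n, y k ^ d (e k.succ) := fun y => by
        rw [hsum (fun i => coordOf e y i ^ d i) fun i hi => by simp [hd0 i hi]]
        simp only [coordOf_apply he, Fin.cons_zero, Fin.cons_succ]
      have h2 : d.degree = d (e 0) + ∑ k : Fin n, d (e k.succ) := by
        rw [Finsupp.degree_eq_sum]
        exact hsum (M := Multiplicative ℕ) (fun i => Multiplicative.ofAdd (d i))
          fun i hi => by simp [hd0 i hi]
      have h3 := hsum (fun i => ((d i).factorial : ℝ)) fun i hi => by simp [hd0 i hi]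
      simp only [h1]
      rw [integral_corner_monomial n _ _ zero_le_one, h2, h3]
      simp
    · obtain ⟨i, hi, hiS⟩ := Finset.not_subset.1 hd
      have h1 : ∀ y, ∏ i, coordOf e y i ^ d i = 0 := fun y => by
        refine Finset.prod_eq_zero (Finset.mem_univ i) ?_
        rw [coordOf_eq_zero hS y hiS, zero_pow (Finsupp.mem_support_iff.1 hi)]
      simp [h1]

end

theorem exists_enumeration {S : Finset (Fin 4)} (hS : S.Nonempty) :
    ∃ n, ∃ e : Fin (n + 1) → Fin 4, Function.Injective e ∧ Finset.univ.image e = S := by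
  obtain ⟨n, hn⟩ := Nat.exists_eq_succ_of_ne_zero hS.card_ne_zero
  refine ⟨n, S.orderEmbOfFin hn, (S.orderEmbOfFin hn).injective, ?_⟩
  rw [← Finset.coe_inj, Finset.coe_image, Finset.coe_univ, Set.image_univ,
    Finset.range_orderEmbOfFin]

/-- Two polynomials that agree on a face have the same normalized integral. -/
theorem faceFun_congr {v : Fin 4 → Vec} {S : Finset (Fin 4)} (hS : S.Nonempty)
    {f f' : Poly}
    (h : ∀ x ∈ hull v S, eval x f = eval x f') : faceFun S (pull v f) = faceFun S (pull v f') := by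
  obtain ⟨n, e, he, heS⟩ := exists_enumeration hS
  rw [faceFun_eq_integral he heS, faceFun_eq_integral he heS]
  refine setIntegral_congr_fun (measurableSet_corner n 1) fun y hy => ?_
  simp only [eval_pull]
  exact h _ (pt_coordOf_mem v heS hy)

namespace Bary

variable {v : Fin 4 → Vec}

/-- The parameters of a point of a face are barycentric coordinates. -/
theorem mem_corner_and_pt_coordOf (b : Bary v) {S : Finset (Fin 4)} {n : ℕ}
    {e : Fin (n + 1) → Fin 4} (he : Function.Injective e) (heS : Finset.univ.image e = S) {x : Vec}
    (hx : x ∈ hull v S) : (fun k => eval x (b.lam (e k.succ))) ∈ corner n 1 ∧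
      pt v (coordOf e fun k => eval x (b.lam (e k.succ))) = x := by
  obtain ⟨hx0, hxS⟩ := b.mem_hull_iff.1 hx
  have hsum : ∑ k, eval x (b.lam (e k)) = 1 := by
    rw [← b.sum_eval_lam x, ← Finset.sum_subset (Finset.subset_univ S) fun i _ hi => hxS i hi,
      ← heS, Finset.sum_image he.injOn]
  rw [Fin.sum_univ_succ] at hsum
  refine ⟨⟨fun k => hx0 _, by linarith [hx0 (e 0)]⟩, ?_⟩
  conv_rhs => rw [← b.pt_eval_lam x]
  congr 1
  ext i
  by_cases hi : i ∈ S
  · rw [← heS] at hi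
    obtain ⟨k, _, rfl⟩ := Finset.mem_image.1 hi
    rw [coordOf_apply he]
    refine Fin.cases ?_ (fun j => ?_) k
    · rw [Fin.cons_zero]
      linarith
    · rw [Fin.cons_succ]
  · rw [hxS i hi, coordOf_eq_zero heS _ hi]

/-- A nonnegative polynomial on a face with vanishing integral is zero there. -/
theorem vanish_of_faceFun_eq_zero (b : Bary v) {S : Finset (Fin 4)} (hS : S.Nonempty) {f : Poly}
    (h0 : ∀ x ∈ hull v S, 0 ≤ eval x f) (h : faceFun S (pull v f) = 0) :
    ∀ x ∈ hull v S, eval x f = 0 := by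
  obtain ⟨n, e, he, heS⟩ := exists_enumeration hS
  rw [faceFun_eq_integral he heS] at h
  have h1 := eqOn_zero_of_integral_corner (continuous_eval_coordOf _) (fun y hy => by
    rw [eval_pull]
    exact h0 _ (pt_coordOf_mem v heS hy)) h
  intro x hx
  obtain ⟨hy, hxy⟩ := b.mem_corner_and_pt_coordOf he heS hx
  have h2 := h1 _ hy
  rwa [eval_pull, hxy] at h2

/-- A polynomial on a face that vanishes on some of the subfaces of codimension one, and whose
moments against the polynomials of the complementary degree vanish, is zero on the face. -/
theorem vanish_of_moments (b : Bary v) {m : ℕ} {S J : Finset (Fin 4)} (hS : S.Nonempty) {f : Poly}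
    (hf : f ∈ polys m) (hJ : ∀ j ∈ J, (S.erase j).Nonempty)
    (h0 : ∀ j ∈ J, ∀ x ∈ hull v (S.erase j), eval x f = 0)
    (h : ∀ q ∈ polys (m - J.card), faceFun S (pull v (f * q)) = 0) :
    ∀ x ∈ hull v S, eval x f = 0 := by
  obtain ⟨q, hq, hfq⟩ := b.exists_eq_prod_lam_mul hf hJ h0
  -- The quotient q itself is the test function: f q is q² times a product of barycentric
  -- coordinates, which is nonnegative on the face.
  have h1 : ∀ x ∈ hull v S, eval x (f * q) = 0 := by
    refine b.vanish_of_faceFun_eq_zero hS (fun x hx => ?_) (h q hq)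
    rw [map_mul, hfq x hx, mul_assoc]
    exact mul_nonneg (Finset.prod_nonneg fun j _ => (b.mem_hull_iff.1 hx).1 j)
      (mul_self_nonneg _)
  intro x hx
  have h2 := h1 x hx
  rw [map_mul] at h2
  rcases mul_eq_zero.1 h2 with h3 | h3
  · exact h3
  · rw [hfq x hx, h3, mul_zero]

end Bary

/-! ### The degrees of freedom as normalized integrals -/

theorem len_pos {a : Vec} (ha : a ≠ 0) : 0 < len a := by
  refine Real.sqrt_pos.2 (lt_of_le_of_ne ?_ fun h => ha (dotProduct_self_eq_zero.1 h.symm))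
  exact Finset.sum_nonneg fun i _ => mul_self_nonneg _

/-- F has to agree with a polynomial only on the edge, because test functions there are extended by
zero to the rest of space. -/
theorem edgeIntegral_eq (v : Fin 4 → Vec) (e : Edge) {F : Vec → ℝ} {f : Poly}
    (hF : ∀ x ∈ edge v e, F x = eval x f) :
    edgeIntegral v e F =
      len (v e.1.2 - v e.1.1) * faceFun {e.1.1, e.1.2} (pull v f) := by
  have hne : e.1.1 ≠ e.1.2 := e.2.ne
  let w : Fin 2 → Fin 4 := ![e.1.1, e.1.2]
  have hw : Function.Injective w := by
    intro a b
    fin_cases a <;> fin_cases b <;> simp [w, hne, hne.symm]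
  have hwS : Finset.univ.image w = {e.1.1, e.1.2} := by
    ext i
    simp [w, Fin.exists_fin_two, eq_comm]
  rw [edgeIntegral, faceFun_eq_integral hw hwS,
    integral_corner_succ zero_le_one (continuous_eval_coordOf _)]
  congr 1
  refine intervalIntegral.integral_congr fun s hs => ?_
  rw [Set.uIcc_of_le zero_le_one] at hs
  have hs1 : 0 ≤ 1 - s := by linarith [hs.2]
  have hy : (Fin.cons s 0 : Fin 1 → ℝ) ∈ corner 1 1 :=
    cons_mem_corner.2 ⟨hs.1, by simp [corner, hs1]⟩
  have hpt := pt_coordOf_mem v hwS hy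
  have hpt' : pt v (coordOf w (Fin.cons s 0)) = v e.1.1 + s • (v e.1.2 - v e.1.1) := by
    rw [pt_coordOf]
    simp [w]
  rw [hpt', hull_pair] at hpt
  rw [integral_corner_zero hs1, hF _ hpt, eval_pull, hpt']

theorem faceIntegral_eq (v : Fin 4 → Vec) (i : Fin 4) {F : Vec → ℝ} {f : Poly}
    (hF : ∀ x ∈ face v i, F x = eval x f) :
    faceIntegral v i F =
      len ((v (i.succAbove 1) - v (i.succAbove 0)) ⨯₃ (v (i.succAbove 2) - v (i.succAbove 0))) *
        faceFun {i}ᶜ (pull v f) := by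
  have hw : Function.Injective i.succAbove := Fin.succAbove_right_injective
  have hwS : Finset.univ.image i.succAbove = {i}ᶜ := Fin.image_succAbove_univ i
  rw [faceIntegral, faceFun_eq_integral hw hwS,
    integral_corner_succ zero_le_one (continuous_eval_coordOf _)]
  congr 1
  refine intervalIntegral.integral_congr fun s hs => ?_
  rw [Set.uIcc_of_le zero_le_one] at hs
  have hs1 : 0 ≤ 1 - s := by linarith [hs.2]
  have hc : Continuous fun y : Fin 1 → ℝ =>
      eval (coordOf i.succAbove (Fin.cons s y)) (pull v f) :=
    (continuous_eval_coordOf (e := i.succAbove) (pull v f)).comp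
      (continuous_pi fun k => by
        refine Fin.cases ?_ (fun j => ?_) k
        · exact continuous_const
        · exact continuous_apply j)
  rw [integral_corner_succ hs1 hc]
  refine intervalIntegral.integral_congr fun t ht => ?_
  rw [Set.uIcc_of_le hs1] at ht
  have ht1 : 0 ≤ 1 - s - t := by linarith [ht.2]
  have hy : (Fin.cons s (Fin.cons t 0 : Fin 1 → ℝ) : Fin 2 → ℝ) ∈ corner 2 1 :=
    cons_mem_corner.2 ⟨hs.1, cons_mem_corner.2 ⟨ht.1, by simpa [corner] using ht1⟩⟩
  have hpt := pt_coordOf_mem v hwS hy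
  have hpt' : pt v (coordOf i.succAbove (Fin.cons s (Fin.cons t 0 : Fin 1 → ℝ))) =
      v (i.succAbove 0) + s • (v (i.succAbove 1) - v (i.succAbove 0))
        + t • (v (i.succAbove 2) - v (i.succAbove 0)) := by
    rw [pt_coordOf, Fin.sum_univ_two, add_assoc]
    rfl
  rw [hpt', hull_compl_singleton] at hpt
  rw [integral_corner_zero ht1, hF _ hpt, eval_pull, hpt']

theorem Bary.dotProduct_vertex_sub {v : Fin 4 → Vec} (b : Bary v) (i j k : Fin 4) :
    b.g i ⬝ᵥ (v j - v k) = (if i = j then 1 else 0) - if i = k then 1 else 0 := by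
  rw [← b.eval_lam_vertex, ← b.eval_lam_vertex, eval_lam, eval_lam, dotProduct_sub]
  ring

/-- Affine change of variables from the reference simplex. Only K ≠ 0 matters, since the constant is
used just to pass vanishing moments from one integral to the other. -/
theorem exists_tet_integral_eq {v : Fin 4 → Vec} (b : Bary v) :
    ∃ K : ℝ, K ≠ 0 ∧ ∀ f : Poly,
      ∫ x in tet v, eval x f = K * faceFun Finset.univ (pull v f) := by
  let A : Vec →L[ℝ] Vec :=
    ∑ j : Fin 3, (ContinuousLinearMap.proj (R := ℝ) (φ := fun _ : Fin 3 => ℝ) j).smulRight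
      (v j.succ - v 0)
  have hA : ∀ y, A y = ∑ j : Fin 3, y j • (v j.succ - v 0) := fun y => by
    simp [A]
  have hgA : ∀ y k, b.g (Fin.succ k) ⬝ᵥ A y = y k := fun y k => by
    rw [hA, dotProduct_sum]
    simp only [dotProduct_smul, b.dotProduct_vertex_sub, Fin.succ_inj, Fin.succ_ne_zero, if_false,
      sub_zero, smul_eq_mul, mul_ite, mul_one, mul_zero, Finset.sum_ite_eq, Finset.mem_univ,
      if_true]
  have hinj : Function.Injective A := fun y z h => by
    ext k
    rw [← hgA y k, h, hgA]
  have hdet : A.det ≠ 0 := fun h => by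
    have h1 := LinearMap.bot_lt_ker_of_det_eq_zero h
    have h2 : LinearMap.ker (A : Vec →ₗ[ℝ] Vec) = ⊥ := LinearMap.ker_eq_bot.2 hinj
    exact h1.ne' h2
  have hpt : ∀ y, pt v (coordOf (n := 3) id y) = v 0 + A y := fun y => by
    rw [pt_coordOf, hA]
    rfl
  have himg : (fun y => v 0 + A y) '' corner 3 1 = tet v := by
    rw [← hull_univ]
    refine Set.Subset.antisymm ?_ fun x hx => ?_
    · rintro _ ⟨y, hy, rfl⟩
      simp only [← hpt]
      exact pt_coordOf_mem v (by simp) hy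
    · obtain ⟨hy, hxy⟩ := b.mem_corner_and_pt_coordOf (n := 3) Function.injective_id (by simp) hx
      rw [hpt] at hxy
      exact ⟨_, hy, hxy⟩
  refine ⟨|A.det|, abs_ne_zero.2 hdet, fun f => ?_⟩
  rw [← himg, integral_image_eq_integral_abs_det_fderiv_smul volume (measurableSet_corner 3 1)
    (fun y _ => (A.hasFDerivAt.const_add (v 0)).hasFDerivWithinAt)
    (fun y _ z _ h => hinj (add_left_cancel h)), integral_smul, smul_eq_mul,
    faceFun_eq_integral (n := 3) (e := id) Function.injective_id (by simp)]
  simp only [eval_pull, hpt]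

/-- The Frobenius product of two tensor fields. -/
def frob (τ ς : Tensor) : Poly := ∑ i, ∑ j, τ i j * ς i j

theorem interiorMoment_eq (v : Fin 4 → Vec) (τ ς : Tensor) :
    interiorMoment v τ ς = ∫ x in tet v, eval x (frob τ ς) := by
  simp [interiorMoment, frob, value]

theorem edge_length_ne_zero {v : Fin 4 → Vec} (hv : AffineIndependent ℝ v) (e : Edge) :
    len (v e.1.2 - v e.1.1) ≠ 0 :=
  (len_pos (sub_ne_zero.2 (hv.injective.ne e.2.ne'))).ne'

theorem face_area_ne_zero {v : Fin 4 → Vec} (b : Bary v) (i : Fin 4) :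
    len ((v (i.succAbove 1) - v (i.succAbove 0)) ⨯₃ (v (i.succAbove 2) - v (i.succAbove 0))) ≠
      0 := by
  refine (len_pos (crossProduct_ne_zero_iff_linearIndependent.2 ?_)).ne'
  rw [LinearIndependent.pair_iff]
  intro s t h
  have hg : ∀ k, b.g (i.succAbove k) ⬝ᵥ (s • (v (i.succAbove 1) - v (i.succAbove 0)) +
      t • (v (i.succAbove 2) - v (i.succAbove 0))) = 0 := fun k => by rw [h, dotProduct_zero]
  simp only [dotProduct_add, dotProduct_smul, b.dotProduct_vertex_sub,
    Fin.succAbove_right_inj, smul_eq_mul] at hg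
  constructor
  · simpa using hg 1
  · simpa using hg 2

/-! ### Components of tensor fields -/

theorem eval_comp (a b : Vec) (τ : Tensor) (x : Vec) :
    eval x (comp a τ b) = a ⬝ᵥ (value τ x *ᵥ b) := by
  simp [comp, dotProduct, Matrix.mulVec, const, value]

theorem comp_eq_sum (a b : Vec) (τ : Tensor) :
    comp a τ b = ∑ i, ∑ j, C (a i * b j) * τ i j := by
  simp only [comp, dotProduct, Matrix.mulVec, const, Finset.mul_sum, C_mul]
  exact Finset.sum_congr rfl fun i _ => Finset.sum_congr rfl fun j _ => by ring

theorem comp_comm {τ : Tensor} (hτ : τᵀ = τ) (a b : Vec) : comp a τ b = comp b τ a := by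
  rw [comp_eq_sum, comp_eq_sum, Finset.sum_comm]
  refine Finset.sum_congr rfl fun i _ => Finset.sum_congr rfl fun j _ => ?_
  rw [show τ j i = τ i j from congrFun (congrFun hτ i) j, mul_comm (a j)]

theorem comp_add_tensor (a b : Vec) (τ ς : Tensor) :
    comp a (τ + ς) b = comp a τ b + comp a ς b := by
  simp [comp, Matrix.add_mulVec, dotProduct_add]

theorem comp_mem {m : ℕ} {τ : Tensor} (hτ : τ ∈ symT m) (a b : Vec) : comp a τ b ∈ polys m := by
  rw [comp_eq_sum]
  exact Submodule.sum_mem _ fun i _ => Submodule.sum_mem _ fun j _ =>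
    C_mul_mem_restrict _ (hτ.1 i j)

/-- Where a · x and b · x are constant, this has the degree of q rather than two more. -/
theorem eval_comp_posPos (a b : Vec) (q : Poly) (x : Vec) :
    eval x (comp a (posPos q) b) = (a ⬝ᵥ x) * (b ⬝ᵥ x) * eval x q := by
  simp only [eval_comp, dotProduct, Matrix.mulVec, value, posPos, pos, LinearMap.coe_mk,
    AddHom.coe_mk, Matrix.map_apply, Matrix.of_apply, map_mul, eval_X, Fin.sum_univ_three]
  ring

/-- `τ = σ + x xᵀ q` with `σ` a symmetric curl. -/
theorem exists_of_mem_shape {l k : ℕ} {τ : Tensor} (hτ : τ ∈ shape l k) :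
    ∃ A ∈ polysT (l + 1), ∃ q ∈ polys (k - 2), τ = symCurl A + posPos q := by
  obtain ⟨_, ⟨A, hA, rfl⟩, _, ⟨q, hq, rfl⟩, rfl⟩ := Submodule.mem_sup.1 hτ
  exact ⟨A, hA, q, hq, rfl⟩

theorem transpose_of_mem_shape {l k : ℕ} {τ : Tensor} (hτ : τ ∈ shape l k) : τᵀ = τ := by
  obtain ⟨A, hA, q, hq, rfl⟩ := exists_of_mem_shape hτ
  rw [Matrix.transpose_add, (symCurl_mem hA).2, (posPos_mem hq).2]

namespace Bary

variable {v : Fin 4 → Vec}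

theorem dotProduct_eq_of_mem_hull (b : Bary v) {S : Finset (Fin 4)} {a : Vec} {c : ℝ}
    (h : ∀ j ∈ S, a ⬝ᵥ v j = c) {x : Vec} (hx : x ∈ hull v S) : a ⬝ᵥ x = c := by
  have h1 : a ⬝ᵥ x = ∑ j, eval x (b.lam j) * (a ⬝ᵥ v j) := by
    conv_lhs => rw [← b.pt_eval_lam x]
    simp only [dotProduct, pt, Finset.mul_sum]
    rw [Finset.sum_comm]
    exact Finset.sum_congr rfl fun i _ => Finset.sum_congr rfl fun j _ => by ring
  have h2 : ∀ j, eval x (b.lam j) * (a ⬝ᵥ v j) = eval x (b.lam j) * c := fun j => by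
    by_cases hj : j ∈ S
    · rw [h j hj]
    · rw [(b.mem_hull_iff.1 hx).2 j hj, zero_mul, zero_mul]
  rw [h1, Finset.sum_congr rfl fun j _ => h2 j, ← Finset.sum_mul, b.sum_eval_lam, one_mul]

theorem eq_vertex_of_mem_hull_singleton (b : Bary v) {j : Fin 4} {x : Vec} (hx : x ∈ hull v {j}) :
    x = v j := by
  have h := (b.mem_hull_iff.1 hx).2
  have h1 := b.sum_eval_lam x
  rw [Finset.sum_eq_single j (fun i _ hi => h i (by simpa using hi)) (by simp)] at h1
  rw [← b.pt_eval_lam x]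
  ext a
  rw [pt, Finset.sum_eq_single j (fun i _ hi => by rw [h i (by simpa using hi), mul_zero])
    (by simp), h1, mul_one]

/-- On a face, a component of a shape function in directions normal to it has degree at most `l`,
since the radial part is of lower degree there. -/
theorem exists_comp_eq_on_hull (b : Bary v) {l k : ℕ} (hkl : k - 2 ≤ l) {τ : Tensor}
    (hτ : τ ∈ shape l k) {S : Finset (Fin 4)} {a a' : Vec} {c c' : ℝ} (ha : ∀ j ∈ S, a ⬝ᵥ v j = c)
    (ha' : ∀ j ∈ S, a' ⬝ᵥ v j = c') :
    ∃ f ∈ polys l, ∀ x ∈ hull v S, eval x (comp a τ a') = eval x f := by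
  obtain ⟨A, hA, q, hq, rfl⟩ := exists_of_mem_shape hτ
  refine ⟨comp a (symCurl A) a' + C (c * c') * q, Submodule.add_mem _
    (comp_mem (symCurl_mem hA) _ _) (C_mul_mem_restrict _ (restrict_mono hkl hq)), fun x hx => ?_⟩
  rw [comp_add_tensor, map_add, eval_comp_posPos, b.dotProduct_eq_of_mem_hull ha hx,
    b.dotProduct_eq_of_mem_hull ha' hx]
  simp

end Bary

/-! ### Traces on edges -/

theorem restrictTo_apply {S : Set Vec} {x : Vec} (hx : x ∈ S) (p : Poly) :
    restrictTo S p x = eval x p :=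
  Set.indicator_of_mem hx fun x => eval x p

theorem edgeMoment_eq (v : Fin 4 → Vec) (e : Edge) (a b : Vec) (τ : Tensor) (q : Poly) :
    edgeMoment v e a b τ (restrictTo (edge v e) q) =
      len (v e.1.2 - v e.1.1) * faceFun {e.1.1, e.1.2} (pull v (comp a τ b * q)) :=
  edgeIntegral_eq v e fun x hx => by rw [restrictTo_apply hx, map_mul]

theorem normalMoment_eq (v : Fin 4 → Vec) (i : Fin 4) (n : Vec) (τ : Tensor) (q : Poly) :
    normalMoment v i n τ (restrictTo (face v i) q) =
      len ((v (i.succAbove 1) - v (i.succAbove 0)) ⨯₃ (v (i.succAbove 2) - v (i.succAbove 0))) *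
        faceFun {i}ᶜ (pull v (comp n τ n * q)) :=
  faceIntegral_eq v i fun x hx => by rw [restrictTo_apply hx, map_mul]

theorem trace₂Moment_eq (v : Fin 4 → Vec) (i : Fin 4) (n : Vec) (τ : Tensor) (q : Poly) :
    trace₂Moment v i n τ (restrictTo (face v i) q) =
      len ((v (i.succAbove 1) - v (i.succAbove 0)) ⨯₃ (v (i.succAbove 2) - v (i.succAbove 0))) *
        faceFun {i}ᶜ (pull v (trace₂ n τ * q)) :=
  faceIntegral_eq v i fun x hx => by rw [restrictTo_apply hx, map_mul]

/-- The polynomial `(τ n) · (n × x)`. -/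
def rotComp (n : Vec) (τ : Tensor) : Poly := (τ *ᵥ const n) ⬝ᵥ (const n ⨯₃ pos)

theorem tangentialMoment_eq (v : Fin 4 → Vec) (i : Fin 4) (n : Vec) (τ : Tensor) (q : Poly) :
    tangentialMoment v i n τ (restrictTo (face v i) q) =
      len ((v (i.succAbove 1) - v (i.succAbove 0)) ⨯₃ (v (i.succAbove 2) - v (i.succAbove 0))) *
        faceFun {i}ᶜ (pull v (rotComp n τ * q)) :=
  faceIntegral_eq v i fun x hx => by
    rw [restrictTo_apply hx, map_mul, dotProduct_smul, smul_eq_mul, mul_comm]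
    congr 1
    simp [rotComp, dotProduct, Matrix.mulVec, Fin.sum_univ_three, cross_apply, value, const, pos]

theorem dotProduct_vertices_of_orthogonal {v : Fin 4 → Vec} {p q : Fin 4} {a : Vec}
    (ha : a ⬝ᵥ (v q - v p) = 0) : ∀ j ∈ ({p, q} : Finset (Fin 4)), a ⬝ᵥ v j = a ⬝ᵥ v p := by
  intro j hj
  rw [dotProduct_sub, sub_eq_zero] at ha
  rcases Finset.mem_insert.1 hj with rfl | hj
  · rfl
  · rw [Finset.mem_singleton.1 hj, ha]

/-- A normal-normal component on an edge is determined by the vertex values and its moments. -/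
theorem comp_vanish_on_edge {v : Fin 4 → Vec} (hv : AffineIndependent ℝ v) (b : Bary v) {l k : ℕ}
    (hkl : k - 2 ≤ l) {τ : Tensor} (hτ : τ ∈ shape l k) {e : Edge} {a a' : Vec}
    (ha : a ⬝ᵥ (v e.1.2 - v e.1.1) = 0) (ha' : a' ⬝ᵥ (v e.1.2 - v e.1.1) = 0)
    (h1 : value τ (v e.1.1) = 0) (h2 : value τ (v e.1.2) = 0)
    (hm : ∀ q ∈ polysOn (edge v e) (l - 2), edgeMoment v e a a' τ q = 0) :
    ∀ x ∈ edge v e, eval x (comp a τ a') = 0 := by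
  have hne : e.1.1 ≠ e.1.2 := e.2.ne
  obtain ⟨f, hf, hfe⟩ := b.exists_comp_eq_on_hull hkl hτ
    (dotProduct_vertices_of_orthogonal ha) (dotProduct_vertices_of_orthogonal ha')
  have hcard : ({e.1.1, e.1.2} : Finset (Fin 4)).card = 2 := Finset.card_pair hne
  have hval : ∀ j ∈ ({e.1.1, e.1.2} : Finset (Fin 4)), value τ (v j) = 0 := by
    intro j hj
    rcases Finset.mem_insert.1 hj with rfl | hj
    · exact h1
    · rw [Finset.mem_singleton.1 hj, h2]
  have hvan := b.vanish_of_moments (S := {e.1.1, e.1.2}) (J := {e.1.1, e.1.2}) ⟨e.1.1, by simp⟩ hf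
    (fun j hj => by
      rw [← Finset.card_pos, Finset.card_erase_of_mem hj, hcard]
      norm_num)
    (fun j hj x hx => by
      rw [← hfe x (hull_mono v (Finset.erase_subset _ _) hx)]
      obtain ⟨j', hj'⟩ := Finset.card_eq_one.1
        (by rw [Finset.card_erase_of_mem hj, hcard] :
          (({e.1.1, e.1.2} : Finset (Fin 4)).erase j).card = 1)
      have hj'' : j' ∈ ({e.1.1, e.1.2} : Finset (Fin 4)) :=
        Finset.mem_of_mem_erase (hj' ▸ Finset.mem_singleton_self j' :
          j' ∈ ({e.1.1, e.1.2} : Finset (Fin 4)).erase j)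
      rw [hj'] at hx
      rw [b.eq_vertex_of_mem_hull_singleton hx, eval_comp, hval _ hj'']
      simp)
    (fun q hq => by
      rw [hcard] at hq
      have := hm _ ⟨q, hq, rfl⟩
      rw [edgeMoment_eq] at this
      rw [← (mul_eq_zero.1 this).resolve_left (edge_length_ne_zero hv e)]
      exact faceFun_congr ⟨e.1.1, by simp⟩ fun x hx => by rw [map_mul, map_mul, hfe x hx])
  intro x hx
  rw [← hull_pair] at hx
  rw [hfe x hx, hvan x hx]

/-- Otherwise w, m 0, m 1 would be a basis of ℝ³ orthogonal to the edge direction d, and d would be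
orthogonal to itself. -/
theorem IsNormalPair.exists_eq {v : Fin 4 → Vec} (hv : AffineIndependent ℝ v) {e : Edge}
    {m : Fin 2 → Vec} (hm : IsNormalPair v e m) {w : Vec} (hw : w ⬝ᵥ (v e.1.2 - v e.1.1) = 0) :
    ∃ s t : ℝ, w = s • m 0 + t • m 1 := by
  set d := v e.1.2 - v e.1.1 with hd
  have hd0 : d ≠ 0 := sub_ne_zero.2 (hv.injective.ne e.2.ne')
  by_contra! hcon
  have hli : LinearIndependent ℝ ![w, m 0, m 1] := by
    have h1 : LinearIndependent ℝ ![m 0, m 1] := by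
      convert hm.1
      ext i
      fin_cases i <;> rfl
    refine linearIndependent_finCons.2 ⟨h1, fun hw' => ?_⟩
    rw [Matrix.range_cons, Matrix.range_cons, Matrix.range_empty, Set.union_empty,
      Set.singleton_union, Submodule.mem_span_pair] at hw'
    obtain ⟨s, t, hst⟩ := hw'
    exact hcon s t hst.symm
  have hspan := hli.span_eq_top_of_card_eq_finrank (by simp)
  have hle : Submodule.span ℝ (Set.range ![w, m 0, m 1]) ≤
      LinearMap.ker (dotProductBilin ℝ ℝ d) := by
    rw [Submodule.span_le]
    rintro _ ⟨i, rfl⟩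
    simp only [SetLike.mem_coe, LinearMap.mem_ker]
    change d ⬝ᵥ _ = 0
    rw [dotProduct_comm]
    fin_cases i
    · exact hw
    · exact hm.2 0
    · exact hm.2 1
  have : d ∈ LinearMap.ker (dotProductBilin ℝ ℝ d) := hle (hspan ▸ trivial)
  exact hd0 (dotProduct_self_eq_zero.1 this)

theorem comp_vanish_of_pair {v : Fin 4 → Vec} (hv : AffineIndependent ℝ v) {e : Edge}
    {m : Fin 2 → Vec} (hm : IsNormalPair v e m) {τ : Tensor} {x : Vec}
    (h : ∀ a b, eval x (comp (m a) τ (m b)) = 0) {w w' : Vec}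
    (hw : w ⬝ᵥ (v e.1.2 - v e.1.1) = 0) (hw' : w' ⬝ᵥ (v e.1.2 - v e.1.1) = 0) :
    eval x (comp w τ w') = 0 := by
  obtain ⟨s, t, rfl⟩ := hm.exists_eq hv hw
  obtain ⟨s', t', rfl⟩ := hm.exists_eq hv hw'
  simp only [eval_comp, Matrix.mulVec_add, Matrix.mulVec_smul, dotProduct_add, add_dotProduct,
    dotProduct_smul, smul_dotProduct] at h ⊢
  simp [h]

/-! ### Traces on faces -/

theorem exists_edge_eq : ∀ i j : Fin 4, j ≠ i → ∃ e : Edge,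
    ({i}ᶜ : Finset (Fin 4)).erase j = {e.1.1, e.1.2} ∧ e.1.1 ≠ i ∧ e.1.2 ≠ i ∧
      e.1.1 ≠ j ∧ e.1.2 ≠ j := by
  decide

theorem IsUnitNormal.dotProduct_vertex {v : Fin 4 → Vec} {i : Fin 4} {n : Vec}
    (hn : IsUnitNormal v i n) : ∀ j ∈ ({i}ᶜ : Finset (Fin 4)), n ⬝ᵥ v j = n ⬝ᵥ v (i.succAbove 0) := by
  intro j hj
  obtain ⟨r, rfl⟩ := Fin.exists_succAbove_eq (by simpa using hj : j ≠ i)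
  have := hn.2 r 0
  rwa [dotProduct_sub, sub_eq_zero] at this

theorem IsUnitNormal.dotProduct_edge {v : Fin 4 → Vec} {i : Fin 4} {n : Vec}
    (hn : IsUnitNormal v i n) {j k : Fin 4} (hj : j ≠ i) (hk : k ≠ i) : n ⬝ᵥ (v k - v j) = 0 := by
  rw [dotProduct_sub, hn.dotProduct_vertex k (by simpa using hk),
    hn.dotProduct_vertex j (by simpa using hj), sub_self]

/-- Expand n as the sum of (n · vⱼ) gⱼ. The coefficients agree for j ≠ i and the gradients sum to
zero, so only gᵢ remains. -/
theorem IsUnitNormal.exists_eq_smul {v : Fin 4 → Vec} (b : Bary v) {i : Fin 4} {n : Vec}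
    (hn : IsUnitNormal v i n) : ∃ κ : ℝ, κ ≠ 0 ∧ n = κ • b.g i := by
  have h : n = (n ⬝ᵥ v i - n ⬝ᵥ v (i.succAbove 0)) • b.g i := by
    ext a
    have h1 : ∀ j, (n ⬝ᵥ v j) * b.g j a = (n ⬝ᵥ v (i.succAbove 0)) * b.g j a +
        if j = i then (n ⬝ᵥ v i - n ⬝ᵥ v (i.succAbove 0)) * b.g j a else 0 := fun j => by
      split_ifs with hj
      · rw [hj]
        ring
      · rw [hn.dotProduct_vertex j (by simpa using hj), add_zero]
    rw [← b.sum_dotProduct_smul_grad n a, Finset.sum_congr rfl fun j _ => h1 j,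
      Finset.sum_add_distrib, ← Finset.mul_sum, b.sum_g]
    simp
  refine ⟨_, fun h0 => ?_, h⟩
  have := hn.1
  rw [h, h0, zero_smul, zero_dotProduct] at this
  exact zero_ne_one this

theorem Bary.grad_dotProduct_edge {v : Fin 4 → Vec} (b : Bary v) {i j k : Fin 4} (hj : i ≠ j)
    (hk : i ≠ k) : b.g i ⬝ᵥ (v k - v j) = 0 := by
  rw [b.dotProduct_vertex_sub, if_neg hj, if_neg hk, sub_zero]

theorem dirDeriv_eq (n : Vec) (p : Poly) : dirDeriv n p =
    C (n 0) * pderiv 0 p + C (n 1) * pderiv 1 p + C (n 2) * pderiv 2 p := by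
  simp [dirDeriv, dotProduct, Fin.sum_univ_three, const]

theorem dirDeriv_add (n : Vec) (p q : Poly) :
    dirDeriv n (p + q) = dirDeriv n p + dirDeriv n q := by
  simp only [dirDeriv_eq, map_add]
  ring

theorem dirDeriv_C_mul (n : Vec) (c : ℝ) (p : Poly) :
    dirDeriv n (C c * p) = C c * dirDeriv n p := by
  simp only [dirDeriv_eq, pderiv_C_mul]
  ring

theorem dirDeriv_mul (n : Vec) (p q : Poly) :
    dirDeriv n (p * q) = dirDeriv n p * q + p * dirDeriv n q := by
  simp only [dirDeriv_eq, pderiv_mul]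
  ring

theorem dirDeriv_mem {m : ℕ} (n : Vec) {p : Poly} (hp : p ∈ polys m) :
    dirDeriv n p ∈ polys (m - 1) := by
  rw [dirDeriv_eq]
  exact Submodule.add_mem _ (Submodule.add_mem _ (C_mul_mem_restrict _ (pderiv_mem_restrict _ hp))
    (C_mul_mem_restrict _ (pderiv_mem_restrict _ hp))) (C_mul_mem_restrict _ (pderiv_mem_restrict _ hp))

theorem mulVec_const (τ : Tensor) (n : Vec) (a : Fin 3) :
    (τ *ᵥ const n) a = C (n 0) * τ a 0 + C (n 1) * τ a 1 + C (n 2) * τ a 2 := by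
  simp only [Matrix.mulVec, dotProduct, Fin.sum_univ_three, const]
  ring

theorem comp_eq_mulVec (a : Vec) (τ : Tensor) (n : Vec) : comp a τ n =
    C (a 0) * (τ *ᵥ const n) 0 + C (a 1) * (τ *ᵥ const n) 1 + C (a 2) * (τ *ᵥ const n) 2 := by
  simp [comp, dotProduct, Fin.sum_univ_three, const]

theorem divF_eq (n : Vec) (u : Fin 3 → Poly) : divF n u =
    divVec u - (C (n 0) * dirDeriv n (u 0) + C (n 1) * dirDeriv n (u 1)
      + C (n 2) * dirDeriv n (u 2)) := by
  simp only [divF, Fin.sum_univ_three, divVec, const]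
  ring

theorem mulVec_const_mem {m : ℕ} {τ : Tensor} (hτ : τ ∈ symT m) (n : Vec) (a : Fin 3) :
    (τ *ᵥ const n) a ∈ polys m := by
  rw [mulVec_const]
  exact Submodule.add_mem _ (Submodule.add_mem _ (C_mul_mem_restrict _ (hτ.1 _ _))
    (C_mul_mem_restrict _ (hτ.1 _ _))) (C_mul_mem_restrict _ (hτ.1 _ _))

theorem trace₂_eq (n : Vec) (τ : Tensor) :
    trace₂ n τ = C 2 * divF n (τ *ᵥ const n) + dirDeriv n (comp n τ n) := by
  rw [trace₂, map_ofNat C 2]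

theorem trace₂_mem {m : ℕ} {τ : Tensor} (hτ : τ ∈ symT m) (n : Vec) :
    trace₂ n τ ∈ polys (m - 1) := by
  have h := mulVec_const_mem hτ n
  rw [trace₂_eq, divF_eq]
  refine Submodule.add_mem _ (C_mul_mem_restrict _ (Submodule.sub_mem _ (divVec_mem h) ?_))
    (dirDeriv_mem n (comp_mem hτ n n))
  exact Submodule.add_mem _ (Submodule.add_mem _ (C_mul_mem_restrict _ (dirDeriv_mem n (h _)))
    (C_mul_mem_restrict _ (dirDeriv_mem n (h _)))) (C_mul_mem_restrict _ (dirDeriv_mem n (h _)))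

theorem trace₂_add (n : Vec) (τ ς : Tensor) : trace₂ n (τ + ς) = trace₂ n τ + trace₂ n ς := by
  simp only [trace₂_eq, comp_add_tensor, divF_eq, divVec, Matrix.add_mulVec, Pi.add_apply,
    dirDeriv_add, map_add]
  ring

/-- The linear form `n · x`. -/
def normalForm (n : Vec) : Poly := C (n 0) * X 0 + C (n 1) * X 1 + C (n 2) * X 2

theorem eval_normalForm (n x : Vec) : eval x (normalForm n) = n ⬝ᵥ x := by
  simp [normalForm, dotProduct, Fin.sum_univ_three]

/-- Apart from powers of n · x, constant on the face, only q, its Euler derivative and its normal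
derivative occur. So the trace has degree at most k - 2 there. -/
theorem trace₂_posPos {n : Vec} (hn : n ⬝ᵥ n = 1) (q : Poly) :
    trace₂ n (posPos q) = C 6 * normalForm n * q + C 2 * normalForm n *
      (X 0 * pderiv 0 q + X 1 * pderiv 1 q + X 2 * pderiv 2 q) - normalForm n ^ 2 * dirDeriv n q := by
  have hn' : C (n 0) * C (n 0) + C (n 1) * C (n 1) + C (n 2) * C (n 2) = (1 : Poly) := by
    simp only [← C_mul, ← C_add, ← C_1]
    rw [← hn, dotProduct, Fin.sum_univ_three]
  have hu : ∀ a, (posPos q *ᵥ const n) a = X a * (normalForm n * q) := fun a => by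
    simp only [mulVec_const, posPos, pos, normalForm, LinearMap.coe_mk, AddHom.coe_mk,
      Matrix.of_apply]
    ring
  have hc : comp n (posPos q) n = normalForm n * (normalForm n * q) := by
    rw [comp_eq_mulVec, hu, hu, hu]
    unfold normalForm
    ring
  have hy : dirDeriv n (normalForm n) = 1 := by
    rw [← hn']
    simp [dirDeriv_eq, normalForm, pderiv_X]
  have hX : ∀ a, dirDeriv n (X a) = C (n a) := fun a => by
    fin_cases a <;> simp [dirDeriv_eq, pderiv_X]
  have hp : ∀ a, pderiv a (normalForm n) = C (n a) := fun a => by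
    fin_cases a <;> simp [normalForm, pderiv_X]
  rw [trace₂_eq, hc, divF_eq, divVec, hu, hu, hu, map_ofNat C 2, map_ofNat C 6]
  simp only [dirDeriv_mul, pderiv_mul, pderiv_X_self, hp, hX, hy]
  have h2 : normalForm n = C (n 0) * X 0 + C (n 1) * X 1 + C (n 2) * X 2 := rfl
  linear_combination (-2 * normalForm n * q) * hn' +
    2 * normalForm n * dirDeriv n q * h2

theorem exists_trace₂_eq_on_face {v : Fin 4 → Vec} (b : Bary v) {l k : ℕ} (hkl : k - 2 ≤ l - 1)
    {τ : Tensor} (hτ : τ ∈ shape l k) {i : Fin 4} {n : Vec} (hn : IsUnitNormal v i n) :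
    ∃ f ∈ polys (l - 1), ∀ x ∈ hull v {i}ᶜ, eval x (trace₂ n τ) = eval x f := by
  obtain ⟨A, hA, q, hq, rfl⟩ := exists_of_mem_shape hτ
  set c := n ⬝ᵥ v (i.succAbove 0) with hc
  have hE : X 0 * pderiv 0 q + X 1 * pderiv 1 q + X 2 * pderiv 2 q ∈ polys (k - 2) := by
    rw [mem_restrict_iff]
    intro d hd
    rw [coeff_euler] at hd
    exact mem_restrict_iff.1 hq d (right_ne_zero_of_mul hd)
  refine ⟨trace₂ n (symCurl A) + (C (6 * c) * q + C (2 * c) *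
      (X 0 * pderiv 0 q + X 1 * pderiv 1 q + X 2 * pderiv 2 q) - C (c ^ 2) * dirDeriv n q),
    Submodule.add_mem _ (trace₂_mem (symCurl_mem hA) n) (restrict_mono hkl ?_), fun x hx => ?_⟩
  · exact Submodule.sub_mem _ (Submodule.add_mem _ (C_mul_mem_restrict _ hq)
      (C_mul_mem_restrict _ hE))
      (C_mul_mem_restrict _ (restrict_mono (Nat.sub_le _ _) (dirDeriv_mem n hq)))
  · rw [trace₂_add, trace₂_posPos hn.1]
    simp only [map_add, map_sub, map_mul, map_pow, eval_normalForm, eval_C,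
      b.dotProduct_eq_of_mem_hull hn.dotProduct_vertex hx, ← hc]

theorem card_compl_singleton' (i : Fin 4) : ({i}ᶜ : Finset (Fin 4)).card = 3 := by
  rw [Finset.card_compl, Finset.card_singleton, Fintype.card_fin]

theorem compl_singleton_nonempty (i : Fin 4) : ({i}ᶜ : Finset (Fin 4)).Nonempty := by
  rw [← Finset.card_pos, card_compl_singleton']
  norm_num

/-- The normal-normal component on a face is determined by its values on the edges and its
moments. -/
theorem normal_comp_vanish {v : Fin 4 → Vec} (b : Bary v) {l k : ℕ} (hkl : k - 2 ≤ l)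
    {τ : Tensor} (hτ : τ ∈ shape l k) {i : Fin 4} {n : Vec} (hn : IsUnitNormal v i n)
    (he : ∀ e : Edge, e.1.1 ≠ i → e.1.2 ≠ i → ∀ x ∈ edge v e, eval x (comp n τ n) = 0)
    (hm : ∀ q ∈ polysOn (face v i) (l - 3), normalMoment v i n τ q = 0) :
    ∀ x ∈ hull v {i}ᶜ, eval x (comp n τ n) = 0 := by
  obtain ⟨f, hf, hfe⟩ := b.exists_comp_eq_on_hull hkl hτ hn.dotProduct_vertex hn.dotProduct_vertex
  have hvan := b.vanish_of_moments (S := {i}ᶜ) (J := {i}ᶜ) (compl_singleton_nonempty i) hf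
    (fun j hj => by
      rw [← Finset.card_pos, Finset.card_erase_of_mem hj, card_compl_singleton']
      norm_num)
    (fun j hj x hx => by
      rw [← hfe x (hull_mono v (Finset.erase_subset _ _) hx)]
      obtain ⟨e, hE, h1, h2, _, _⟩ := exists_edge_eq i j (by simpa using hj)
      rw [hE, hull_pair] at hx
      exact he e h1 h2 x hx)
    (fun q hq => by
      rw [card_compl_singleton'] at hq
      have := hm _ ⟨q, hq, rfl⟩
      rw [normalMoment_eq] at this
      rw [← (mul_eq_zero.1 this).resolve_left (face_area_ne_zero b i)]
      exact faceFun_congr (compl_singleton_nonempty i) fun x hx => by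
        rw [map_mul, map_mul, hfe x hx])
  intro x hx
  rw [hfe x hx, hvan x hx]

theorem trace₂_vanish {v : Fin 4 → Vec} (b : Bary v) {l k : ℕ} (hkl : k - 2 ≤ l - 1)
    {τ : Tensor} (hτ : τ ∈ shape l k) {i : Fin 4} {n : Vec} (hn : IsUnitNormal v i n)
    (hm : ∀ q ∈ polysOn (face v i) (l - 1), trace₂Moment v i n τ q = 0) :
    ∀ x ∈ hull v {i}ᶜ, eval x (trace₂ n τ) = 0 := by
  obtain ⟨f, hf, hfe⟩ := exists_trace₂_eq_on_face b hkl hτ hn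
  have hvan := b.vanish_of_moments (S := {i}ᶜ) (J := ∅) (compl_singleton_nonempty i) hf
    (by simp) (by simp)
    (fun q hq => by
      have := hm _ ⟨q, hq, rfl⟩
      rw [trace₂Moment_eq] at this
      rw [← (mul_eq_zero.1 this).resolve_left (face_area_ne_zero b i)]
      exact faceFun_congr (compl_singleton_nonempty i) fun x hx => by
        rw [map_mul, map_mul, hfe x hx])
  intro x hx
  rw [hfe x hx, hvan x hx]

/-! ### Green's identity -/

/-- The surface divergence of `(τ n) q` integrates to zero if the normal components of `τ` vanish
on the edges. -/
theorem faceFun_divF_eq_zero {v : Fin 4 → Vec} (b : Bary v) {i : Fin 4} {n : Vec}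
    (hn : IsUnitNormal v i n) {τ : Tensor}
    (he : ∀ e : Edge, ∀ w w' : Vec, w ⬝ᵥ (v e.1.2 - v e.1.1) = 0 → w' ⬝ᵥ (v e.1.2 - v e.1.1) = 0 →
      ∀ x ∈ edge v e, eval x (comp w τ w') = 0) (q : Poly) :
    faceFun {i}ᶜ (pull v (divF n fun a => (τ *ᵥ const n) a * q)) = 0 := by
  obtain ⟨κ, hκ, hκn⟩ := hn.exists_eq_smul b
  have hgi : ∀ w, n ⬝ᵥ w = 0 → b.g i ⬝ᵥ w = 0 := fun w hw => by
    rw [hκn, smul_dotProduct, smul_eq_mul] at hw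
    exact (mul_eq_zero.1 hw).resolve_left hκ
  -- The projections of the coordinate vectors to the plane of the face: div_F u is the sum of the
  -- derivatives of the components of u along them.
  let w : Fin 3 → Vec := fun a => Pi.single a 1 - n a • n
  have hw : ∀ a, n ⬝ᵥ w a = 0 := fun a => by
    simp only [w, dotProduct_sub, dotProduct_smul, hn.1, dotProduct_single, smul_eq_mul]
    ring
  set u : Fin 3 → Poly := fun a => (τ *ᵥ const n) a * q with hu
  have hdiv : divF n u = ∑ a, dirDeriv (w a) (u a) := by
    simp only [divF_eq, divVec, dirDeriv_eq, w, Fin.sum_univ_three, Pi.sub_apply, Pi.smul_apply,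
      smul_eq_mul, C_sub, C_mul]
    simp
    ring
  rw [hdiv, map_sum, map_sum]
  have h1 : ∀ a, faceFun {i}ᶜ (pull v (dirDeriv (w a) (u a))) =
      -∑ j ∈ {i}ᶜ, (b.g j ⬝ᵥ w a) * faceFun (({i}ᶜ : Finset (Fin 4)).erase j) (pull v (u a)) :=
    fun a => b.faceFun_dirDeriv (by rw [card_compl_singleton']; norm_num)
      (fun j hj => by
        have : j = i := by simpa using hj
        exact this ▸ hgi _ (hw a)) _
  rw [Finset.sum_congr rfl fun a _ => h1 a, Finset.sum_neg_distrib, Finset.sum_comm, neg_eq_zero]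
  refine Finset.sum_eq_zero fun j hj => ?_
  have hji : j ≠ i := by simpa using hj
  obtain ⟨e, hE, h1, h2, h3, h4⟩ := exists_edge_eq i j hji
  -- The tangential part of gⱼ is a conormal of the edge opposite to vertex j in this face. The edge
  -- flux is therefore the component of τ along t and n, both orthogonal to the edge.
  set t : Vec := b.g j - (b.g j ⬝ᵥ n) • n with ht
  have hn0 := hn.dotProduct_edge h1 h2
  have ht0 : t ⬝ᵥ (v e.1.2 - v e.1.1) = 0 := by
    rw [ht, sub_dotProduct, smul_dotProduct, hn0, b.grad_dotProduct_edge h3.symm h4.symm]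
    simp
  have hcomp : ∑ a, (b.g j ⬝ᵥ w a) * faceFun (({i}ᶜ : Finset (Fin 4)).erase j) (pull v (u a)) =
      faceFun (({i}ᶜ : Finset (Fin 4)).erase j) (pull v (comp t τ n * q)) := by
    have h5 : comp t τ n * q = ∑ a, (b.g j ⬝ᵥ w a) • u a := by
      have h6 : ∀ a, b.g j ⬝ᵥ w a = t a := fun a => by
        simp only [w, ht, dotProduct_sub, dotProduct_smul, dotProduct_single, Pi.sub_apply,
          Pi.smul_apply, smul_eq_mul]
        ring
      simp only [h6, comp_eq_mulVec, hu, Fin.sum_univ_three, smul_eq_C_mul]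
      ring
    simp only [h5, map_sum, map_smul, smul_eq_mul]
  rw [hcomp, hE]
  rw [faceFun_congr (f' := 0) ⟨e.1.1, by simp⟩ fun x hx => by
    rw [hull_pair] at hx
    rw [map_mul, he e t n ht0 hn0 x hx, zero_mul, map_zero]]
  simp

/-- This is the normal flux n · (div τ q - τ∇q) of the volume integration by parts. Writing τn · ∇q
as a surface divergence minus lower terms brings out exactly the two traces nᵀτn and 2 div_F(τn) +
∂ₙ(nᵀτn). -/
theorem divF_mul (n : Vec) (τ : Tensor) (hτ : τᵀ = τ) (q : Poly) :
    C (n 0) * (divRow τ 0 * q - (τ 0 0 * pderiv 0 q + τ 0 1 * pderiv 1 q + τ 0 2 * pderiv 2 q)) +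
    C (n 1) * (divRow τ 1 * q - (τ 1 0 * pderiv 0 q + τ 1 1 * pderiv 1 q + τ 1 2 * pderiv 2 q)) +
    C (n 2) * (divRow τ 2 * q - (τ 2 0 * pderiv 0 q + τ 2 1 * pderiv 1 q + τ 2 2 * pderiv 2 q)) =
    trace₂ n τ * q - divF n (fun a => (τ *ᵥ const n) a * q) - comp n τ n * dirDeriv n q := by
  have h10 : τ 1 0 = τ 0 1 := congrFun (congrFun hτ 0) 1
  have h20 : τ 2 0 = τ 0 2 := congrFun (congrFun hτ 0) 2
  have h21 : τ 2 1 = τ 1 2 := congrFun (congrFun hτ 1) 2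
  rw [trace₂, divF_eq, divF_eq, comp_eq_mulVec]
  simp only [divVec, divRow, mulVec_const, dirDeriv_mul, dirDeriv_add, pderiv_mul,
    map_add, h10, h20, h21]
  simp only [dirDeriv_eq, pderiv_C]
  ring

/-- Green's identity for the operator `div div` and fields with vanishing traces. -/
theorem faceFun_divDiv_mul {v : Fin 4 → Vec} (b : Bary v) {n : Fin 4 → Vec}
    (hn : ∀ i, IsUnitNormal v i (n i)) {τ : Tensor} (hτ : τᵀ = τ)
    (he : ∀ e : Edge, ∀ w w' : Vec, w ⬝ᵥ (v e.1.2 - v e.1.1) = 0 → w' ⬝ᵥ (v e.1.2 - v e.1.1) = 0 →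
      ∀ x ∈ edge v e, eval x (comp w τ w') = 0)
    (h1 : ∀ i, ∀ x ∈ hull v {i}ᶜ, eval x (comp (n i) τ (n i)) = 0)
    (h2 : ∀ i, ∀ x ∈ hull v {i}ᶜ, eval x (trace₂ (n i) τ) = 0) (q : Poly) :
    faceFun Finset.univ (pull v (divDiv τ * q)) =
      faceFun Finset.univ (pull v (frob τ (hessLin q))) := by
  -- The divergence of this flux is div div τ q - τ : ∇²q.
  set u : Fin 3 → Poly := fun a => divRow τ a * q -
    (τ a 0 * pderiv 0 q + τ a 1 * pderiv 1 q + τ a 2 * pderiv 2 q) with hu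
  have hdiv : divDiv τ * q - frob τ (hessLin q) = ∑ a, dirDeriv (Pi.single a 1) (u a) := by
    have h10 : τ 1 0 = τ 0 1 := congrFun (congrFun hτ 0) 1
    have h20 : τ 2 0 = τ 0 2 := congrFun (congrFun hτ 0) 2
    have h21 : τ 2 1 = τ 1 2 := congrFun (congrFun hτ 1) 2
    simp only [hu, frob, hessLin, hess, Fin.sum_univ_three, dirDeriv_eq, divDiv, divVec, divRow,
      LinearMap.coe_mk, AddHom.coe_mk, Matrix.of_apply, map_sub, map_add, pderiv_mul]
    simp [h10, h20, h21]
    ring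
  rw [← sub_eq_zero, ← map_sub, ← map_sub, hdiv, map_sum, map_sum]
  have h3 : ∀ a, faceFun Finset.univ (pull v (dirDeriv (Pi.single a 1) (u a))) =
      -∑ j, b.g j a * faceFun {j}ᶜ (pull v (u a)) := fun a => by
    rw [b.faceFun_dirDeriv (by simp) (by simp)]
    simp [Finset.compl_singleton]
  rw [Finset.sum_congr rfl fun a _ => h3 a, Finset.sum_neg_distrib, Finset.sum_comm, neg_eq_zero]
  refine Finset.sum_eq_zero fun j _ => ?_
  obtain ⟨κ, hκ, hκn⟩ := (hn j).exists_eq_smul b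
  have h4 : κ * ∑ a, b.g j a * faceFun {j}ᶜ (pull v (u a)) = faceFun {j}ᶜ (pull v
      (trace₂ (n j) τ * q - divF (n j) (fun a => (τ *ᵥ const (n j)) a * q) -
        comp (n j) τ (n j) * dirDeriv (n j) q)) := by
    rw [← divF_mul (n j) τ hτ q]
    simp only [← smul_eq_C_mul, map_add, map_smul, smul_eq_mul, Fin.sum_univ_three, hκn,
      Pi.smul_apply, hu]
    ring
  refine (mul_eq_zero.1 (h4.trans ?_)).resolve_left hκ
  rw [map_sub, map_sub, map_sub, map_sub, faceFun_divF_eq_zero b (hn j) he,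
    faceFun_congr (f := trace₂ (n j) τ * q) (f' := 0) (compl_singleton_nonempty j)
      fun x hx => by rw [map_mul, h2 j x hx, zero_mul, map_zero],
    faceFun_congr (f := comp (n j) τ (n j) * _) (f' := 0) (compl_singleton_nonempty j)
      fun x hx => by rw [map_mul, h1 j x hx, zero_mul, map_zero]]
  simp

/-! ### Tangential fields on a face -/

/-- The coordinates of the projection of `x` to the plane orthogonal to the unit vector `n`. -/
def projForm (n : Vec) (a : Fin 3) : Poly := X a - C (n a) * normalForm n

theorem C_dotProduct (a b : Vec) :
    C (a 0) * C (b 0) + C (a 1) * C (b 1) + C (a 2) * C (b 2) = (C (a ⬝ᵥ b) : Poly) := by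
  simp only [← C_mul, ← C_add]
  rw [dotProduct, Fin.sum_univ_three]

/-- Polynomials in the projected coordinates are constant along n, so for them the gradient is the
surface gradient. -/
theorem dirDeriv_aeval_projForm {n : Vec} (hn : n ⬝ᵥ n = 1) (p : Poly) :
    dirDeriv n (aeval (projForm n) p) = 0 := by
  have hn' := C_dotProduct n n
  rw [hn, C_1] at hn'
  have hX : ∀ a, dirDeriv n (projForm n a) = 0 := fun a => by
    fin_cases a <;> simp [dirDeriv_eq, projForm, normalForm, pderiv_X] <;>
      first
        | linear_combination (-C (n 0)) * hn'
        | linear_combination (-C (n 1)) * hn'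
        | linear_combination (-C (n 2)) * hn'
  induction p using MvPolynomial.induction_on with
  | C a => simp [dirDeriv_eq]
  | add p q hp hq => rw [map_add, dirDeriv_add, hp, hq, add_zero]
  | mul_X p a hp => rw [map_mul, aeval_X, dirDeriv_mul, hp, hX, zero_mul, mul_zero, add_zero]

theorem projForm_isHomogeneous (n : Vec) (a : Fin 3) : (projForm n a).IsHomogeneous 1 := by
  have h : ∀ c i, (C c * X i : Poly).IsHomogeneous 1 := fun c i => by
    simpa using (isHomogeneous_C (Fin 3) c).mul (isHomogeneous_X ℝ i)
  have h2 : (normalForm n).IsHomogeneous 1 := ((h _ _).add (h _ _)).add (h _ _)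
  have h3 : (C (n a) * normalForm n).IsHomogeneous 1 := by
    simpa using (isHomogeneous_C (Fin 3) (n a)).mul h2
  exact (isHomogeneous_X ℝ a).sub h3

/-- On a plane, a tangential field is the sum of a gradient and a multiple of `n × x`. -/
theorem tangential_decomposition {n t : Vec} (hn : n ⬝ᵥ n = 1) (ht : n ⬝ᵥ t = 0) {d : ℝ} {r : Poly}
    (hr : Eul d r) (hnr : dirDeriv n r = 0) (u : Fin 3 → Poly) :
    let W : Fin 3 → Poly := fun a => ((fun i => pderiv i r) ⨯₃ const t) a
    C (d + 1) * ((const t ⬝ᵥ u) * r) = (u ⬝ᵥ fun a => pderiv a (normalForm t * r)) +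
      (u ⬝ᵥ (const n ⨯₃ pos)) * (C (n 0) * W 0 + C (n 1) * W 1 + C (n 2) * W 2) := by
  have hn' := C_dotProduct n n
  have hN := C_dotProduct n t
  rw [hn, C_1] at hn'
  rw [ht, C_0] at hN
  rw [dirDeriv_eq] at hnr
  unfold Eul at hr
  intro W
  have hW0 : W 0 = pderiv 1 r * C (t 2) - pderiv 2 r * C (t 1) := by simp [W, cross_apply, const]
  have hW1 : W 1 = pderiv 2 r * C (t 0) - pderiv 0 r * C (t 2) := by simp [W, cross_apply, const]
  have hW2 : W 2 = pderiv 0 r * C (t 1) - pderiv 1 r * C (t 0) := by simp [W, cross_apply, const]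
  -- Both ∇r and t are tangential, so ∇r × t = w n. Then w (n × x) = (∇r × t) × x = (x · ∇r) t - (t
  -- · x) ∇r, where x · ∇r = d r, and the remaining terms form the gradient of (t · x) r.
  set w := C (n 0) * W 0 + C (n 1) * W 1 + C (n 2) * W 2 with hw
  have h0 : W 0 = C (n 0) * w := by
    rw [hw]
    simp only [hW0, hW1, hW2]
    linear_combination (-(pderiv 1 r * C (t 2) - pderiv 2 r * C (t 1))) * hn' +
      (C (n 1) * C (t 2) - C (n 2) * C (t 1)) * hnr +
      (C (n 2) * pderiv 1 r - C (n 1) * pderiv 2 r) * hN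
  have h1 : W 1 = C (n 1) * w := by
    rw [hw]
    simp only [hW0, hW1, hW2]
    linear_combination (-(pderiv 2 r * C (t 0) - pderiv 0 r * C (t 2))) * hn' +
      (C (n 2) * C (t 0) - C (n 0) * C (t 2)) * hnr +
      (C (n 0) * pderiv 2 r - C (n 2) * pderiv 0 r) * hN
  have h2 : W 2 = C (n 2) * w := by
    rw [hw]
    simp only [hW0, hW1, hW2]
    linear_combination (-(pderiv 0 r * C (t 1) - pderiv 1 r * C (t 0))) * hn' +
      (C (n 0) * C (t 1) - C (n 1) * C (t 0)) * hnr +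
      (C (n 1) * pderiv 0 r - C (n 0) * pderiv 1 r) * hN
  have hd0 : pderiv 0 (normalForm t) = C (t 0) := by simp [normalForm, pderiv_X]
  have hd1 : pderiv 1 (normalForm t) = C (t 1) := by simp [normalForm, pderiv_X]
  have hd2 : pderiv 2 (normalForm t) = C (t 2) := by simp [normalForm, pderiv_X]
  have hT : normalForm t = C (t 0) * X 0 + C (t 1) * X 1 + C (t 2) * X 2 := rfl
  rw [hW0] at h0
  rw [hW1] at h1
  rw [hW2] at h2
  clear_value w
  simp only [dotProduct, Fin.sum_univ_three, pderiv_mul, hd0, hd1, hd2, cross_apply, const, pos,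
    Matrix.cons_val, C_add, C_1]
  simp only [hT]
  linear_combination (-(C (t 0) * u 0 + C (t 1) * u 1 + C (t 2) * u 2)) * hr +
    (u 2 * X 1 - u 1 * X 2) * h0 + (u 0 * X 2 - u 2 * X 0) * h1 + (u 1 * X 0 - u 0 * X 1) * h2

/-- Gradients and multiples of n × x together give all tangential polynomial fields on the face. The
decomposition needs a homogeneous coefficient independent of the normal coordinate, so q is first
replaced on the face by a polynomial in the projected coordinates and then split by degree. -/
theorem faceFun_tangential {v : Fin 4 → Vec} (b : Bary v) {m : ℕ} {i : Fin 4} {n : Vec}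
    (hn : IsUnitNormal v i n) {u : Fin 3 → Poly}
    (hgrad : ∀ p : Poly, faceFun {i}ᶜ (pull v (u ⬝ᵥ fun a => pderiv a p)) = 0)
    (hrot : ∀ q ∈ polys (m - 1), faceFun {i}ᶜ (pull v ((u ⬝ᵥ (const n ⨯₃ pos)) * q)) = 0)
    {t : Vec} (ht : n ⬝ᵥ t = 0) {q : Poly} (hq : q ∈ polys m) :
    faceFun {i}ᶜ (pull v ((const t ⬝ᵥ u) * q)) = 0 := by
  set c := n ⬝ᵥ v (i.succAbove 0)
  -- On the face n · x = c, so x is its projection plus c n; the shift makes q' at the projection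
  -- equal to q at x.
  set q' : Poly := aeval (fun a => X a + C (c * n a)) q with hq'
  have hq'm : q' ∈ polys m := aeval_mem_restrict (fun a => Submodule.add_mem _
    (X_mem_restrict a le_rfl) (C_mem_restrict _)) hq
  have hface : ∀ x ∈ hull v {i}ᶜ, eval x q = eval x (aeval (projForm n) q') := fun x hx => by
    rw [eval_aeval, hq', eval_aeval]
    refine congrArg (fun y => eval y q) (funext fun a => ?_)
    have := b.dotProduct_eq_of_mem_hull hn.dotProduct_vertex hx
    simp [projForm, eval_normalForm, this, c]
    ring
  rw [faceFun_congr (f' := (const t ⬝ᵥ u) * aeval (projForm n) q') (compl_singleton_nonempty i)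
    fun x hx => by rw [map_mul, map_mul, hface x hx]]
  rw [← sum_range_homogeneousComponent hq'm, map_sum, Finset.mul_sum, map_sum, map_sum]
  refine Finset.sum_eq_zero fun d _ => ?_
  set r : Poly := aeval (projForm n) (homogeneousComponent d q')
  have hrm : r ∈ polys m := aeval_mem_restrict (fun a =>
    mem_restrict_of_isHomogeneous (projForm_isHomogeneous n a))
    (homogeneousComponent_mem_restrict d hq'm)
  have hr : Eul d r := by
    have := (homogeneousComponent_isHomogeneous d q').aeval (projForm n) (projForm_isHomogeneous n)
    rw [one_mul] at this
    exact Eul.of_isHomogeneous this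
  have h := tangential_decomposition hn.1 ht hr (dirDeriv_aeval_projForm hn.1 _) u
  have h0 : ((d : ℝ) + 1) * faceFun {i}ᶜ (pull v ((const t ⬝ᵥ u) * r)) = 0 := by
    rw [← smul_eq_mul, ← map_smul, ← map_smul, smul_eq_C_mul]
    refine (congrArg (fun p => faceFun {i}ᶜ (pull v p)) h).trans ?_
    rw [map_add, map_add, hgrad, zero_add]
    refine hrot _ ?_
    have hW : ∀ a, ((fun i => pderiv i r) ⨯₃ const t) a ∈ polys (m - 1) := fun a => by
      have h : ∀ i j, pderiv i r * C (t j) ∈ polys (m - 1) := fun i j => by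
        rw [mul_comm]
        exact C_mul_mem_restrict _ (pderiv_mem_restrict i hrm)
      fin_cases a <;> simp only [cross_apply, const] <;>
        exact Submodule.sub_mem (polys (m - 1)) (h _ _) (h _ _)
    exact Submodule.add_mem _ (Submodule.add_mem _ (C_mul_mem_restrict _ (hW _))
      (C_mul_mem_restrict _ (hW _))) (C_mul_mem_restrict _ (hW _))
  exact (mul_eq_zero.1 h0).resolve_left (by positivity)

/-! ### Unisolvence -/

/-- The tensor field `(a bᵀ + b aᵀ) q`. -/
def symDyad (a b : Vec) (q : Poly) : Tensor :=
  Matrix.of fun i j => C (a i * b j + b i * a j) * q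

theorem symDyad_mem {m : ℕ} (a b : Vec) {q : Poly} (hq : q ∈ polys m) : symDyad a b q ∈ symT m :=
  ⟨fun i j => C_mul_mem_restrict _ hq, by
    ext1 i j
    simp only [symDyad, Matrix.transpose_apply, Matrix.of_apply]
    rw [add_comm, mul_comm (b j), mul_comm (a j)]⟩

theorem frob_symDyad {τ : Tensor} (hτ : τᵀ = τ) (a b : Vec) (q : Poly) :
    frob τ (symDyad a b q) = C 2 * (comp a τ b * q) := by
  have h10 : τ 1 0 = τ 0 1 := congrFun (congrFun hτ 0) 1
  have h20 : τ 2 0 = τ 0 2 := congrFun (congrFun hτ 0) 2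
  have h21 : τ 2 1 = τ 1 2 := congrFun (congrFun hτ 1) 2
  simp only [frob, symDyad, comp_eq_sum, Fin.sum_univ_three, Matrix.of_apply, C_add, C_mul, h10,
    h20, h21, map_ofNat C 2]
  ring

theorem frob_add (τ ς ς' : Tensor) : frob τ (ς + ς') = frob τ ς + frob τ ς' := by
  simp only [frob, Matrix.add_apply, mul_add, Finset.sum_add_distrib]

/-- A component that vanishes on a face vanishes identically if the field is orthogonal to all
symmetric fields of degree less than `l`. -/
theorem comp_eq_zero_of_vanish_on_face {v : Fin 4 → Vec} (b : Bary v) {l : ℕ} {τ : Tensor}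
    (hτ : τ ∈ symT l) (horth : ∀ ς ∈ symT (l - 1), faceFun Finset.univ (pull v (frob τ ς)) = 0)
    (i : Fin 4) {a a' : Vec} (h : ∀ x ∈ hull v {i}ᶜ, eval x (comp a τ a') = 0) :
    comp a τ a' = 0 := by
  refine b.eq_zero_of_vanish (b.vanish_of_moments (J := {i}) Finset.univ_nonempty
    (comp_mem hτ a a') (fun j _ => ?_) (fun j hj x hx => ?_) fun q hq => ?_)
  · rw [← Finset.compl_singleton]
    exact compl_singleton_nonempty j
  · rw [Finset.mem_singleton.1 hj, ← Finset.compl_singleton] at hx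
    exact h x hx
  · have h2 := horth _ (symDyad_mem a a' hq)
    rw [frob_symDyad hτ.2, ← smul_eq_C_mul, map_smul, map_smul, smul_eq_mul] at h2
    exact (mul_eq_zero.1 h2).resolve_left two_ne_zero

theorem Bary.comp_eq_sum_left {v : Fin 4 → Vec} (b : Bary v) (w w' : Vec) (τ : Tensor) (x : Vec) :
    eval x (comp w τ w') = ∑ j, (w ⬝ᵥ v j) * eval x (comp (b.g j) τ w') := by
  have hw : w = ∑ j, (w ⬝ᵥ v j) • b.g j := by
    ext a
    rw [Finset.sum_apply]
    exact (b.sum_dotProduct_smul_grad w a).symm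
  simp only [eval_comp]
  conv_lhs => rw [hw]
  simp only [sum_dotProduct, smul_dotProduct, smul_eq_mul]

theorem Bary.sum_comp_left {v : Fin 4 → Vec} (b : Bary v) (w : Vec) (τ : Tensor) (x : Vec) :
    ∑ j, eval x (comp (b.g j) τ w) = 0 := by
  have hg : ∑ j, b.g j = 0 := by
    ext a
    rw [Finset.sum_apply]
    exact b.sum_g a
  simp only [eval_comp]
  rw [← sum_dotProduct, hg, zero_dotProduct]

/-- A symmetric field with `gᵢᵀ τ gᵢ = 0` for all `i` and `τ gₖ = 0` for one `k` is zero. -/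
theorem eq_zero_of_comp_grad {v : Fin 4 → Vec} (b : Bary v) {τ : Tensor} (hτ : τᵀ = τ) (k : Fin 4)
    (h1 : ∀ i, comp (b.g i) τ (b.g i) = 0) (h2 : ∀ j, comp (b.g j) τ (b.g k) = 0) : τ = 0 := by
  have h3 : ∀ i j x, eval x (comp (b.g i) τ (b.g j)) = 0 := by
    intro i j x
    have hs := fun i => b.sum_comp_left (b.g i) τ x
    simp only [Fin.sum_univ_four] at hs
    have hc : ∀ i j, eval x (comp (b.g i) τ (b.g j)) = eval x (comp (b.g j) τ (b.g i)) :=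
      fun i j => by rw [comp_comm hτ]
    have hd : ∀ i, eval x (comp (b.g i) τ (b.g i)) = 0 := fun i => by rw [h1, map_zero]
    have hk : ∀ j, eval x (comp (b.g j) τ (b.g k)) = 0 := fun j => by rw [h2, map_zero]
    have s0 := hs 0
    have s1 := hs 1
    have s2 := hs 2
    have s3 := hs 3
    have c10 := hc 1 0
    have c20 := hc 2 0
    have c30 := hc 3 0
    have c21 := hc 2 1
    have c31 := hc 3 1
    have c32 := hc 3 2
    have d0 := hd 0
    have d1 := hd 1
    have d2 := hd 2
    have d3 := hd 3
    have k0 := hk 0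
    have k1 := hk 1
    have k2 := hk 2
    have k3 := hk 3
    clear hs hc hd hk h1 h2
    -- The 4 × 4 matrix of these components is symmetric with zero row sums, zero diagonal and zero
    -- row k. Its three remaining entries have zero pairwise sums, hence vanish.
    fin_cases k <;> simp only [Fin.zero_eta, Fin.mk_one, Fin.reduceFinMk] at k0 k1 k2 k3 <;>
      fin_cases i <;> fin_cases j <;>
      simp only [Fin.zero_eta, Fin.mk_one, Fin.reduceFinMk] <;> linarith
  have h4 : ∀ w w' x, eval x (comp w τ w') = 0 := fun w w' x => by
    rw [b.comp_eq_sum_left]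
    refine Finset.sum_eq_zero fun j _ => ?_
    rw [comp_comm hτ, b.comp_eq_sum_left]
    simp [h3]
  ext1 i j
  refine funext fun x => ?_
  have := h4 (Pi.single i 1) (Pi.single j 1) x
  rw [eval_comp] at this
  simpa [value] using this

/-- A shape function with vanishing traces that is orthogonal to the interior and tangential
test functions is zero. -/
theorem eq_zero_of_moments {v : Fin 4 → Vec} (b : Bary v) {k l : ℕ}
    (hl : max (k - 1) 3 ≤ l) {n : Fin 4 → Vec} (hn : ∀ i, IsUnitNormal v i (n i)) (f₁ : Fin 4)
    {τ : Tensor} (hτ : τ ∈ shape l k)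
    (he : ∀ e : Edge, ∀ w w' : Vec, w ⬝ᵥ (v e.1.2 - v e.1.1) = 0 → w' ⬝ᵥ (v e.1.2 - v e.1.1) = 0 →
      ∀ x ∈ edge v e, eval x (comp w τ w') = 0)
    (h1 : ∀ i, ∀ x ∈ hull v {i}ᶜ, eval x (comp (n i) τ (n i)) = 0)
    (h2 : ∀ i, ∀ x ∈ hull v {i}ᶜ, eval x (trace₂ (n i) τ) = 0)
    (hH : ∀ p ∈ polys (k - 2), faceFun Finset.univ (pull v (frob τ (hessLin p))) = 0)
    (hC : ∀ A ∈ polysT (l - 2), faceFun Finset.univ (pull v (frob τ (symCross A))) = 0)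
    (hF : ∀ q ∈ polys (l - 2), faceFun {f₁}ᶜ (pull v (rotComp (n f₁) τ * q)) = 0) :
    τ = 0 := by
  have hl3 : 3 ≤ l := (le_max_right _ _).trans hl
  have hsym := transpose_of_mem_shape hτ
  have hgreen := faceFun_divDiv_mul b hn hsym he h1 h2
  obtain ⟨A, hA, q, hq, hτA⟩ := exists_of_mem_shape hτ
  have hdd : divDiv τ = divDiv (posPos q) := by rw [hτA, divDiv_add, divDiv_symCurl, zero_add]
  have hddm : divDiv τ ∈ polys (k - 2) := by
    rw [hdd]
    -- The factor x xᵀ raises the degree by two and div div lowers it by two, so div div τ is an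
    -- admissible test function for moments 5.
    have h := divVec_mem fun i => divVec_mem ((posPos_mem hq).1 i)
    exact h
  have hdd0 : divDiv τ = 0 := by
    have h3 : faceFun Finset.univ (pull v (divDiv τ * divDiv τ)) = 0 := by
      rw [hgreen, hH _ hddm]
    refine b.eq_zero_of_vanish fun x hx => ?_
    have h4 := b.vanish_of_faceFun_eq_zero Finset.univ_nonempty
      (fun x _ => by rw [map_mul]; exact mul_self_nonneg _) h3 x hx
    rw [map_mul] at h4
    exact mul_self_eq_zero.1 h4
  have hq0 : q = 0 := divDiv_posPos_injective (by rw [← hdd, hdd0])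
  have hτm : τ ∈ symT l := by
    rw [hτA, hq0, map_zero, add_zero]
    exact symCurl_mem hA
  have horth : ∀ ς ∈ symT (l - 1), faceFun Finset.univ (pull v (frob τ ς)) = 0 := by
    intro ς hς
    -- The degree of p may exceed k - 2: once div div τ = 0, Green's identity gives orthogonality to
    -- every Hessian. B has degree at most l - 2, as moments 6 require.
    obtain ⟨_, ⟨p, _, rfl⟩, _, ⟨B, hB, rfl⟩, rfl⟩ :=
      Submodule.mem_sup.1 (symT_le_hessSpace_sup_symCrossSpace (l - 1) hς)
    rw [frob_add, map_add, map_add, ← hgreen, hdd0, zero_mul, map_zero, map_zero, zero_add]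
    exact hC B hB
  have hgg : ∀ i, comp (b.g i) τ (b.g i) = 0 := fun i => by
    refine comp_eq_zero_of_vanish_on_face b hτm horth i fun x hx => ?_
    obtain ⟨κ, hκ, hκn⟩ := (hn i).exists_eq_smul b
    have := h1 i x hx
    rw [hκn, eval_comp, smul_dotProduct, Matrix.mulVec_smul, dotProduct_smul, smul_eq_mul,
      smul_eq_mul, ← eval_comp] at this
    exact (mul_eq_zero.1 ((mul_eq_zero.1 this).resolve_left hκ)).resolve_left hκ
  set i := f₁
  set u : Fin 3 → Poly := τ *ᵥ const (n i) with hu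
  obtain ⟨κ, hκ, hκn⟩ := (hn i).exists_eq_smul b
  have hgn : ∀ w, comp w τ (n i) = C κ * comp w τ (b.g i) := fun w => by
    simp only [comp_eq_sum, hκn, Pi.smul_apply, smul_eq_mul, Finset.mul_sum, C_mul]
    exact Finset.sum_congr rfl fun a _ => Finset.sum_congr rfl fun a' _ => by ring
  have hnn : comp (n i) τ (n i) = 0 := by
    rw [hgn, comp_comm hsym, hgn, hgg, mul_zero, mul_zero]
  -- With nᵀτn identically zero, the second trace reduces to 2 div_F(τn).
  have hdivF : ∀ x ∈ hull v {i}ᶜ, eval x (divF (n i) u) = 0 := fun x hx => by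
    have := h2 i x hx
    rw [trace₂_eq, hnn, map_add, map_mul, eval_C] at this
    have h0 : dirDeriv (n i) 0 = 0 := by simp [dirDeriv_eq]
    rw [h0, map_zero, add_zero] at this
    exact (mul_eq_zero.1 this).resolve_left two_ne_zero
  have hgrad : ∀ p : Poly, faceFun {i}ᶜ (pull v (u ⬝ᵥ fun a => pderiv a p)) = 0 := by
    intro p
    have h3 := faceFun_divF_eq_zero b (hn i) he p
    have h4 : divF (n i) (fun a => (τ *ᵥ const (n i)) a * p) =
        divF (n i) u * p + (u ⬝ᵥ fun a => pderiv a p) - comp (n i) τ (n i) * dirDeriv (n i) p := by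
      simp only [divF_eq, divVec, comp_eq_mulVec, ← hu, dirDeriv_mul, pderiv_mul, dotProduct,
        Fin.sum_univ_three]
      ring
    rw [h4, hnn, zero_mul, sub_zero, map_add, map_add,
      faceFun_congr (f := divF (n i) u * p) (f' := 0) (compl_singleton_nonempty i)
        fun x hx => by rw [map_mul, hdivF x hx, zero_mul, map_zero]] at h3
    simpa using h3
  -- Both gⱼ and n are orthogonal to the edge opposite to vertex j in the face, so this component
  -- vanishes on that edge, and moments of degree l - 1 suffice.
  have htan : ∀ j, ∀ x ∈ hull v {i}ᶜ, eval x (comp (b.g j) τ (n i)) = 0 := by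
    intro j
    by_cases hj : j = i
    · intro x _
      rw [hj, hgn, hgg, mul_zero, map_zero]
    obtain ⟨e, hE, e1, e2, e3, e4⟩ := exists_edge_eq i j hj
    refine b.vanish_of_moments (J := {j}) (compl_singleton_nonempty i) (comp_mem hτm _ _)
      (fun j' hj' => ?_) (fun j' hj' x hx => ?_) fun q hq => ?_
    · rw [Finset.mem_singleton.1 hj', hE]
      exact ⟨e.1.1, by simp⟩
    · rw [Finset.mem_singleton.1 hj', hE, hull_pair] at hx
      exact he e _ _ (b.grad_dotProduct_edge e3.symm e4.symm) ((hn i).dotProduct_edge e1 e2) x hx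
    · have h5 : comp (b.g j) τ (n i) = const (b.g j - (n i ⬝ᵥ b.g j) • n i) ⬝ᵥ u := by
        have h6 : const (b.g j - (n i ⬝ᵥ b.g j) • n i) ⬝ᵥ u =
            comp (b.g j) τ (n i) - C (n i ⬝ᵥ b.g j) * comp (n i) τ (n i) := by
          simp only [comp_eq_mulVec, ← hu, dotProduct, Fin.sum_univ_three, const, Pi.sub_apply,
            Pi.smul_apply, smul_eq_mul, C_sub, C_mul]
          ring
        rw [h6, hnn, mul_zero, sub_zero]
      rw [h5]
      refine faceFun_tangential b (hn i) hgrad (m := l - 1) (fun q hq => hF q hq) ?_ hq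
      rw [dotProduct_sub, dotProduct_smul, (hn i).1, smul_eq_mul, mul_one, sub_self]
  refine eq_zero_of_comp_grad b hsym i hgg fun j => ?_
  have h7 := comp_eq_zero_of_vanish_on_face b hτm horth i (htan j)
  rw [hgn] at h7
  exact (mul_eq_zero.1 h7).resolve_left fun h => hκ (C_eq_zero.1 h)

/-! ### Dimensions -/

theorem one_add_choose (m : ℕ) : (1 + m).choose m = m + 1 := by
  rw [add_comm, Nat.choose_succ_self_right]

theorem two_mul_choose (m : ℕ) : 2 * (2 + m).choose m = (m + 1) * (m + 2) := by
  induction m with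
  | zero => rfl
  | succ m ih =>
    have h := one_add_choose (m + 1)
    rw [show 2 + (m + 1) = 2 + m + 1 by ring, Nat.choose_succ_succ, mul_add, ih,
      show 2 + m = 1 + (m + 1) by ring, h]
    ring

theorem six_mul_choose (m : ℕ) : 6 * (3 + m).choose m = (m + 1) * (m + 2) * (m + 3) := by
  induction m with
  | zero => rfl
  | succ m ih =>
    have h := two_mul_choose (m + 1)
    rw [show 3 + (m + 1) = 3 + m + 1 by ring, Nat.choose_succ_succ, mul_add, ih,
      show 3 + m = 2 + (m + 1) by ring]
    linarith

/-- The position of the entry `(i, j)` of a symmetric matrix in the list of its six independent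
entries. -/
def entryIndex : Fin 3 → Fin 3 → Fin 6 := ![![0, 1, 2], ![1, 3, 4], ![2, 4, 5]]

/-- The positions of the six independent entries of a symmetric matrix. -/
def entryPos : Fin 6 → Fin 3 × Fin 3 := ![(0, 0), (0, 1), (0, 2), (1, 1), (1, 2), (2, 2)]

theorem entryIndex_entryPos : ∀ k, entryIndex (entryPos k).1 (entryPos k).2 = k := by decide

theorem entryPos_entryIndex : ∀ i j, entryPos (entryIndex i j) = (i, j) ∨
    entryPos (entryIndex i j) = (j, i) := by decide

theorem apply_entryPos_entryIndex {R : Type*} {M : Matrix (Fin 3) (Fin 3) R} (hM : M.IsSymm)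
    (i j : Fin 3) : M (entryPos (entryIndex i j)).1 (entryPos (entryIndex i j)).2 = M i j := by
  rcases entryPos_entryIndex i j with h | h <;> rw [h]
  exact hM.apply i j

/-- The symmetric tensor field with the given six entries. -/
def symOfEntries (m : ℕ) : (Fin 6 → polys m) →ₗ[ℝ] Tensor where
  toFun q := Matrix.of fun i j => (q (entryIndex i j)).1
  map_add' _ _ := rfl
  map_smul' _ _ := rfl

theorem symOfEntries_injective (m : ℕ) : Function.Injective (symOfEntries m) := by
  intro q q' h
  refine funext fun k => Subtype.ext ?_
  have : (q (entryIndex (entryPos k).1 (entryPos k).2)).1 =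
      (q' (entryIndex (entryPos k).1 (entryPos k).2)).1 :=
    congrFun (congrFun h (entryPos k).1) (entryPos k).2
  rwa [entryIndex_entryPos] at this

theorem range_symOfEntries (m : ℕ) : LinearMap.range (symOfEntries m) = symT m := by
  ext τ
  constructor
  · rintro ⟨q, rfl⟩
    refine ⟨fun i j => (q _).2, ?_⟩
    ext1 i j
    have : entryIndex j i = entryIndex i j := by revert i j; decide
    change (q (entryIndex j i)).1 = (q (entryIndex i j)).1
    rw [this]
  · intro hτ
    refine ⟨fun k => ⟨τ (entryPos k).1 (entryPos k).2, hτ.1 _ _⟩, ?_⟩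
    ext1 i j
    exact apply_entryPos_entryIndex hτ.2 i j

theorem finrank_symT (m : ℕ) : Module.finrank ℝ (symT m) = 6 * (3 + m).choose m := by
  rw [← range_symOfEntries, LinearMap.finrank_range_of_inj (symOfEntries_injective m),
    Module.finrank_pi_fintype]
  simp [finrank_restrictTotalDegree]

instance finite_symT (m : ℕ) : Module.Finite ℝ (symT m) := by
  rw [← range_symOfEntries]
  infer_instance

/-- The kernel of the Hessian is P₁, of dimension 4; m ≥ 1 ensures that all of it lies in P_m. -/
theorem finrank_hessSpace {m : ℕ} (hm : 1 ≤ m) :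
    Module.finrank ℝ (hessSpace m) + 4 = (3 + m).choose m := by
  have h := LinearMap.finrank_range_add_finrank_ker (hessLin.domRestrict (polys m))
  have hker : LinearMap.ker (hessLin.domRestrict (polys m)) =
      (polys 1).comap (polys m).subtype := by
    ext p
    rw [LinearMap.mem_ker, Submodule.mem_comap]
    refine ⟨fun hp => mem_polys_one_of_quadPos_hess ?_, fun hp => hess_eq_zero_of_mem_polys_one hp⟩
    rw [show hessLin ((polys m).subtype p) = 0 from hp]
    simp [quadPos, mulPos]
  have hle : polys 1 ≤ polys m := fun p hp => restrict_mono hm hp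
  rw [LinearMap.range_domRestrict, hker, (Submodule.comapSubtypeEquivOfLe hle).finrank_eq,
    finrank_restrictTotalDegree, finrank_restrictTotalDegree] at h
  exact h

theorem symCrossSpace_le (m : ℕ) : symCrossSpace m ≤ symT (m + 1) := by
  rintro _ ⟨A, hA, rfl⟩
  exact symCross_mem hA

theorem curlPart_le (l : ℕ) : curlPart l ≤ symT l := by
  rintro _ ⟨A, hA, rfl⟩
  exact symCurl_mem hA

instance finite_symCrossSpace (m : ℕ) : Module.Finite ℝ (symCrossSpace m) :=
  Submodule.finiteDimensional_of_le (symCrossSpace_le m)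

instance finite_curlPart (l : ℕ) : Module.Finite ℝ (curlPart l) :=
  Submodule.finiteDimensional_of_le (curlPart_le l)

instance finite_hessSpace (m : ℕ) : Module.Finite ℝ (hessSpace m) := by
  unfold hessSpace
  infer_instance

instance finite_radialPart (k : ℕ) : Module.Finite ℝ (radialPart k) := by
  unfold radialPart
  infer_instance

instance finite_shape (l k : ℕ) : Module.Finite ℝ (shape l k) := by
  unfold shape
  infer_instance

instance finite_polysOn (S : Set Vec) (m : ℕ) : Module.Finite ℝ (polysOn S m) := by
  unfold polysOn
  infer_instance

/-- The Hessians of P_{m+3} and this space lie disjointly in the symmetric fields of degree m + 1.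
An upper bound suffices, since this space indexes degrees of freedom. -/
theorem finrank_symCrossSpace_le (m : ℕ) :
    Module.finrank ℝ (symCrossSpace m) + (3 + (m + 3)).choose (m + 3) ≤
      6 * (3 + (m + 1)).choose (m + 1) + 4 := by
  have h1 := Submodule.finrank_sup_add_finrank_inf_eq (hessSpace (m + 3)) (symCrossSpace m)
  rw [(disjoint_hessSpace_symCrossSpace (m + 3) m).eq_bot, finrank_bot, add_zero] at h1
  have h2 : hessSpace (m + 3) ⊔ symCrossSpace m ≤ symT (m + 1) := by
    refine sup_le ?_ (symCrossSpace_le m)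
    rintro _ ⟨p, hp, rfl⟩
    have h := hess_mem hp
    rwa [show m + 3 - 2 = m + 1 by omega] at h
  have h3 := Submodule.finrank_mono h2
  rw [finrank_symT] at h3
  have h4 := finrank_hessSpace (m := m + 3) (by omega)
  omega

theorem finrank_radialPart (k : ℕ) :
    Module.finrank ℝ (radialPart k) = (3 + (k - 2)).choose (k - 2) := by
  have hinj : Function.Injective posPos := by
    rw [injective_iff_map_eq_zero]
    intro q hq
    refine divDiv_posPos_injective ?_
    rw [hq]
    simp [divDiv, divRow, divVec]
  rw [radialPart, ← (Submodule.equivMapOfInjective posPos hinj (polys (k - 2))).finrank_eq,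
    finrank_restrictTotalDegree]

/-- Here the radial part has the full degree l - 2 rather than k - 2, so that the sum covers all
symmetric fields of degree l. -/
theorem le_finrank_curlPart {l : ℕ} (hl : 2 ≤ l) :
    6 * (3 + l).choose l ≤ Module.finrank ℝ (curlPart l) + (3 + (l - 2)).choose (l - 2) := by
  rw [← finrank_symT, ← finrank_radialPart]
  exact (Submodule.finrank_mono (symT_le_curlPart_sup_radialPart hl)).trans
    (Submodule.finrank_add_le_finrank_add_finrank _ _)

theorem finrank_shape (l k : ℕ) : Module.finrank ℝ (shape l k) =
    Module.finrank ℝ (curlPart l) + (3 + (k - 2)).choose (k - 2) := by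
  have h := Submodule.finrank_sup_add_finrank_inf_eq (curlPart l) (radialPart k)
  rwa [(disjoint_curlPart_radialPart l k).eq_bot, finrank_bot, add_zero, finrank_radialPart] at h

/-! ### Counting degrees of freedom. -/

/-- The space of polynomials on a face of dimension `n` is at most as large as the space of
polynomials in `n` variables. -/
theorem finrank_polysOn_hull_le {v : Fin 4 → Vec} (b : Bary v) {S : Finset (Fin 4)} {n : ℕ}
    (hS : S.card = n + 1) (m : ℕ) :
    Module.finrank ℝ (polysOn (hull v S) m) ≤ (n + m).choose m := by
  let e : Fin (n + 1) → Fin 4 := S.orderEmbOfFin hS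
  have he : Function.Injective e := (S.orderEmbOfFin hS).injective
  have heS : Finset.univ.image e = S := by
    rw [← Finset.coe_inj, Finset.coe_image, Finset.coe_univ, Set.image_univ,
      Finset.range_orderEmbOfFin]
  -- A polynomial on the face is a polynomial of the same degree in the n barycentric coordinates
  -- other than that of the vertex `e 0`.
  let Ψ : MvPolynomial (Fin n) ℝ →ₗ[ℝ] (Vec → ℝ) :=
    restrictTo (hull v S) ∘ₗ (aeval fun k => b.lam (e k.succ)).toLinearMap
  have hle : polysOn (hull v S) m ≤ (restrictTotalDegree (Fin n) ℝ m).map Ψ := by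
    rintro _ ⟨f, hf, rfl⟩
    refine ⟨aeval (fun a => C (v (e 0) a) +
      ∑ k : Fin n, C (v (e k.succ) a - v (e 0) a) * X k) f, aeval_mem_restrict (fun a =>
        Submodule.add_mem _ (C_mem_restrict _) (Submodule.sum_mem _ fun k _ =>
          C_mul_mem_restrict _ (X_mem_restrict k le_rfl))) hf, ?_⟩
    ext x
    by_cases hx : x ∈ hull v S
    · have hpt := (b.mem_corner_and_pt_coordOf he heS hx).2
      rw [pt_coordOf] at hpt
      rw [LinearMap.comp_apply, restrictTo_apply hx, restrictTo_apply hx, AlgHom.toLinearMap_apply,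
        eval_aeval, eval_aeval]
      refine congrArg (fun y => eval y f) (funext fun a => ?_)
      have := congrFun hpt a
      simp only [Pi.add_apply, Finset.sum_apply, Pi.smul_apply, Pi.sub_apply, smul_eq_mul] at this
      simpa [mul_comm] using this
    · simp [Ψ, restrictTo, hx]
  calc Module.finrank ℝ (polysOn (hull v S) m)
      ≤ Module.finrank ℝ ((restrictTotalDegree (Fin n) ℝ m).map Ψ) := Submodule.finrank_mono hle
    _ ≤ _ := Submodule.finrank_map_le _ _
    _ = _ := finrank_restrictTotalDegree n m

theorem finrank_polysOn_face_le {v : Fin 4 → Vec} (b : Bary v) (i : Fin 4) (m : ℕ) :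
    Module.finrank ℝ (polysOn (face v i) m) ≤ (2 + m).choose m := by
  rw [← hull_compl_singleton]
  exact finrank_polysOn_hull_le b (card_compl_singleton' i) m

theorem finrank_polysOn_edge_le {v : Fin 4 → Vec} (b : Bary v) (e : Edge) (m : ℕ) :
    Module.finrank ℝ (polysOn (edge v e) m) ≤ m + 1 := by
  rw [← hull_pair, ← one_add_choose]
  exact finrank_polysOn_hull_le b (Finset.card_pair e.2.ne) m

/-! ### The degrees of freedom as linear maps -/

theorem comp_smul_tensor (a b : Vec) (c : ℝ) (τ : Tensor) :
    comp a (c • τ) b = c • comp a τ b := by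
  simp [comp, Matrix.smul_mulVec, dotProduct_smul]

/-- `τ ↦ aᵀ τ b` as a linear map. -/
def compLin (a b : Vec) : Tensor →ₗ[ℝ] Poly where
  toFun τ := comp a τ b
  map_add' := comp_add_tensor a b
  map_smul' c τ := comp_smul_tensor a b c τ

/-- The second trace as a linear map. -/
def trace₂Lin (n : Vec) : Tensor →ₗ[ℝ] Poly where
  toFun τ := trace₂ n τ
  map_add' := trace₂_add n
  map_smul' c τ := by
    simp only [trace₂_eq, comp_smul_tensor, divF_eq, divVec, Matrix.smul_mulVec, Pi.smul_apply,
      smul_eq_C_mul, dirDeriv_C_mul, pderiv_C_mul, RingHom.id_apply]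
    ring

/-- `τ ↦ (τ n) · (n × x)` as a linear map. -/
def rotCompLin (n : Vec) : Tensor →ₗ[ℝ] Poly where
  toFun τ := rotComp n τ
  map_add' τ ς := by simp [rotComp, Matrix.add_mulVec, add_dotProduct]
  map_smul' c τ := by simp [rotComp, Matrix.smul_mulVec, smul_dotProduct]

/-- Moments against polynomials on a set are linear functionals. -/
theorem exists_dual_of_moment {v : Fin 4 → Vec} {S : Finset (Fin 4)} {H : Set Vec} {c : ℝ}
    {B : Tensor → (Vec → ℝ) → ℝ} (L : Tensor →ₗ[ℝ] Poly) (m : ℕ)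
    (hB : ∀ τ q, B τ (restrictTo H q) = c * faceFun S (pull v (L τ * q))) :
    ∃ Φ : Tensor →ₗ[ℝ] Module.Dual ℝ (polysOn H m), ∀ τ q, Φ τ q = B τ q.1 := by
  refine ⟨LinearMap.mk₂ ℝ (fun τ q => B τ q.1) ?_ ?_ ?_ ?_, fun _ _ => rfl⟩
  · rintro τ τ' ⟨_, q, _, rfl⟩
    simp only [hB, map_add, add_mul, mul_add]
  · rintro a τ ⟨_, q, _, rfl⟩
    simp only [hB, map_smul, smul_mul_assoc, smul_eq_mul]
    ring
  · rintro τ ⟨_, q, _, rfl⟩ ⟨_, q', _, rfl⟩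
    simp only [Submodule.coe_add, ← map_add (restrictTo H), hB]
    simp only [mul_add, map_add]
  · rintro a τ ⟨_, q, _, rfl⟩
    simp only [Submodule.coe_smul, ← map_smul (restrictTo H), hB]
    simp only [mul_smul_comm, map_smul, smul_eq_mul]
    ring

theorem frob_comm (τ ς : Tensor) : frob τ ς = frob ς τ := by
  simp only [frob, mul_comm]

theorem frob_smul (c : ℝ) (τ ς : Tensor) : frob τ (c • ς) = c • frob τ ς := by
  simp only [frob, Matrix.smul_apply, mul_smul_comm, Finset.smul_sum]

theorem exists_dual_of_interiorMoment {v : Fin 4 → Vec} (b : Bary v) (V : Submodule ℝ Tensor) :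
    ∃ Φ : Tensor →ₗ[ℝ] Module.Dual ℝ V, ∀ τ ς, Φ τ ς = interiorMoment v τ ς.1 := by
  obtain ⟨K, _, hK⟩ := exists_tet_integral_eq b
  have hB : ∀ τ ς, interiorMoment v τ ς = K * faceFun Finset.univ (pull v (frob τ ς)) :=
    fun τ ς => by rw [interiorMoment_eq, hK]
  refine ⟨LinearMap.mk₂ ℝ (fun τ ς => interiorMoment v τ ς.1) ?_ ?_ ?_ ?_, fun _ _ => rfl⟩
  · intro τ τ' ς
    simp only [hB, frob_comm _ ς.1, frob_add, map_add, mul_add]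
  · intro a τ ς
    simp only [hB, frob_comm _ ς.1, frob_smul, map_smul, smul_eq_mul]
    ring
  · intro τ ς ς'
    simp only [hB, Submodule.coe_add, frob_add, map_add, mul_add]
  · intro a τ ς
    simp only [hB, Submodule.coe_smul, frob_smul, map_smul, smul_eq_mul]
    ring

/-- The independent entries of the value at a point. -/
def entriesAt (x : Vec) : Tensor →ₗ[ℝ] (Fin 6 → ℝ) where
  toFun τ k := value τ x (entryPos k).1 (entryPos k).2
  map_add' τ ς := by
    ext k
    simp [value]
  map_smul' c τ := by
    ext k
    simp [value]

theorem eq_of_entries {M M' : Matrix (Fin 3) (Fin 3) ℝ} (hM : M.IsSymm) (hM' : M'.IsSymm)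
    (h : ∀ k, M (entryPos k).1 (entryPos k).2 = M' (entryPos k).1 (entryPos k).2) : M = M' := by
  ext i j
  rw [← apply_entryPos_entryIndex hM, h, apply_entryPos_entryIndex hM']

theorem value_isSymm {τ : Tensor} (hτ : τᵀ = τ) (x : Vec) : (value τ x).IsSymm := by
  rw [Matrix.IsSymm, value, ← Matrix.transpose_map, hτ]

/-- The space of values of the degrees of freedom; a symmetric matrix is represented by its six
independent entries. -/
abbrev DofValues (v : Fin 4 → Vec) (l k : ℕ) (f₁ : Fin 4) : Type :=
  (Fin 4 → Fin 6 → ℝ) ×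
  ((e : Edge) → {p : Fin 2 × Fin 2 // p.1 ≤ p.2} → Module.Dual ℝ (polysOn (edge v e) (l - 2))) ×
  ((i : Fin 4) → Module.Dual ℝ (polysOn (face v i) (l - 3))) ×
  ((i : Fin 4) → Module.Dual ℝ (polysOn (face v i) (l - 1))) ×
  Module.Dual ℝ (hessSpace (k - 2)) × Module.Dual ℝ (symCrossSpace (l - 2)) ×
  Module.Dual ℝ (polysOn (face v f₁) (l - 2))

theorem card_edge : Fintype.card Edge = 6 := by decide

theorem card_pairs : Fintype.card {p : Fin 2 × Fin 2 // p.1 ≤ p.2} = 3 := by decide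

instance finite_dual_polysOn (S : Set Vec) (m : ℕ) :
    Module.Finite ℝ (Module.Dual ℝ (polysOn S m)) := inferInstance

theorem finite_and_finrank_prod_le {A B : Type*} [AddCommGroup A] [AddCommGroup B] [Module ℝ A]
    [Module ℝ B] {a b : ℕ} (hA : Module.Finite ℝ A ∧ Module.finrank ℝ A ≤ a)
    (hB : Module.Finite ℝ B ∧ Module.finrank ℝ B ≤ b) :
    Module.Finite ℝ (A × B) ∧ Module.finrank ℝ (A × B) ≤ a + b := by
  obtain ⟨_, hA⟩ := hA
  obtain ⟨_, hB⟩ := hB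
  exact ⟨inferInstance, Module.finrank_prod.trans_le (add_le_add hA hB)⟩

theorem finite_and_finrank_edgeDuals_le {v : Fin 4 → Vec} (b : Bary v) (m : ℕ) :
    Module.Finite ℝ ((e : Edge) → {p : Fin 2 × Fin 2 // p.1 ≤ p.2} →
      Module.Dual ℝ (polysOn (edge v e) m)) ∧
    Module.finrank ℝ ((e : Edge) → {p : Fin 2 × Fin 2 // p.1 ≤ p.2} →
      Module.Dual ℝ (polysOn (edge v e) m)) ≤ 18 * (m + 1) := by
  refine ⟨inferInstance, ?_⟩
  simp only [Module.finrank_pi_fintype, Subspace.dual_finrank_eq, Finset.sum_const,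
    Finset.card_univ, card_pairs, smul_eq_mul]
  refine (Finset.sum_le_card_nsmul _ _ (3 * (m + 1)) fun e _ => ?_).trans_eq ?_
  · exact Nat.mul_le_mul_left 3 (finrank_polysOn_edge_le b e m)
  · rw [Finset.card_univ, card_edge, smul_eq_mul]
    ring

theorem finite_and_finrank_faceDuals_le {v : Fin 4 → Vec} (b : Bary v) (m : ℕ) :
    Module.Finite ℝ ((i : Fin 4) → Module.Dual ℝ (polysOn (face v i) m)) ∧
    Module.finrank ℝ ((i : Fin 4) → Module.Dual ℝ (polysOn (face v i) m)) ≤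
      4 * (2 + m).choose m := by
  refine ⟨inferInstance, ?_⟩
  simp only [Module.finrank_pi_fintype, Subspace.dual_finrank_eq]
  exact Finset.sum_le_card_nsmul _ _ _ fun i _ => finrank_polysOn_face_le b i m

theorem finite_and_finrank_dual_le {V : Type*} [AddCommGroup V] [Module ℝ V] [Module.Finite ℝ V]
    {a : ℕ} (h : Module.finrank ℝ V ≤ a) :
    Module.Finite ℝ (Module.Dual ℝ V) ∧ Module.finrank ℝ (Module.Dual ℝ V) ≤ a :=
  ⟨inferInstance, Subspace.dual_finrank_eq.trans_le h⟩

/-- There are at most as many degrees of freedom as there are shape functions. -/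
theorem dofs_le_finrank_shape {l k : ℕ} (hk : 3 ≤ k) (hl : 3 ≤ l) :
    24 + (18 * (l - 2 + 1) + (4 * (2 + (l - 3)).choose (l - 3) +
      (4 * (2 + (l - 1)).choose (l - 1) + (Module.finrank ℝ (hessSpace (k - 2)) +
      (Module.finrank ℝ (symCrossSpace (l - 2)) + (2 + (l - 2)).choose (l - 2)))))) ≤
    Module.finrank ℝ (shape l k) := by
  -- This removes the truncated subtractions. The binomial coefficient in k occurs on both sides and
  -- cancels, and so do the 4 of the Hessian count and the 4 of the cross-product count; a
  -- polynomial inequality in t remains.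
  obtain ⟨t, rfl⟩ : ∃ t, l = t + 3 := ⟨l - 3, by omega⟩
  have hH := finrank_hessSpace (m := k - 2) (by omega)
  have hC := finrank_symCrossSpace_le (t + 1)
  have hS := finrank_shape (t + 3) k
  have hA := le_finrank_curlPart (l := t + 3) (by omega)
  have c1 := two_mul_choose t
  have c2 := two_mul_choose (t + 2)
  have c3 := two_mul_choose (t + 1)
  have c4 := six_mul_choose (t + 1 + 3)
  have c5 := six_mul_choose (t + 1 + 1)
  have c6 := six_mul_choose (t + 3)
  have c7 := six_mul_choose (t + 1)
  rw [show t + 3 - 2 = t + 1 by omega] at hA ⊢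
  rw [show t + 3 - 1 = t + 2 by omega, show t + 3 - 3 = t by omega]
  generalize (2 + t).choose t = x1 at *
  generalize (2 + (t + 2)).choose (t + 2) = x2 at *
  generalize (2 + (t + 1)).choose (t + 1) = x3 at *
  generalize (3 + (t + 1 + 3)).choose (t + 1 + 3) = x4 at *
  generalize (3 + (t + 1 + 1)).choose (t + 1 + 1) = x5 at *
  generalize (3 + (t + 3)).choose (t + 3) = x6 at *
  generalize (3 + (t + 1)).choose (t + 1) = x7 at *
  generalize (3 + (k - 2)).choose (k - 2) = x8 at *
  generalize Module.finrank ℝ (hessSpace (k - 2)) = y1 at *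
  generalize Module.finrank ℝ (symCrossSpace (t + 1)) = y2 at *
  generalize Module.finrank ℝ (curlPart (t + 3)) = y3 at *
  generalize Module.finrank ℝ (shape (t + 3) k) = y4 at *
  ring_nf at c1 c2 c3 c4 c5 c6 c7
  linarith

theorem finite_and_finrank_dofValues_le {v : Fin 4 → Vec} (b : Bary v) {l k : ℕ} (hk : 3 ≤ k)
    (hl : 3 ≤ l) (f₁ : Fin 4) :
    Module.Finite ℝ (DofValues v l k f₁) ∧
      Module.finrank ℝ (DofValues v l k f₁) ≤ Module.finrank ℝ (shape l k) := by
  have h := finite_and_finrank_prod_le (A := Fin 4 → Fin 6 → ℝ) (a := 24)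
    ⟨inferInstance, by simp [Module.finrank_pi_fintype]⟩
    (finite_and_finrank_prod_le (finite_and_finrank_edgeDuals_le b (l - 2))
    (finite_and_finrank_prod_le (finite_and_finrank_faceDuals_le b (l - 3))
    (finite_and_finrank_prod_le (finite_and_finrank_faceDuals_le b (l - 1))
    (finite_and_finrank_prod_le (finite_and_finrank_dual_le (V := hessSpace (k - 2)) le_rfl)
    (finite_and_finrank_prod_le (finite_and_finrank_dual_le (V := symCrossSpace (l - 2)) le_rfl)
    (finite_and_finrank_dual_le (finrank_polysOn_face_le b f₁ (l - 2))))))))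
  exact ⟨h.1, h.2.trans (dofs_le_finrank_shape hk hl)⟩

/-- An injective linear map into a space that is not larger is bijective. -/
theorem surjective_of_finrank_le {A B : Type*} [AddCommGroup A] [AddCommGroup B] [Module ℝ A]
    [Module ℝ B] [Module.Finite ℝ A]
    (hB : Module.Finite ℝ B ∧ Module.finrank ℝ B ≤ Module.finrank ℝ A) {f : A →ₗ[ℝ] B}
    (hf : Function.Injective f) : Function.Surjective f := by
  obtain ⟨_, hB⟩ := hB
  exact (LinearMap.injective_iff_surjective_of_finrank_eq_finrank
    (le_antisymm (LinearMap.finrank_le_finrank_of_injective hf) hB)).1 hf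

/-- Bundles all degrees of freedom into one linear map, so that existence and uniqueness follow from
its bijectivity on the shape functions. -/
theorem exists_dofMap {v : Fin 4 → Vec} (b : Bary v) (n : Fin 4 → Vec) (m : Edge → Fin 2 → Vec)
    (l k : ℕ) (f₁ : Fin 4) :
    ∃ D : Tensor →ₗ[ℝ] DofValues v l k f₁, ∀ τ,
      (∀ δ j, (D τ).1 δ j = value τ (v δ) (entryPos j).1 (entryPos j).2) ∧
      (∀ e p q, (D τ).2.1 e p q = edgeMoment v e (m e p.1.1) (m e p.1.2) τ q.1) ∧
      (∀ i q, (D τ).2.2.1 i q = normalMoment v i (n i) τ q.1) ∧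
      (∀ i q, (D τ).2.2.2.1 i q = trace₂Moment v i (n i) τ q.1) ∧
      (∀ ς, (D τ).2.2.2.2.1 ς = interiorMoment v τ ς.1) ∧
      (∀ ς, (D τ).2.2.2.2.2.1 ς = interiorMoment v τ ς.1) ∧
      (∀ q, (D τ).2.2.2.2.2.2 q = tangentialMoment v f₁ (n f₁) τ q.1) := by
  choose E hE using fun (e : Edge) (p : {p : Fin 2 × Fin 2 // p.1 ≤ p.2}) =>
    exists_dual_of_moment (compLin (m e p.1.1) (m e p.1.2)) (l - 2)
      (edgeMoment_eq v e (m e p.1.1) (m e p.1.2))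
  choose N hN using fun i =>
    exists_dual_of_moment (compLin (n i) (n i)) (l - 3) (normalMoment_eq v i (n i))
  choose T hT using fun i =>
    exists_dual_of_moment (trace₂Lin (n i)) (l - 1) (trace₂Moment_eq v i (n i))
  obtain ⟨R, hR⟩ :=
    exists_dual_of_moment (rotCompLin (n f₁)) (l - 2) (tangentialMoment_eq v f₁ (n f₁))
  obtain ⟨H, hH⟩ := exists_dual_of_interiorMoment b (hessSpace (k - 2))
  obtain ⟨G, hG⟩ := exists_dual_of_interiorMoment b (symCrossSpace (l - 2))
  exact ⟨(LinearMap.pi fun δ => entriesAt (v δ)).prod ((LinearMap.pi fun e =>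
      LinearMap.pi fun p => E e p).prod ((LinearMap.pi N).prod ((LinearMap.pi T).prod
      (H.prod (G.prod R))))), fun τ => ⟨fun _ _ => rfl, fun e p q => hE e p τ q,
      fun i q => hN i τ q, fun i q => hT i τ q, fun ς => hH τ ς, fun ς => hG τ ς,
      fun q => hR τ q⟩⟩

/-- The traces on an edge are determined by the degrees of freedom on that edge. -/
theorem comp_vanish_edge {v : Fin 4 → Vec} (hv : AffineIndependent ℝ v) (b : Bary v) {l k : ℕ}
    (hkl : k - 2 ≤ l) {m : Edge → Fin 2 → Vec} (hm : ∀ e, IsNormalPair v e (m e)) {τ : Tensor}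
    (hτ : τ ∈ shape l k) {e : Edge} (h1 : value τ (v e.1.1) = 0) (h2 : value τ (v e.1.2) = 0)
    (he : ∀ a b, ∀ q ∈ polysOn (edge v e) (l - 2), edgeMoment v e (m e a) (m e b) τ q = 0)
    {w w' : Vec} (hw : w ⬝ᵥ (v e.1.2 - v e.1.1) = 0) (hw' : w' ⬝ᵥ (v e.1.2 - v e.1.1) = 0) :
    ∀ x ∈ edge v e, eval x (comp w τ w') = 0 := fun x hx =>
  comp_vanish_of_pair hv (hm e) (fun a c => comp_vanish_on_edge hv b hkl hτ ((hm e).2 a)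
    ((hm e).2 c) h1 h2 (he a c) x hx) hw hw'

/-- The two traces on a face are determined by the degrees of freedom on that face. -/
theorem traces_vanish_face {v : Fin 4 → Vec} (hv : AffineIndependent ℝ v) (b : Bary v) {l k : ℕ}
    (hkl : k - 2 ≤ l - 1) {n : Fin 4 → Vec} (hn : ∀ i, IsUnitNormal v i (n i))
    {m : Edge → Fin 2 → Vec} (hm : ∀ e, IsNormalPair v e (m e)) {τ : Tensor}
    (hτ : τ ∈ shape l k) {i : Fin 4} (hV : ∀ δ, δ ≠ i → value τ (v δ) = 0)
    (hE : ∀ e : Edge, e.1.1 ≠ i → e.1.2 ≠ i → ∀ a b, ∀ q ∈ polysOn (edge v e) (l - 2),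
      edgeMoment v e (m e a) (m e b) τ q = 0)
    (hN : ∀ q ∈ polysOn (face v i) (l - 3), normalMoment v i (n i) τ q = 0)
    (hT : ∀ q ∈ polysOn (face v i) (l - 1), trace₂Moment v i (n i) τ q = 0) :
    ∀ x ∈ face v i, eval x (comp (n i) τ (n i)) = 0 ∧ eval x (trace₂ (n i) τ) = 0 := by
  intro x hx
  rw [← hull_compl_singleton] at hx
  exact ⟨normal_comp_vanish b (by omega) hτ (hn i) (fun e h1 h2 => comp_vanish_edge hv b
    (by omega) hm hτ (hV _ h1) (hV _ h2) (hE e h1 h2) ((hn i).dotProduct_edge h1 h2)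
    ((hn i).dotProduct_edge h1 h2)) hN x hx, trace₂_vanish b hkl hτ (hn i) hT x hx⟩

/-- Transfers the vanishing from the integrals of the statement to the normalized integrals of
`eq_zero_of_moments`; the lengths, areas and volume constant are nonzero. -/
theorem eq_zero_of_dofs {v : Fin 4 → Vec} (hv : AffineIndependent ℝ v) (b : Bary v) {k l : ℕ}
    (hl : max (k - 1) 3 ≤ l) {n : Fin 4 → Vec} (hn : ∀ i, IsUnitNormal v i (n i))
    {m : Edge → Fin 2 → Vec} (hm : ∀ e, IsNormalPair v e (m e)) (f₁ : Fin 4) {τ : Tensor}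
    (hτ : τ ∈ shape l k) (hV : ∀ δ, value τ (v δ) = 0)
    (hE : ∀ (e : Edge) (p : {p : Fin 2 × Fin 2 // p.1 ≤ p.2}) (q : polysOn (edge v e) (l - 2)),
      edgeMoment v e (m e p.1.1) (m e p.1.2) τ q.1 = 0)
    (hN : ∀ (i) (q : polysOn (face v i) (l - 3)), normalMoment v i (n i) τ q.1 = 0)
    (hT : ∀ (i) (q : polysOn (face v i) (l - 1)), trace₂Moment v i (n i) τ q.1 = 0)
    (hH : ∀ ς : hessSpace (k - 2), interiorMoment v τ ς.1 = 0)
    (hC : ∀ ς : symCrossSpace (l - 2), interiorMoment v τ ς.1 = 0)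
    (hR : ∀ q : polysOn (face v f₁) (l - 2), tangentialMoment v f₁ (n f₁) τ q.1 = 0) :
    τ = 0 := by
  have h1 := (le_max_left _ _).trans hl
  -- The moments are prescribed for a ≤ c only; symmetry of τ gives the others.
  have hE' : ∀ (e : Edge) (a c : Fin 2), ∀ q ∈ polysOn (edge v e) (l - 2),
      edgeMoment v e (m e a) (m e c) τ q = 0 := by
    intro e a c q hq
    rcases le_total a c with h | h
    · exact hE e ⟨(a, c), h⟩ ⟨q, hq⟩
    · have := hE e ⟨(c, a), h⟩ ⟨q, hq⟩
      rwa [edgeMoment, comp_comm (transpose_of_mem_shape hτ)] at this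
  have hface := fun i => traces_vanish_face hv b (by omega) hn hm hτ (i := i) (fun δ _ => hV δ)
    (fun e _ _ => hE' e) (fun q hq => hN i ⟨q, hq⟩) (fun q hq => hT i ⟨q, hq⟩)
  simp only [← hull_compl_singleton] at hface
  obtain ⟨K, hK0, hK⟩ := exists_tet_integral_eq b
  refine eq_zero_of_moments b hl hn f₁ hτ
    (fun e w w' hw hw' => comp_vanish_edge hv b (by omega) hm hτ (hV _) (hV _) (hE' e) hw hw')
    (fun i x hx => (hface i x hx).1) (fun i x hx => (hface i x hx).2) (fun p hp => ?_)
    (fun A hA => ?_) (fun q hq => ?_)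
  · have := hH ⟨_, p, hp, rfl⟩
    rw [interiorMoment_eq, hK] at this
    exact (mul_eq_zero.1 this).resolve_left hK0
  · have := hC ⟨_, A, hA, rfl⟩
    rw [interiorMoment_eq, hK] at this
    exact (mul_eq_zero.1 this).resolve_left hK0
  · have := hR ⟨_, q, hq, rfl⟩
    rw [tangentialMoment_eq] at this
    exact (mul_eq_zero.1 this).resolve_left (face_area_ne_zero b f₁)

end

end DivDiv

/-! ### The main theorem. -/

theorem mainTheorem1 (k l : ℕ) (hk : 3 ≤ k) (hl : max (k - 1) 3 ≤ l)
    (v : Fin 4 → DivDiv.Vec) (hv : AffineIndependent ℝ v)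
    (n : Fin 4 → DivDiv.Vec) (hn : ∀ i, DivDiv.IsUnitNormal v i (n i))
    (m : DivDiv.Edge → Fin 2 → DivDiv.Vec) (hm : ∀ e, DivDiv.IsNormalPair v e (m e))
    (f₁ : Fin 4) :
    -- the sum defining the space of shape functions is direct
    Disjoint (DivDiv.curlPart l) (DivDiv.radialPart k) ∧
    -- unisolvence: arbitrary values of the degrees of freedom are attained exactly once
    (∀ (dV : Fin 4 → Matrix (Fin 3) (Fin 3) ℝ) (_ : ∀ δ, (dV δ).IsSymm)
        (dE : (e : DivDiv.Edge) → {p : Fin 2 × Fin 2 // p.1 ≤ p.2} →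
          Module.Dual ℝ (DivDiv.polysOn (DivDiv.edge v e) (l - 2)))
        (dN : (i : Fin 4) → Module.Dual ℝ (DivDiv.polysOn (DivDiv.face v i) (l - 3)))
        (dT : (i : Fin 4) → Module.Dual ℝ (DivDiv.polysOn (DivDiv.face v i) (l - 1)))
        (dH : Module.Dual ℝ (DivDiv.hessSpace (k - 2)))
        (dC : Module.Dual ℝ (DivDiv.symCrossSpace (l - 2)))
        (dF : Module.Dual ℝ (DivDiv.polysOn (DivDiv.face v f₁) (l - 2))),
      ∃! τ : DivDiv.Tensor, τ ∈ DivDiv.shape l k ∧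
        (∀ δ, DivDiv.value τ (v δ) = dV δ) ∧
        (∀ e p q, DivDiv.edgeMoment v e (m e p.1.1) (m e p.1.2) τ q.1 = dE e p q) ∧
        (∀ i q, DivDiv.normalMoment v i (n i) τ q.1 = dN i q) ∧
        (∀ i q, DivDiv.trace₂Moment v i (n i) τ q.1 = dT i q) ∧
        (∀ ς, DivDiv.interiorMoment v τ ς.1 = dH ς) ∧
        (∀ ς, DivDiv.interiorMoment v τ ς.1 = dC ς) ∧
        (∀ q, DivDiv.tangentialMoment v f₁ (n f₁) τ q.1 = dF q)) ∧
    -- the traces on an edge are determined by the degrees of freedom on that edge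
    (∀ τ ∈ DivDiv.shape l k, ∀ e : DivDiv.Edge,
      DivDiv.value τ (v e.1.1) = 0 → DivDiv.value τ (v e.1.2) = 0 →
      (∀ a b, ∀ q ∈ DivDiv.polysOn (DivDiv.edge v e) (l - 2),
        DivDiv.edgeMoment v e (m e a) (m e b) τ q = 0) →
      ∀ a b, ∀ x ∈ DivDiv.edge v e,
        MvPolynomial.eval x (DivDiv.comp (m e a) τ (m e b)) = 0) ∧
    -- the two traces on a face are determined by the degrees of freedom on that closed face
    (∀ τ ∈ DivDiv.shape l k, ∀ i : Fin 4,
      (∀ δ, δ ≠ i → DivDiv.value τ (v δ) = 0) →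
      (∀ e : DivDiv.Edge, e.1.1 ≠ i → e.1.2 ≠ i → ∀ a b,
        ∀ q ∈ DivDiv.polysOn (DivDiv.edge v e) (l - 2),
          DivDiv.edgeMoment v e (m e a) (m e b) τ q = 0) →
      (∀ q ∈ DivDiv.polysOn (DivDiv.face v i) (l - 3),
        DivDiv.normalMoment v i (n i) τ q = 0) →
      (∀ q ∈ DivDiv.polysOn (DivDiv.face v i) (l - 1),
        DivDiv.trace₂Moment v i (n i) τ q = 0) →
      ∀ x ∈ DivDiv.face v i,
        MvPolynomial.eval x (DivDiv.comp (n i) τ (n i)) = 0 ∧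
        MvPolynomial.eval x (DivDiv.trace₂ (n i) τ) = 0) := by
  obtain ⟨b⟩ := DivDiv.exists_bary hv
  have hk1 : k - 1 ≤ l := (le_max_left _ _).trans hl
  have hl3 : 3 ≤ l := (le_max_right _ _).trans hl
  refine ⟨DivDiv.disjoint_curlPart_radialPart l k, ?_, ?_, ?_⟩
  · intro dV hV dE dN dT dH dC dF
    obtain ⟨D, hD⟩ := DivDiv.exists_dofMap b n m l k f₁
    have hinj : Function.Injective (D.domRestrict (DivDiv.shape l k)) := by
      rw [injective_iff_map_eq_zero]
      rintro ⟨τ, hτ⟩ h0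
      have h0 : D τ = 0 := h0
      obtain ⟨h1, h2, h3, h4, h5, h6, h7⟩ := hD τ
      simp only [h0, Prod.fst_zero, Prod.snd_zero, Pi.zero_apply, LinearMap.zero_apply]
        at h1 h2 h3 h4 h5 h6 h7
      refine Subtype.ext (DivDiv.eq_zero_of_dofs hv b hl hn hm f₁ hτ (fun δ => ?_)
        (fun e p q => (h2 e p q).symm) (fun i q => (h3 i q).symm) (fun i q => (h4 i q).symm)
        (fun ς => (h5 ς).symm) (fun ς => (h6 ς).symm) (fun q => (h7 q).symm))
      exact DivDiv.eq_of_entries (DivDiv.value_isSymm (DivDiv.transpose_of_mem_shape hτ) _)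
        Matrix.transpose_zero fun j => (h1 δ j).symm
    have hsurj : Function.Surjective (D.domRestrict (DivDiv.shape l k)) :=
      DivDiv.surjective_of_finrank_le (DivDiv.finite_and_finrank_dofValues_le b hk hl3 f₁) hinj
    -- The vertex matrices enter through six entries each; their symmetry recovers the full matrices
    -- afterwards.
    obtain ⟨⟨τ, hτ⟩, hDτ⟩ := hsurj (fun δ j => dV δ (DivDiv.entryPos j).1 (DivDiv.entryPos j).2,
      dE, dN, dT, dH, dC, dF)
    have hDτ : D τ = _ := hDτ
    obtain ⟨h1, h2, h3, h4, h5, h6, h7⟩ := hD τ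
    simp only [hDτ] at h1 h2 h3 h4 h5 h6 h7
    refine ⟨τ, ⟨hτ, fun δ => ?_, fun e p q => (h2 e p q).symm, fun i q => (h3 i q).symm,
      fun i q => (h4 i q).symm, fun ς => (h5 ς).symm, fun ς => (h6 ς).symm,
      fun q => (h7 q).symm⟩, ?_⟩
    · exact DivDiv.eq_of_entries (DivDiv.value_isSymm (DivDiv.transpose_of_mem_shape hτ) _)
        (hV δ) fun j => (h1 δ j).symm
    · rintro σ ⟨hσ, g1, g2, g3, g4, g5, g6, g7⟩
      obtain ⟨i1, i2, i3, i4, i5, i6, i7⟩ := hD σ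
      have hDσ : D σ = D τ := by
        rw [hDτ]
        refine Prod.ext ?_ (Prod.ext ?_ (Prod.ext ?_ (Prod.ext ?_ (Prod.ext ?_ (Prod.ext ?_ ?_)))))
        · exact funext fun δ => funext fun j => by rw [i1, g1]
        · exact funext fun e => funext fun p => LinearMap.ext fun q => by rw [i2, g2]
        · exact funext fun i => LinearMap.ext fun q => by rw [i3, g3]
        · exact funext fun i => LinearMap.ext fun q => by rw [i4, g4]
        · exact LinearMap.ext fun ς => by rw [i5, g5]
        · exact LinearMap.ext fun ς => by rw [i6, g6]
        · exact LinearMap.ext fun q => by rw [i7, g7]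
      exact congrArg Subtype.val (@hinj ⟨σ, hσ⟩ ⟨τ, hτ⟩ hDσ)
  · intro τ hτ e h1 h2 he a c
    exact DivDiv.comp_vanish_edge hv b (by omega) hm hτ h1 h2 he ((hm e).2 a) ((hm e).2 c)
  · intro τ hτ i hV hE hN hT
    exact DivDiv.traces_vanish_face hv b (by omega) hn hm hτ hV hE hN hT
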